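/- For $\alpha,\beta\in\mathbb F_2^n$ let $W(\alpha,\beta)=\bigotimes_{k=1}^n i^{-\alpha_k\beta_k}Z^{\alpha_k}X^{\beta_k}$ be the $n$-qubit Pauli operator with symplectic representation $(\alpha,\beta)\in\mathbb F_2^{2n}$. Let $H=\sum_{i=1}^m c_iP_i$, $m\ge 1$, where $c_i\in\mathbb R$ and $P_1,\dots,P_m$ are distinct, pairwise commuting $n$-qubit Pauli operators of this form, and let $B^\top\in\mathbb F_2^{2n\times m}$ be the matrix whose columns are their symplectic representations. A weight-$l$ decoding oracle for $H$ is a unitary $D$ on $m+2n$ qubits such that $D\,|y\rangle|B^\top y\rangle=|0\rangle|B^\top y\rangle$ for every $y\in\mathbb F_2^m$ of Hamming weight $1\le|y|\le l$. Let $\mathcal P(x)=\sum_{j=0}^l a_jx^j$ be a real polynomial of degree $l$ with $\mathcal P(H)\neq 0$. Theorem. There is a single quantum algorithm which, given $n,m,l$, the symplectic representations of the $P_i$, the coefficients $c_i$ and the $a_j$, prepares the state $$\rho_{\mathcal P}(H)=\frac{\mathcal P(H)^2}{\operatorname{Tr}\,\mathcal P(H)^2}$$ exactly, on a designated $n$-qubit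 register and with all other qubits traced out, using exactly one call to $D$, for every weight-$l$ decoding oracle $D$ for $H$. Its running time and its number of qubits are $O(m\cdot\mathrm{poly}(l,n))$, with the constant and the polynomial independent of all inputs. Here the algorithm is one fixed program of a random access machine which stores natural numbers (with addition and truncated subtraction) and real numbers (with rational constants, $+,-,\times,\div,\sqrt{\ }$), can compare them, and drives a quantum register initially in $|0\cdots0\rangle$. Each arithmetic operation, comparison and memory access, each arbitrary one-qubit unitary with at most two control qubits (its matrix entries being computed by the machine), and each oracle call takes $O(1)$ time; classical pre-processing is included in the running time. -/

import Mathlib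

open scoped BigOperators

noncomputable section

namespace HDQI

/-! ### Pauli operators and Pauli Hamiltonians

The computational basis of `k` qubits is indexed by `Fin k → ZMod 2`. -/

/-- The vector `(α, β) ∈ F₂^{2n}`: the `inl` coordinates are `α`, the `inr` coordinates are `β`. -/
abbrev PauliLabel (n : ℕ) : Type := Fin n ⊕ Fin n → ZMod 2

def pauliX : Matrix (ZMod 2) (ZMod 2) ℂ := Matrix.of fun x y => if x = y then 0 else 1

def pauliZ : Matrix (ZMod 2) (ZMod 2) ℂ := Matrix.diagonal fun x => if x = 0 then 1 else -1

/-- `W(α, β) = i^{-αβ} Z^α X^β` on one qubit. -/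
def pauliOne (a b : ZMod 2) : Matrix (ZMod 2) (ZMod 2) ℂ :=
  (Complex.I⁻¹ ^ (a.val * b.val)) • (pauliZ ^ a.val * pauliX ^ b.val)

/-- `W(α, β) = W(α₁, β₁) ⊗ ⋯ ⊗ W(αₙ, βₙ)`. -/
def pauli {n : ℕ} (v : PauliLabel n) : Matrix (Fin n → ZMod 2) (Fin n → ZMod 2) ℂ :=
  Matrix.of fun x y => ∏ k, pauliOne (v (Sum.inl k)) (v (Sum.inr k)) (x k) (y k)

/-- `H = ∑ᵢ cᵢ Pᵢ`, where `Pᵢ` is the Pauli operator with symplectic representation `v i`. -/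
def hamiltonian {n m : ℕ} (v : Fin m → PauliLabel n) (c : Fin m → ℝ) :
    Matrix (Fin n → ZMod 2) (Fin n → ZMod 2) ℂ :=
  ∑ i, (c i : ℂ) • pauli (v i)

/-- `ρ_P(H) = P(H)² / Tr P(H)²`. -/
def rhoP {n m : ℕ} (v : Fin m → PauliLabel n) (c : Fin m → ℝ) (P : Polynomial ℝ) :
    Matrix (Fin n → ZMod 2) (Fin n → ZMod 2) ℂ :=
  ((Polynomial.aeval (hamiltonian v c) P) ^ 2).trace⁻¹ •
    (Polynomial.aeval (hamiltonian v c) P) ^ 2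

/-! ### Decoding oracles -/

/-- The binary matrix `Bᵀ` of the Hamiltonian; its columns are the symplectic representations. -/
def sympMatrix {n m : ℕ} (v : Fin m → PauliLabel n) :
    Matrix (Fin n ⊕ Fin n) (Fin m) (ZMod 2) :=
  Matrix.of fun k i => v i k

/-- Basis labels of the `m + 2n` qubits on which a decoding oracle acts. -/
abbrev OracleLabel (n m : ℕ) : Type := (Fin m → ZMod 2) × PauliLabel n

/-- A weight-`l` decoding oracle: a unitary `D` with `D |y⟩|Bᵀy⟩ = |0⟩|Bᵀy⟩` for all `y` of
Hamming weight between `1` and `l`. On all other basis states `D` is unconstrained. -/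
def IsDecodingOracle {n m : ℕ} (v : Fin m → PauliLabel n) (l : ℕ)
    (D : Matrix (OracleLabel n m) (OracleLabel n m) ℂ) : Prop :=
  D ∈ Matrix.unitaryGroup (OracleLabel n m) ℂ ∧
    ∀ y : Fin m → ZMod 2, 1 ≤ hammingNorm y → hammingNorm y ≤ l →
      D.mulVec (Pi.single (y, (sympMatrix v).mulVec y) 1) =
        Pi.single (0, (sympMatrix v).mulVec y) 1

/-! ### Quantum circuits with an oracle gate

Qubits are numbered `0, 1, 2, …`. -/

/-- A gate is a one-qubit operation with a list of control qubits, or a call of the oracle. -/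
inductive Gate where
  | ctrl (controls : List ℕ) (target : ℕ) (U : Matrix (ZMod 2) (ZMod 2) ℂ)
  | oracle

def Gate.isOracle : Gate → Bool
  | .oracle => true
  | .ctrl _ _ _ => false

/-- Gates that may be used on `N` qubits: one-qubit unitaries with at most two controls (all
qubits involved being distinct qubits of the register), and the oracle. -/
def Gate.Valid (N : ℕ) : Gate → Prop
  | .oracle => True
  | .ctrl cs t U => cs.length ≤ 2 ∧ (t :: cs).Nodup ∧ (∀ q ∈ t :: cs, q < N) ∧
      U ∈ Matrix.unitaryGroup (ZMod 2) ℂ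

/-- The value of qubit `q` in the basis state `x` (and `0` if there is no such qubit). -/
def bit {N : ℕ} (x : Fin N → ZMod 2) (q : ℕ) : ZMod 2 := if h : q < N then x ⟨q, h⟩ else 0

/-- Registers: `A` is qubits `0, …, m-1`; `B` is qubits `m, …, m+n-1`; `C` is qubits
`m+n, …, m+2n-1`. The oracle acts on `A` and on `BC`, all other qubits are ancillas. -/
def regA {N : ℕ} (m : ℕ) (x : Fin N → ZMod 2) : Fin m → ZMod 2 := fun i => bit x i

def regB {N : ℕ} (m n : ℕ) (x : Fin N → ZMod 2) : Fin n → ZMod 2 := fun k => bit x (m + k)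

def regC {N : ℕ} (m n : ℕ) (x : Fin N → ZMod 2) : Fin n → ZMod 2 := fun k => bit x (m + n + k)

def oracleLabel {N : ℕ} (n m : ℕ) (x : Fin N → ZMod 2) : OracleLabel n m :=
  (regA m x, Sum.elim (regB m n x) (regC m n x))

open Classical in
/-- The `2^N × 2^N` matrix of a gate, the oracle being `D`. -/
def Gate.matrix {n m : ℕ} (D : Matrix (OracleLabel n m) (OracleLabel n m) ℂ) (N : ℕ) :
    Gate → Matrix (Fin N → ZMod 2) (Fin N → ZMod 2) ℂ
  | .ctrl cs t U => Matrix.of fun x y =>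
      if ∀ q ∈ cs, bit x q = 1 then
        (if ∀ q : Fin N, (q : ℕ) ≠ t → x q = y q then U (bit x t) (bit y t) else 0)
      else (if x = y then 1 else 0)
  | .oracle => Matrix.of fun x y =>
      if ∀ q : Fin N, m + 2 * n ≤ (q : ℕ) → x q = y q then
        D (oracleLabel n m x) (oracleLabel n m y) else 0

/-- The state vector after the gates of a circuit are applied, first gate first, to `|0…0⟩`. -/
def finalVector {n m : ℕ} (D : Matrix (OracleLabel n m) (OracleLabel n m) ℂ) (N : ℕ)
    (gates : List Gate) : (Fin N → ZMod 2) → ℂ :=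
  gates.foldl (fun ψ g => (g.matrix D N).mulVec ψ) (Pi.single 0 1)

open Classical in
/-- The reduced density matrix on register `B` of the final state of the circuit
(all other qubits are traced out). -/
def outputState {n m : ℕ} (D : Matrix (OracleLabel n m) (OracleLabel n m) ℂ) (N : ℕ)
    (gates : List Gate) : Matrix (Fin n → ZMod 2) (Fin n → ZMod 2) ℂ :=
  Matrix.of fun b b' => ∑ x : Fin N → ZMod 2, ∑ x' : Fin N → ZMod 2,
    if regB m n x = b ∧ regB m n x' = b' ∧
        (∀ q : Fin N, (q : ℕ) < m ∨ m + n ≤ (q : ℕ) → x q = x' q) then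
      finalVector D N gates x * star (finalVector D N gates x') else 0

/-! ### Algorithms: programs of a real random access machine that drive a quantum register

The machine has two-dimensional tables of natural numbers and of real numbers. Each arithmetic
operation, comparison and memory access, each gate and each oracle call is one step. -/

/-- Memory of the machine, with the list of gates applied so far (first gate first). -/
structure Store where
  nat : ℕ → ℕ → ℕ → ℕ
  real : ℕ → ℕ → ℕ → ℝ
  gates : List Gate

/-- Natural-number expressions; `read t i j` is the entry `(i, j)` of table `t`. -/
inductive NExpr where
  | const (k : ℕ)
  | read (t : ℕ) (i j : NExpr)
  | add (e f : NExpr)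
  | sub (e f : NExpr)

def NExpr.eval (σ : Store) : NExpr → ℕ
  | .const k => k
  | .read t i j => σ.nat t (i.eval σ) (j.eval σ)
  | .add e f => e.eval σ + f.eval σ
  | .sub e f => e.eval σ - f.eval σ

def NExpr.cost : NExpr → ℕ
  | .const _ => 1
  | .read _ i j => 1 + i.cost + j.cost
  | .add e f => 1 + e.cost + f.cost
  | .sub e f => 1 + e.cost + f.cost

/-- Real expressions: rational constants, memory access, the four operations, square root. -/
inductive RExpr where
  | const (q : ℚ)
  | read (t : ℕ) (i j : NExpr)
  | add (e f : RExpr)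
  | sub (e f : RExpr)
  | mul (e f : RExpr)
  | div (e f : RExpr)
  | sqrt (e : RExpr)

def RExpr.eval (σ : Store) : RExpr → ℝ
  | .const q => (q : ℝ)
  | .read t i j => σ.real t (i.eval σ) (j.eval σ)
  | .add e f => e.eval σ + f.eval σ
  | .sub e f => e.eval σ - f.eval σ
  | .mul e f => e.eval σ * f.eval σ
  | .div e f => e.eval σ / f.eval σ
  | .sqrt e => Real.sqrt (e.eval σ)

def RExpr.cost : RExpr → ℕ
  | .const _ => 1
  | .read _ i j => 1 + i.cost + j.cost
  | .add e f => 1 + e.cost + f.cost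
  | .sub e f => 1 + e.cost + f.cost
  | .mul e f => 1 + e.cost + f.cost
  | .div e f => 1 + e.cost + f.cost
  | .sqrt e => 1 + e.cost

inductive Test where
  | nle (e f : NExpr)
  | rle (e f : RExpr)

def Test.Holds (σ : Store) : Test → Prop
  | .nle e f => e.eval σ ≤ f.eval σ
  | .rle e f => e.eval σ ≤ f.eval σ

def Test.cost : Test → ℕ
  | .nle e f => 1 + e.cost + f.cost
  | .rle e f => 1 + e.cost + f.cost

/-- Programs. In `gate cs t u`, the pair `u a b` holds the real and the imaginary part of the
`(a, b)` entry of the one-qubit operation that is applied to qubit `t` with controls `cs`. -/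
inductive Cmd where
  | skip
  | seq (c d : Cmd)
  | setN (t : ℕ) (i j : NExpr) (e : NExpr)
  | setR (t : ℕ) (i j : NExpr) (e : RExpr)
  | ite (b : Test) (c d : Cmd)
  | while (b : Test) (c : Cmd)
  | gate (cs : List NExpr) (t : NExpr) (u : ZMod 2 → ZMod 2 → RExpr × RExpr)
  | oracle

def Store.setN (σ : Store) (t i j k : ℕ) : Store :=
  { σ with nat := fun t' i' j' => if t' = t ∧ i' = i ∧ j' = j then k else σ.nat t' i' j' }

def Store.setR (σ : Store) (t i j : ℕ) (x : ℝ) : Store :=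
  { σ with real := fun t' i' j' =>
      if t' = t ∧ i' = i ∧ j' = j then x else σ.real t' i' j' }

def Store.emit (σ : Store) (g : Gate) : Store := { σ with gates := σ.gates ++ [g] }

def evalUnitary (σ : Store) (u : ZMod 2 → ZMod 2 → RExpr × RExpr) :
    Matrix (ZMod 2) (ZMod 2) ℂ :=
  Matrix.of fun a b => ⟨(u a b).1.eval σ, (u a b).2.eval σ⟩

def gateCost (cs : List NExpr) (t : NExpr) (u : ZMod 2 → ZMod 2 → RExpr × RExpr) : ℕ :=
  1 + (cs.map NExpr.cost).sum + t.cost + ∑ a, ∑ b, ((u a b).1.cost + (u a b).2.cost)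

/-- `Exec c σ T τ`: started in `σ`, the program `c` halts in `τ` after `T` steps. -/
inductive Exec : Cmd → Store → ℕ → Store → Prop
  | skip (σ : Store) : Exec .skip σ 1 σ
  | seq {c d : Cmd} {σ τ υ : Store} {S T : ℕ} :
      Exec c σ S τ → Exec d τ T υ → Exec (.seq c d) σ (S + T) υ
  | setN (t : ℕ) (i j e : NExpr) (σ : Store) :
      Exec (.setN t i j e) σ (1 + i.cost + j.cost + e.cost)
        (σ.setN t (i.eval σ) (j.eval σ) (e.eval σ))
  | setR (t : ℕ) (i j : NExpr) (e : RExpr) (σ : Store) :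
      Exec (.setR t i j e) σ (1 + i.cost + j.cost + e.cost)
        (σ.setR t (i.eval σ) (j.eval σ) (e.eval σ))
  | ite_true {b : Test} {c d : Cmd} {σ τ : Store} {T : ℕ} :
      b.Holds σ → Exec c σ T τ → Exec (.ite b c d) σ (b.cost + T) τ
  | ite_false {b : Test} {c d : Cmd} {σ τ : Store} {T : ℕ} :
      ¬ b.Holds σ → Exec d σ T τ → Exec (.ite b c d) σ (b.cost + T) τ
  | while_true {b : Test} {c : Cmd} {σ τ υ : Store} {S T : ℕ} :
      b.Holds σ → Exec c σ S τ → Exec (.while b c) τ T υ →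
        Exec (.while b c) σ (b.cost + S + T) υ
  | while_false {b : Test} {c : Cmd} {σ : Store} :
      ¬ b.Holds σ → Exec (.while b c) σ b.cost σ
  | gate (cs : List NExpr) (t : NExpr) (u : ZMod 2 → ZMod 2 → RExpr × RExpr) (σ : Store) :
      Exec (.gate cs t u) σ (gateCost cs t u)
        (σ.emit (.ctrl (cs.map (NExpr.eval σ)) (t.eval σ) (evalUnitary σ u)))
  | oracle (σ : Store) : Exec .oracle σ 1 (σ.emit .oracle)

/-- The input: natural table `0` holds `n, m, l` in row `0`; natural tables `1` and `2` hold the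
`α` and `β` parts of the symplectic representation of the `i`-th term in row `i`; real tables
`0` and `1` hold the `c i` and the coefficients `a j` in row `0`. All else is `0`, and no gate has
been applied. -/
def inputStore {n m : ℕ} (l : ℕ) (v : Fin m → PauliLabel n) (c : Fin m → ℝ) (a : ℕ → ℝ) :
    Store where
  nat := fun t i j =>
    match t with
    | 0 => if i = 0 then (match j with | 0 => n | 1 => m | 2 => l | _ => 0) else 0
    | 1 => if h : i < m ∧ j < n then (v ⟨i, h.1⟩ (Sum.inl ⟨j, h.2⟩)).val else 0
    | 2 => if h : i < m ∧ j < n then (v ⟨i, h.1⟩ (Sum.inr ⟨j, h.2⟩)).val else 0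
    | _ => 0
  real := fun t i j =>
    match t with
    | 0 => if h : i = 0 ∧ j < m then c ⟨j, h.2⟩ else 0
    | 1 => if i = 0 ∧ j ≤ l then a j else 0
    | _ => 0
  gates := []

end HDQI

end

/-! Vectorise the operator. Hadamards on register B followed by CNOTs into C send a basis state (a,
b) of BC to 2^{-n/2} times the vector of matrix entries of Z^a X^b (`run_bellPairs`, `run_bell`).
Write P(H) = ∑_S w_S ∏_{i∈S} P_i and ∏_{i∈S} P_i = θ_S Z^a X^b, where (a, b) is the syndrome of S.
If BC is brought to a multiple of ∑_S w_S θ_S |a, b⟩, disentangled from all else, the Bell circuit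
yields κ times the vectorisation of P(H). Tracing out C gives |κ|² P(H) P(H)† = |κ|² P(H)².
Unitarity forces trace one (`sum_norm_run`, `trace_outputState`), so Tr P(H)² never has to be
computed.

The weights w_S. The P_i commute and square to 1, so the Taylor formula P^{(k)}(x + h) = ∑_d x^d/d!
· P^{(k+d)}(h) with x = c_i P_i gives a recursion over pairs (number of terms treated, order k ≤ l
of the derivative); see `sum_amp_opProd`. Thus the w_S are the amplitudes of a matrix product state
of bond dimension l + 1. Its bond index is carried by a walker in unary encoding on 2(l + 1) qubits.
Classically, each transfer step is followed by an elimination with Givens rotations, which makes the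
matrix lower triangular again (`sweep_lower`) and so keeps the bond dimension at l + 1. The circuit
plays the rotations backwards (`run_sites`). It can start with the walker at 0 because row 0 of the
last triangular matrix has a single nonzero entry at most (`run_prep`). The angles cost O(l³)
operations for each term, besides the O(n) spent on recognising identity terms.

Decoding. Controlled Pauli operators write the syndrome into BC together with the phase θ_S
(`run_syndrome`). Every S of nonzero weight has at most l elements, none of them an identity term
(`amp_support`), so the oracle erases A, except for S = ∅, where it is unconstrained. Unitarity of D
implies that the other S have nonzero syndrome (`synd_ne_zero`). Hence a flag for a zero syndrome
recognises S = ∅; under this flag the term 0 is inserted into A and BC before the call, and its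
syndrome is removed afterwards (`run_decode`).

For l = 0 the oracle is an arbitrary unitary and the required state is maximally mixed. It suffices
to apply D to one half of a maximally entangled state (`outputState_constCirc`).

Running time. The predicate `Runs` bounds the steps of a program together with its effect;
`exec_algorithm` collects the bounds and identifies the emitted circuit. -/

noncomputable section

namespace HDQI

/-! ### A program logic with time bounds -/

/-- Contents of the real tables. -/
abbrev Mem : Type := ℕ → ℕ → ℕ → ℝ

/-- `τ` differs from `σ` in the natural tables at most in the loop counters with index `≥ r`. -/
def Agree (r : ℕ) (σ τ : Store) : Prop :=
  ∀ t i j, (t = 3 → i < r) → τ.nat t i j = σ.nat t i j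

theorem Agree.refl (r : ℕ) (σ : Store) : Agree r σ σ := fun _ _ _ _ => rfl

theorem Agree.trans {r : ℕ} {σ τ υ : Store} (h : Agree r σ τ) (h' : Agree r τ υ) :
    Agree r σ υ := fun t i j hr => (h' t i j hr).trans (h t i j hr)

theorem Agree.mono {r s : ℕ} {σ τ : Store} (h : Agree s σ τ) (hrs : r ≤ s) : Agree r σ τ :=
  fun t i j hr => h t i j fun ht => (hr ht).trans_le hrs

/-- Started in `σ`, the program `c` halts within `B` steps; it emits the gates `G`, leaves real
tables satisfying `Q`, and changes no natural number except loop counters with index `≥ r`. -/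
def Runs (r : ℕ) (c : Cmd) (σ : Store) (B : ℕ) (Q : Mem → Prop) (G : List Gate) : Prop :=
  ∃ T τ, Exec c σ T τ ∧ T ≤ B ∧ Agree r σ τ ∧ Q τ.real ∧ τ.gates = σ.gates ++ G

variable {r : ℕ} {σ : Store} {Q : Mem → Prop}

theorem Runs.mono {c : Cmd} {B B' : ℕ} {Q' : Mem → Prop} {G : List Gate}
    (h : Runs r c σ B Q G) (hB : B ≤ B') (hQ : ∀ ρ, Q ρ → Q' ρ) : Runs r c σ B' Q' G := by
  obtain ⟨T, τ, h1, h2, h3, h4, h5⟩ := h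
  exact ⟨T, τ, h1, h2.trans hB, h3, hQ _ h4, h5⟩

theorem Runs.weaken {c : Cmd} {C C' Y : ℕ} {G : List Gate}
    (h : Runs r c σ (C * Y) Q G) (hC : C ≤ C') : Runs r c σ (C' * Y) Q G :=
  h.mono (Nat.mul_le_mul_right _ hC) fun _ h => h

theorem Runs.raise {c : Cmd} {C Y Y' : ℕ} {G : List Gate}
    (h : Runs r c σ (C * Y) Q G) (hY : Y ≤ Y') : Runs r c σ (C * Y') Q G :=
  h.mono (Nat.mul_le_mul_left _ hY) fun _ h => h

theorem Runs.skip (C : ℕ) {Y : ℕ} (hY : 1 ≤ Y) (hC : 1 ≤ C) (hQ : Q σ.real) :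
    Runs r .skip σ (C * Y) Q [] :=
  ⟨1, σ, .skip σ, Nat.mul_pos hC hY, .refl _ _, hQ, by simp⟩

/-- Time bounds have the form constant times `Y`. With a common `Y`, sequencing only adds the
constants; `Runs.raise` lifts a cheaper block to the larger `Y` of its neighbour. -/
theorem Runs.seq {c d : Cmd} {C₁ C₂ Y : ℕ} {Q₁ : Mem → Prop} {G₁ G₂ : List Gate}
    (h₁ : Runs r c σ (C₁ * Y) Q₁ G₁)
    (h₂ : ∀ τ, Agree r σ τ → Q₁ τ.real → Runs r d τ (C₂ * Y) Q G₂) :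
    Runs r (.seq c d) σ ((C₁ + C₂) * Y) Q (G₁ ++ G₂) := by
  obtain ⟨S, τ, e₁, b₁, a₁, q₁, g₁⟩ := h₁
  obtain ⟨T, υ, e₂, b₂, a₂, q₂, g₂⟩ := h₂ τ a₁ q₁
  exact ⟨S + T, υ, e₁.seq e₂, by rw [Nat.add_mul]; exact add_le_add b₁ b₂, a₁.trans a₂, q₂,
    by rw [g₂, g₁, List.append_assoc]⟩

theorem Runs.seq_right {c d : Cmd} {C₁ C₂ Y : ℕ} {Q₁ : Mem → Prop} {G : List Gate}
    (h₁ : Runs r c σ (C₁ * Y) Q₁ [])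
    (h₂ : ∀ τ, Agree r σ τ → Q₁ τ.real → Runs r d τ (C₂ * Y) Q G) :
    Runs r (.seq c d) σ ((C₁ + C₂) * Y) Q G :=
  h₁.seq h₂

/-- The real tables `ρ` with entry `(i, j)` of table `t` replaced by `x`. -/
def setMem (ρ : Mem) (t i j : ℕ) (x : ℝ) : Mem :=
  fun t' i' j' => if t' = t ∧ i' = i ∧ j' = j then x else ρ t' i' j'

theorem Runs.setR {t C Y : ℕ} {i j : NExpr} {e : RExpr} (hY : 1 ≤ Y)
    (hC : 1 + i.cost + j.cost + e.cost ≤ C)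
    (hQ : Q (setMem σ.real t (i.eval σ) (j.eval σ) (e.eval σ))) :
    Runs r (.setR t i j e) σ (C * Y) Q [] :=
  ⟨_, _, .setR t i j e σ, hC.trans (Nat.le_mul_of_pos_right _ hY), fun _ _ _ _ => rfl, hQ,
    by simp [Store.setR]⟩

theorem Runs.gate {cs : List NExpr} {t : NExpr} {u : ZMod 2 → ZMod 2 → RExpr × RExpr}
    {C Y : ℕ} {g : Gate} (hY : 1 ≤ Y) (hC : gateCost cs t u ≤ C)
    (hg : .ctrl (cs.map (NExpr.eval σ)) (t.eval σ) (evalUnitary σ u) = g) (hQ : Q σ.real) :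
    Runs r (.gate cs t u) σ (C * Y) Q [g] :=
  ⟨_, _, .gate cs t u σ, hC.trans (Nat.le_mul_of_pos_right _ hY), fun _ _ _ _ => rfl, hQ,
    by simp [Store.emit, hg]⟩

theorem Runs.oracle {C Y : ℕ} (hY : 1 ≤ Y) (hC : 1 ≤ C) (hQ : Q σ.real) :
    Runs r .oracle σ (C * Y) Q [.oracle] :=
  ⟨1, _, .oracle σ, Nat.mul_pos hC hY, fun _ _ _ _ => rfl, hQ, by simp [Store.emit]⟩

theorem Runs.ite {b : Test} {c d : Cmd} {C C' Y : ℕ} {G : List Gate} (hY : 1 ≤ Y)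
    (hC : C + b.cost ≤ C')
    (h₁ : b.Holds σ → Runs r c σ (C * Y) Q G) (h₂ : ¬ b.Holds σ → Runs r d σ (C * Y) Q G) :
    Runs r (.ite b c d) σ (C' * Y) Q G := by
  have key : ∀ T, T ≤ C * Y → b.cost + T ≤ C' * Y := fun T hT => by nlinarith
  by_cases hb : b.Holds σ
  · obtain ⟨T, τ, h1, h2, h3⟩ := h₁ hb
    exact ⟨_, τ, .ite_true hb h1, key _ h2, h3⟩
  · obtain ⟨T, τ, h1, h2, h3⟩ := h₂ hb
    exact ⟨_, τ, .ite_false hb h1, key _ h2, h3⟩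

/-- The counter of the `r`-th loop. -/
def ctr (r : ℕ) : NExpr := .read 3 (.const r) (.const 0)

/-- The counter of the `r`-th loop, multiplied by its stride. -/
def acc (r : ℕ) : NExpr := .read 3 (.const r) (.const 1)

@[simp] theorem ctr_eval (r : ℕ) (σ : Store) : (ctr r).eval σ = σ.nat 3 r 0 := rfl
@[simp] theorem acc_eval (r : ℕ) (σ : Store) : (acc r).eval σ = σ.nat 3 r 1 := rfl
@[simp] theorem ctr_cost (r : ℕ) : (ctr r).cost = 3 := rfl
@[simp] theorem acc_cost (r : ℕ) : (acc r).cost = 3 := rfl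

/-- The body of a counting loop, followed by the update of the counters. -/
def loopBody (r : ℕ) (w : NExpr) (body : Cmd) : Cmd :=
  .seq body (.seq (.setN 3 (.const r) (.const 0) (.add (ctr r) (.const 1)))
    (.setN 3 (.const r) (.const 1) (.add (acc r) w)))

/-- Repeat `body` with counter `0, 1, …, e - 1`. -/
def forLoop (r : ℕ) (e w : NExpr) (body : Cmd) : Cmd :=
  .seq (.setN 3 (.const r) (.const 0) (.const 0)) (.seq (.setN 3 (.const r) (.const 1) (.const 0))
    (.while (.nle (.add (ctr r) (.const 1)) e) (loopBody r w body)))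

/-- Induction on the number `d` of rounds left, for an arbitrary current counter `j`. A round costs,
besides its body, 6 + `e.cost` for the test and 8 and 7 + `w.cost` for the two updates; the last
summand is the final, failing test. -/
theorem Runs.while_aux {e w : NExpr} {body : Cmd} {k s B : ℕ} {I : ℕ → Mem → Prop}
    {G : ℕ → List Gate} {σ₀ : Store}
    (hk : ∀ τ, Agree r σ₀ τ → e.eval τ = k) (hs : ∀ τ, Agree r σ₀ τ → w.eval τ = s)
    (hb : ∀ j < k, ∀ τ, Agree r σ₀ τ → τ.nat 3 r 0 = j → τ.nat 3 r 1 = j * s → I j τ.real →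
      Runs (r + 1) body τ B (I (j + 1)) (G j)) (d : ℕ) :
    ∀ j σ, j + d = k → Agree r σ₀ σ → σ.nat 3 r 0 = j → σ.nat 3 r 1 = j * s → I j σ.real →
      ∃ T τ, Exec (.while (.nle (.add (ctr r) (.const 1)) e) (loopBody r w body)) σ T τ ∧
        T ≤ d * (B + (21 + e.cost + w.cost)) + (6 + e.cost) ∧ Agree r σ₀ τ ∧ I k τ.real ∧
        τ.gates = σ.gates ++ (List.range' j d).flatMap G := by
  induction d with
  | zero =>
    intro j σ hj ha h0 h1 hI
    refine ⟨_, σ, .while_false ?_, ?_, ha, ?_, by simp⟩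
    · simp only [Test.Holds, NExpr.eval, ctr_eval, hk _ ha]; omega
    · simp [Test.cost, NExpr.cost]
    · rw [← hj]; exact hI
  | succ d ih =>
    intro j σ hj ha h0 h1 hI
    obtain ⟨T, τ, e1, b1, a1, q1, g1⟩ := hb j (by omega) σ ha h0 h1 hI
    have ha' : Agree r σ₀ τ := ha.trans (a1.mono (by omega))
    have hw := hs _ ha'
    have n0 : τ.nat 3 r 0 = j := by rw [a1 3 r 0 (by omega), h0]
    have n1 : τ.nat 3 r 1 = j * s := by rw [a1 3 r 1 (by omega), h1]
    set τ₁ := τ.setN 3 r 0 (j + 1) with hτ₁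
    have e2 : Exec (.setN 3 (.const r) (.const 0) (.add (ctr r) (.const 1))) τ 8 τ₁ := by
      have := Exec.setN 3 (.const r) (.const 0) (.add (ctr r) (.const 1)) τ
      simpa [NExpr.cost, NExpr.eval, n0] using this
    have ha1 : Agree r σ₀ τ₁ := ha'.trans fun t i j' h => by
      simp only [hτ₁, Store.setN]; rw [if_neg]; rintro ⟨rfl, rfl, rfl⟩; have := h rfl; omega
    set τ₂ := τ₁.setN 3 r 1 ((j + 1) * s) with hτ₂
    have e3 : Exec (.setN 3 (.const r) (.const 1) (.add (acc r) w)) τ₁ (7 + w.cost) τ₂ := by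
      have := Exec.setN 3 (.const r) (.const 1) (.add (acc r) w) τ₁
      have h' : (NExpr.add (acc r) w).eval τ₁ = (j + 1) * s := by
        simp only [NExpr.eval, acc_eval, hs _ ha1]
        simp [hτ₁, Store.setN, n1]; ring
      rw [h'] at this
      convert this using 1
      · simp [NExpr.cost]; omega
      · rfl
    have ha2 : Agree r σ₀ τ₂ := ha1.trans fun t i j' h => by
      simp only [hτ₂, Store.setN]; rw [if_neg]; rintro ⟨rfl, rfl, rfl⟩; have := h rfl; omega
    obtain ⟨T', υ, e4, b4, a4, q4, g4⟩ := ih (j + 1) τ₂ (by omega) ha2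
      (by simp [hτ₂, hτ₁, Store.setN]) (by simp [hτ₂, Store.setN]) q1
    refine ⟨_, υ, .while_true ?_ (e1.seq (e2.seq e3)) e4, ?_, a4, q4, ?_⟩
    · simp only [Test.Holds, NExpr.eval, ctr_eval, hk _ ha]; omega
    · simp only [Test.cost, NExpr.cost, ctr_cost]
      rw [Nat.succ_mul]; omega
    · rw [g4]
      simp [hτ₂, hτ₁, Store.setN, g1, List.range'_succ]

/-- The rule for counting loops. -/
theorem Runs.loop {e w : NExpr} {body : Cmd} {k s C Y : ℕ} {I : ℕ → Mem → Prop}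
    {G : ℕ → List Gate} (z : ℕ)
    (hk : ∀ τ, Agree r σ τ → e.eval τ = k) (hs : ∀ τ, Agree r σ τ → w.eval τ = s)
    (hkz : k ≤ z) (hz : 1 ≤ z) (hY : 1 ≤ Y) (hcost : e.cost + w.cost ≤ 30) (h0 : I 0 σ.real)
    (hb : ∀ j < k, ∀ τ, Agree r σ τ → τ.nat 3 r 0 = j → τ.nat 3 r 1 = j * s → I j τ.real →
      Runs (r + 1) body τ (C * Y) (I (j + 1)) (G j)) :
    Runs r (forLoop r e w body) σ ((C + 100) * (z * Y)) (I k) ((List.range k).flatMap G) := by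
  set σ₁ := σ.setN 3 r 0 0 with hσ₁
  set σ₂ := σ₁.setN 3 r 1 0 with hσ₂
  have ha : Agree r σ σ₂ := fun t i j h => by
    simp only [hσ₂, hσ₁, Store.setN]
    rw [if_neg, if_neg] <;> (rintro ⟨rfl, rfl, rfl⟩; have := h rfl; omega)
  obtain ⟨T, τ, e1, b1, a1, q1, g1⟩ := Runs.while_aux hk hs hb k 0 σ₂ (by omega) ha
    (by simp [hσ₂, hσ₁, Store.setN]) (by simp [hσ₂, hσ₁, Store.setN]) h0
  have e2 : Exec (.setN 3 (.const r) (.const 0) (.const 0)) σ 4 σ₁ :=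
    Exec.setN 3 (.const r) (.const 0) (.const 0) σ
  have e3 : Exec (.setN 3 (.const r) (.const 1) (.const 0)) σ₁ 4 σ₂ :=
    Exec.setN 3 (.const r) (.const 1) (.const 0) σ₁
  refine ⟨_, τ, e2.seq (e3.seq e1), ?_, a1, q1, ?_⟩
  -- `hcost` bounds the overhead of a round by 21 + 30 = 51; the two initialisations and the failing
  -- test together stay below 49.
  · have h1 : k * (C * Y + (21 + e.cost + w.cost)) ≤ z * (C * Y + 51 * Y) :=
      Nat.mul_le_mul hkz (by omega)
    have h2 : 1 ≤ z * Y := Nat.mul_pos hz hY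
    calc _ ≤ z * (C * Y + 51 * Y) + 49 := by omega
      _ = C * (z * Y) + 51 * (z * Y) + 49 := by ring
      _ ≤ (C + 100) * (z * Y) := by rw [Nat.add_mul]; omega
  · rw [g1, List.range_eq_range']; rfl

/-- The rule for loops that only emit gates. -/
theorem Runs.loop_emit {e w : NExpr} {body : Cmd} {k s C Y : ℕ} {ρ : Mem}
    {G : ℕ → List Gate} (z : ℕ)
    (hk : ∀ τ, Agree r σ τ → e.eval τ = k) (hs : ∀ τ, Agree r σ τ → w.eval τ = s)
    (hkz : k ≤ z) (hz : 1 ≤ z) (hY : 1 ≤ Y) (hcost : e.cost + w.cost ≤ 30) (h0 : σ.real = ρ)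
    (hb : ∀ j < k, ∀ τ, Agree r σ τ → τ.nat 3 r 0 = j → τ.nat 3 r 1 = j * s → τ.real = ρ →
      Runs (r + 1) body τ (C * Y) (· = ρ) (G j)) :
    Runs r (forLoop r e w body) σ ((C + 100) * (z * Y)) (· = ρ) ((List.range k).flatMap G) :=
  Runs.loop (I := fun _ => (· = ρ)) z hk hs hkz hz hY hcost h0 hb

/-! ### The circuit -/

/-- The size parameters and the input tables. -/
structure Par where
  n : ℕ
  m : ℕ
  l : ℕ
  α : ℕ → ℕ → ℕ
  β : ℕ → ℕ → ℕ
  c : ℕ → ℝ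
  a : ℕ → ℝ

/-- `f (k - 1) ++ ⋯ ++ f 0`. -/
def desc (f : ℕ → List Gate) : ℕ → List Gate
  | 0 => []
  | k + 1 => f k ++ desc f k

theorem flatMap_range_sub (f : ℕ → List Gate) (k : ℕ) :
    (List.range k).flatMap (fun j => f (k - 1 - j)) = desc f k := by
  induction k with
  | zero => rfl
  | succ k ih =>
    rw [List.range_succ_eq_map, List.flatMap_cons, List.flatMap_map, desc, ← ih]
    congr 1
    refine congrArg (fun g => (List.range k).flatMap g) (funext fun j => ?_)
    congr 1
    simp only [Nat.succ_eq_add_one]; omega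

/-! ### Taylor coefficients and elimination by plane rotations. -/

section Angles

/-- The coefficients of `x^y t^d` (`y = 0, 1`) in `exp (c x t)` modulo `x² = 1` (for `ν = 1`), or
modulo `x = 1` (for `ν = 0`). -/
def expCoef (c ν : ℝ) : ℕ → ℝ × ℝ
  | 0 => (1, 0)
  | d + 1 => (c / (d + 1 : ℝ) * (ν * (expCoef c ν d).2 + (1 - ν) * (expCoef c ν d).1),
      c / (d + 1 : ℝ) * (ν * (expCoef c ν d).1))

/-- The transfer step: from the bond matrix of a site to the matrix of its pairs
(value of the site, bond index) at the next one. -/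
def transfer (L : ℕ) (E : ℕ → ℝ × ℝ) (R : ℕ → ℕ → ℝ) : ℕ → ℕ → ℝ := fun k s =>
  if k < L then
    if s < L then R k s + ∑ d ∈ Finset.range L, (E (d + 1)).1 * R (k + (d + 1)) s
    else if s < L + L then
      R k s + ∑ d ∈ Finset.range L, (E (d + 1)).2 * R (k + (d + 1)) (s - L)
    else R k s
  else R k s

def normSqG (M : ℕ → ℕ → ℝ) (p q : ℕ) : ℝ := M p p * M p p + M p q * M p q

/-- When both entries vanish nothing has to be eliminated and the identity rotation is chosen, so
the pair is a cosine and a sine in every case. -/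
def cosG (M : ℕ → ℕ → ℝ) (p q : ℕ) : ℝ :=
  if normSqG M p q ≤ 0 then 1 else M p p / √(normSqG M p q)

def sinG (M : ℕ → ℕ → ℝ) (p q : ℕ) : ℝ :=
  if normSqG M p q ≤ 0 then 0 else M p q / √(normSqG M p q)

/-- The rotation of the columns `p` and `q` that eliminates the entry `(p, q)`. -/
def rot (L : ℕ) (M : ℕ → ℕ → ℝ) (p q : ℕ) : ℕ → ℕ → ℝ := fun k s =>
  if k < L then
    if s = p then cosG M p q * M k p + sinG M p q * M k q
    else if s = q then cosG M p q * M k q - sinG M p q * M k p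
    else M k s
  else M k s

/-- Elimination of row `p` in the columns `p + 1, …, q - 1`. -/
def sweepRow (L : ℕ) (M : ℕ → ℕ → ℝ) (p : ℕ) : ℕ → ℕ → ℕ → ℝ
  | 0 => M
  | q + 1 => if q ≤ p then sweepRow L M p q else rot L (sweepRow L M p q) p q

/-- Elimination of the first rows. -/
def sweep (L : ℕ) (M : ℕ → ℕ → ℝ) : ℕ → ℕ → ℕ → ℝ
  | 0 => M
  | p + 1 => sweepRow L (sweep L M p) p (L + L)

end Angles

namespace Par

variable (p : Par)

/-- `L` is the bond dimension: the bond index is the order 0, …, l of a derivative. The walker has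
`W` = 2`L` positions, one for each pair (bit of a term, bond index); position `L + s` stands for bit
1 and index `s`. -/
abbrev L : ℕ := p.l + 1
abbrev W : ℕ := p.L + p.L
/-- Qubits of the walker. -/
abbrev wq (s : ℕ) : ℕ := p.m + (p.n + p.n) + s
/-- Qubits of the flag ladder. -/
abbrev gq (j : ℕ) : ℕ := p.m + (p.n + p.n) + p.W + j

/-- The `i`-th term is not the identity. -/
def Nontriv (i : ℕ) : Prop := ∃ k < p.n, 1 ≤ p.α i k ∨ 1 ≤ p.β i k

-- An identity term has syndrome zero, so the set consisting of it could not be told apart from ∅.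
-- Such terms are absorbed into the scalar weights and never set a bit.
open Classical in
def nontriv (i : ℕ) : ℝ := if p.Nontriv i then 1 else 0

def coef (i : ℕ) : ℕ → ℝ × ℝ := expCoef (p.c i) (p.nontriv i)

/-- The bond matrices, in triangular form. -/
def bond : ℕ → ℕ → ℕ → ℝ
  -- The entry k! a_k is the k-th derivative of the polynomial at 0.
  | 0 => fun k s => if s = 0 ∧ k < p.L then (Nat.factorial k : ℝ) * p.a k else 0
  | i + 1 => sweep p.L (transfer p.L (p.coef i) (bond i)) p.L

/-- The matrix before the elimination of the entry `(r, q)` at the `i`-th site. -/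
def stage (i r q : ℕ) : ℕ → ℕ → ℝ :=
  sweepRow p.L (sweep p.L (transfer p.L (p.coef i) (p.bond i)) r) r q

def cosA (i r q : ℕ) : ℝ := cosG (p.stage i r q) r q
def sinA (i r q : ℕ) : ℝ := sinG (p.stage i r q) r q

end Par

/-! ### The gates and the building blocks of the circuit. -/

def hadamard : Matrix (ZMod 2) (ZMod 2) ℂ :=
  Matrix.of fun a b => ((√2)⁻¹ : ℝ) * if a = 1 ∧ b = 1 then -1 else 1

def rotation (c s : ℝ) : Matrix (ZMod 2) (ZMod 2) ℂ :=
  Matrix.of fun a b => if a = b then (c : ℂ) else if a = 0 then (s : ℂ) else (-s : ℂ)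

def phaseMat : Matrix (ZMod 2) (ZMod 2) ℂ := Matrix.of fun a b => if a = b then -Complex.I else 0

abbrev Gate.x (cs : List ℕ) (t : ℕ) : Gate := .ctrl cs t pauliX

namespace Par

variable (p : Par)

/-- At most one qubit of the walker is set. The CNOTs therefore turn the controlled rotation into a
rotation in the plane of the positions `r` and `q` that fixes all other positions. -/
def givens (i r q : ℕ) : List Gate :=
  if q ≤ r then [] else
    [.x [p.wq r] (p.wq q), .ctrl [p.wq q] (p.wq r) (rotation (p.cosA i r q) (p.sinA i r q)),
      .x [p.wq r] (p.wq q)]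

/-- Splits the position `L + s` into bit and index: bit `i` is set, the walker is copied to `s`, and
the Toffoli gate clears the old position. -/
def merge (i s : ℕ) : List Gate :=
  [.x [p.wq (p.L + s)] i, .x [p.wq (p.L + s)] (p.wq s), .x [i, p.wq s] (p.wq (p.L + s))]

/-- The rotations come in descending order because the circuit undoes the elimination, beginning
with its last rotation. -/
def siteCirc (i : ℕ) : List Gate :=
  desc (fun r => desc (p.givens i r) p.W) p.L ++ (List.range p.L).flatMap (p.merge i)

/-- Left multiplication of Z^a X^b by a Pauli operator adds labels, up to a scalar. The sign from
moving X past Z^a depends on the label before the addition, so the Z gate precedes the X gates; the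
scalar -i belongs to the factors with both parts. -/
def pauliCirc (i k : ℕ) : List Gate :=
  (if 1 ≤ p.β i k then [.ctrl [i] (p.m + k) pauliZ] else []) ++
    ((if 1 ≤ p.α i k then [.x [i] (p.m + k)] else []) ++
      ((if 1 ≤ p.β i k then [.x [i] (p.m + (p.n + k))] else []) ++
        (if 1 ≤ p.α i k then (if 1 ≤ p.β i k then [.ctrl [i] (p.m + k) phaseMat] else [])
          else [])))

/-- The two gates together add g_j (1 + u_j) to g_{j+1}, so the ladder accumulates the indicator of
u_0 = ⋯ = u_j = 0. -/
def ladder (j : ℕ) : List Gate :=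
  [.x [p.gq j] (p.gq (j + 1)), .x [p.gq j, p.m + j] (p.gq (j + 1))]

def flagShift (k : ℕ) : List Gate :=
  (if 1 ≤ p.α 0 k then [.x [p.gq (p.n + p.n)] (p.m + k)] else []) ++
    (if 1 ≤ p.β 0 k then [.x [p.gq (p.n + p.n)] (p.m + (p.n + k))] else [])

end Par

def bellPair (s t : ℕ) : List Gate := [.ctrl [] s hadamard, .x [s] t]

namespace Par

variable (p : Par)

def prepCirc : List Gate := [.x [] (p.wq 0)] ++ desc p.siteCirc p.m

def syndromeCirc : List Gate :=
  (List.range p.m).flatMap fun i => (List.range p.n).flatMap (p.pauliCirc i)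

/-- The oracle is unconstrained at y = 0. Where the syndrome vanishes, this replaces the input (0,
0) by the legitimate pair consisting of the unit vector of term 0 and its symplectic representation.
-/
def flagCirc : List Gate :=
  [.x [] (p.gq 0)] ++ ((List.range (p.n + p.n)).flatMap p.ladder ++
    ([.x [p.gq (p.n + p.n)] 0] ++ (List.range p.n).flatMap p.flagShift))

def unflagCirc : List Gate :=
  (List.range p.n).flatMap p.flagShift ++ desc p.ladder (p.n + p.n)

def bellCirc : List Gate :=
  (List.range p.n).flatMap fun k => bellPair (p.m + k) (p.m + (p.n + k))

def mainCirc : List Gate :=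
  p.prepCirc ++ (p.syndromeCirc ++ (p.flagCirc ++ ([.oracle] ++ (p.unflagCirc ++ p.bellCirc))))

/-- The circuit for polynomials of degree zero. -/
def constCirc : List Gate :=
  (List.range (p.m + (p.n + p.n))).flatMap (fun q => bellPair (p.m + (p.n + p.n) + q) q) ++
    [.oracle]

/-- Replacing y = 0 by a vector of weight one needs l ≥ 1; for l = 0 the oracle satisfies no
condition but unitarity. -/
def circuit : List Gate := if 1 ≤ p.l then p.mainCirc else p.constCirc

end Par

/-! ### The program: emission of the circuit -/

/-- The natural tables hold the input and the product `l * W`. -/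
structure Env (p : Par) (σ : Store) : Prop where
  hn : σ.nat 0 0 0 = p.n
  hm : σ.nat 0 0 1 = p.m
  hl : σ.nat 0 0 2 = p.l
  hd : σ.nat 4 0 0 = p.l * p.W
  hα : ∀ i k, σ.nat 1 i k = p.α i k
  hβ : ∀ i k, σ.nat 2 i k = p.β i k

theorem Env.of_agree {p : Par} {r : ℕ} {σ τ : Store} (h : Env p σ) (ha : Agree r σ τ) :
    Env p τ where
  hn := (ha 0 0 0 (by simp)).trans h.hn
  hm := (ha 0 0 1 (by simp)).trans h.hm
  hl := (ha 0 0 2 (by simp)).trans h.hl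
  hd := (ha 4 0 0 (by simp)).trans h.hd
  hα i k := (ha 1 i k (by simp)).trans (h.hα i k)
  hβ i k := (ha 2 i k (by simp)).trans (h.hβ i k)

def eN : NExpr := .read 0 (.const 0) (.const 0)
def eM : NExpr := .read 0 (.const 0) (.const 1)
def el : NExpr := .read 0 (.const 0) (.const 2)
def eL : NExpr := .add el (.const 1)
def eW : NExpr := .add eL eL
def eD : NExpr := .read 4 (.const 0) (.const 0)
def eα (i k : NExpr) : NExpr := .read 1 i k
def eβ (i k : NExpr) : NExpr := .read 2 i k
def eB (k : NExpr) : NExpr := .add eM k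
def eC (k : NExpr) : NExpr := .add eM (.add eN k)
def ew (s : NExpr) : NExpr := .add (.add eM (.add eN eN)) s
def eg (j : NExpr) : NExpr := .add (.add (.add eM (.add eN eN)) eW) j

section Eval

variable {p : Par} {σ : Store} (h : Env p σ)
include h

theorem Env.eN : eN.eval σ = p.n := h.hn
theorem Env.eM : eM.eval σ = p.m := h.hm
theorem Env.el : el.eval σ = p.l := h.hl
theorem Env.eL : eL.eval σ = p.L := by simp [HDQI.eL, NExpr.eval, h.el]
theorem Env.eW : eW.eval σ = p.W := by simp [HDQI.eW, NExpr.eval, h.eL]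
theorem Env.eD : eD.eval σ = p.l * p.W := h.hd
theorem Env.eα (i k : NExpr) : (eα i k).eval σ = p.α (i.eval σ) (k.eval σ) := h.hα _ _
theorem Env.eβ (i k : NExpr) : (eβ i k).eval σ = p.β (i.eval σ) (k.eval σ) := h.hβ _ _
theorem Env.eB (k : NExpr) : (eB k).eval σ = p.m + k.eval σ := by
  simp [HDQI.eB, NExpr.eval, h.eM]
theorem Env.eC (k : NExpr) : (eC k).eval σ = p.m + (p.n + k.eval σ) := by
  simp [HDQI.eC, NExpr.eval, h.eM, h.eN]
theorem Env.ew (k : NExpr) : (ew k).eval σ = p.wq (k.eval σ) := by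
  simp [HDQI.ew, NExpr.eval, h.eM, h.eN]
theorem Env.eg (k : NExpr) : (eg k).eval σ = p.gq (k.eval σ) := by
  simp [HDQI.eg, NExpr.eval, h.eM, h.eN, h.eW]

end Eval

def uX : ZMod 2 → ZMod 2 → RExpr × RExpr := fun a b => (if a = b then .const 0 else .const 1, .const 0)
def uZ : ZMod 2 → ZMod 2 → RExpr × RExpr := fun a b =>
  (if a = b then (if a = 0 then .const 1 else .const (-1)) else .const 0, .const 0)
def uH : ZMod 2 → ZMod 2 → RExpr × RExpr := fun a b =>
  (.mul (.div (.const 1) (.sqrt (.const 2))) (.const (if a = 1 ∧ b = 1 then -1 else 1)), .const 0)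
def uPhase : ZMod 2 → ZMod 2 → RExpr × RExpr := fun a b =>
  (.const 0, .const (if a = b then -1 else 0))
def uRot (c s : RExpr) : ZMod 2 → ZMod 2 → RExpr × RExpr := fun a b =>
  (if a = b then c else if a = 0 then s else .sub (.const 0) s, .const 0)

theorem evalUnitary_uX (σ : Store) : evalUnitary σ uX = pauliX := by
  ext a b
  by_cases h : a = b <;> simp [evalUnitary, uX, pauliX, h, RExpr.eval, Complex.ext_iff]

theorem evalUnitary_uZ (σ : Store) : evalUnitary σ uZ = pauliZ := by
  ext a b
  by_cases h : a = b
  · subst h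
    by_cases h : a = 0 <;> simp [evalUnitary, uZ, pauliZ, h, RExpr.eval, Complex.ext_iff]
  · simp [evalUnitary, uZ, pauliZ, h, RExpr.eval, Complex.ext_iff]

theorem evalUnitary_uH (σ : Store) : evalUnitary σ uH = hadamard := by
  ext a b
  by_cases h : a = 1 ∧ b = 1 <;>
    simp [evalUnitary, uH, hadamard, h, RExpr.eval, Complex.ext_iff] <;>
    rw [Real.sqrt_div_self', one_div]

theorem evalUnitary_uPhase (σ : Store) : evalUnitary σ uPhase = phaseMat := by
  ext a b
  by_cases h : a = b <;> simp [evalUnitary, uPhase, phaseMat, h, RExpr.eval, Complex.ext_iff]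

theorem evalUnitary_uRot (σ : Store) (c s : RExpr) :
    evalUnitary σ (uRot c s) = rotation (c.eval σ) (s.eval σ) := by
  ext a b
  by_cases h : a = b
  · simp [evalUnitary, uRot, rotation, h, Complex.ext_iff, RExpr.eval]
  · by_cases h' : a = 0
    · subst h'; simp [evalUnitary, uRot, rotation, h, RExpr.eval, Complex.ext_iff]
    · simp [evalUnitary, uRot, rotation, h, h', RExpr.eval, Complex.ext_iff]

def cX (cs : List NExpr) (t : NExpr) : Cmd := .gate cs t uX

section Emit

variable {r : ℕ} {σ : Store}

/-- Execute `c` if the natural number `e` is positive. -/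
def guardPos (e : NExpr) (c : Cmd) : Cmd := .ite (.nle (.const 1) e) c .skip

theorem Runs.whenPos {e : NExpr} {c : Cmd} {C C' Y x : ℕ} {G : List Gate} {ρ : Mem} (hY : 1 ≤ Y)
    (hC : C + (2 + e.cost) ≤ C') (hC1 : 1 ≤ C) (hx : e.eval σ = x) (hQ : σ.real = ρ)
    (h₁ : Runs r c σ (C * Y) (· = ρ) G) :
    Runs r (guardPos e c) σ (C' * Y) (· = ρ) (if 1 ≤ x then G else []) := by
  refine Runs.ite hY (C := C) (by simpa [Test.cost, NExpr.cost, add_assoc] using hC) ?_ ?_ <;>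
    simp only [Test.Holds, NExpr.eval, hx] <;> intro h
  · rwa [if_pos h]
  · rw [if_neg h]; exact Runs.skip C hY hC1 hQ

end Emit

def bellCmd (s t : NExpr) : Cmd := .seq (.gate [] s uH) (cX [s] t)

def givensCmd (i r q a : NExpr) : Cmd :=
  .ite (.nle q r) .skip
    (.seq (cX [ew r] (ew q)) (.seq (.gate [ew q] (ew r) (uRot (.read 5 i a) (.read 6 i a)))
      (cX [ew r] (ew q))))

def mergeCmd (i s : NExpr) : Cmd :=
  .seq (cX [ew (.add eL s)] i) (.seq (cX [ew (.add eL s)] (ew s)) (cX [i, ew s] (ew (.add eL s))))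

/-- Loop counters increase while these parts of the circuit run downwards, hence the reflected
indices. In `eA` the row offset is l·`W` minus the accumulated multiple of `W`, since the machine
cannot multiply natural numbers. -/
def eI : NExpr := .sub (.sub eM (.const 1)) (ctr 0)
def eR : NExpr := .sub (.sub eL (.const 1)) (ctr 1)
def eQ : NExpr := .sub (.sub eW (.const 1)) (ctr 2)
def eA : NExpr := .add (.sub eD (acc 1)) eQ

def siteCmd : Cmd :=
  .seq (forLoop 1 eL eW (forLoop 2 eW (.const 0) (givensCmd eI eR eQ eA)))
    (forLoop 1 eL (.const 0) (mergeCmd eI (ctr 1)))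

def prepCmd : Cmd := .seq (cX [] (ew (.const 0))) (forLoop 0 eM (.const 0) siteCmd)

def pauliCmd (i k : NExpr) : Cmd :=
  .seq (guardPos (eβ i k) (.gate [i] (eB k) uZ))
    (.seq (guardPos (eα i k) (cX [i] (eB k)))
      (.seq (guardPos (eβ i k) (cX [i] (eC k)))
        (guardPos (eα i k) (guardPos (eβ i k) (.gate [i] (eB k) uPhase)))))

def syndromeCmd : Cmd :=
  forLoop 0 eM (.const 0) (forLoop 1 eN (.const 0) (pauliCmd (ctr 0) (ctr 1)))

def ladderCmd (j : NExpr) : Cmd :=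
  .seq (cX [eg j] (eg (.add j (.const 1)))) (cX [eg j, eB j] (eg (.add j (.const 1))))

def shiftCmd (k : NExpr) : Cmd :=
  .seq (guardPos (eα (.const 0) k) (cX [eg (.add eN eN)] (eB k)))
    (guardPos (eβ (.const 0) k) (cX [eg (.add eN eN)] (eC k)))

def flagCmd : Cmd :=
  .seq (cX [] (eg (.const 0))) (.seq (forLoop 0 (.add eN eN) (.const 0) (ladderCmd (ctr 0)))
    (.seq (cX [eg (.add eN eN)] (.const 0)) (forLoop 0 eN (.const 0) (shiftCmd (ctr 0)))))

def unflagCmd : Cmd :=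
  .seq (forLoop 0 eN (.const 0) (shiftCmd (ctr 0)))
    (forLoop 0 (.add eN eN) (.const 0)
      (ladderCmd (.sub (.sub (.add eN eN) (.const 1)) (ctr 0))))

def bellLoopCmd : Cmd := forLoop 0 eN (.const 0) (bellCmd (eB (ctr 0)) (eC (ctr 0)))

def mainCmd : Cmd :=
  .seq prepCmd (.seq syndromeCmd (.seq flagCmd (.seq .oracle (.seq unflagCmd bellLoopCmd))))

def constCmd : Cmd :=
  .seq (forLoop 0 (.add eM (.add eN eN)) (.const 0)
    (bellCmd (.add (.add eM (.add eN eN)) (ctr 0)) (ctr 0))) .oracle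

/-! ### Correctness and cost of the emission of the circuit. -/

section EmitRuns

variable {p : Par} {r : ℕ} {σ τ : Store} {ρ : Mem} {Y : ℕ}

/-- One size parameter for all loops but those over the terms: the lengths `n`, `n + n`, `L` and `W`
are at most 2`X`. -/
abbrev Par.X (p : Par) : ℕ := p.l + p.n + 1

theorem Par.bounds (p : Par) : 1 ≤ p.X ∧ p.n ≤ p.X ∧ p.n + p.n ≤ 2 * p.X ∧ p.L ≤ p.X ∧
    p.W ≤ 2 * p.X := by
  simp only [Par.X, Par.W, Par.L]; omega

/-- The expression `e` has the value `v`, whatever the counters with index `≥ r` are. -/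
def Val (r : ℕ) (σ : Store) (e : NExpr) (v : ℕ) : Prop := ∀ τ, Agree r σ τ → e.eval τ = v

theorem Val.eval {e : NExpr} {v : ℕ} (h : Val r σ e v) : e.eval σ = v := h σ (.refl _ _)

theorem Val.of_agree {e : NExpr} {v : ℕ} (h : Val r σ e v) (ha : Agree r σ τ) : Val r τ e v :=
  fun _ h' => h _ (ha.trans h')

theorem Val.mono {e : NExpr} {v r' : ℕ} (h : Val r σ e v) (hr : r ≤ r') : Val r' σ e v :=
  fun _ h' => h _ (h'.mono hr)

theorem Val.const (v : ℕ) : Val r σ (.const v) v := fun _ _ => rfl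

theorem Val.add {e f : NExpr} {v w : ℕ} (h : Val r σ e v) (h' : Val r σ f w) :
    Val r σ (.add e f) (v + w) := fun τ ha => congrArg₂ (· + ·) (h τ ha) (h' τ ha)

theorem Val.sub {e f : NExpr} {v w : ℕ} (h : Val r σ e v) (h' : Val r σ f w) :
    Val r σ (.sub e f) (v - w) := fun τ ha => congrArg₂ (· - ·) (h τ ha) (h' τ ha)

theorem Val.ctr {j v : ℕ} (hj : j < r) (h : σ.nat 3 j 0 = v) : Val r σ (ctr j) v :=
  fun _ ha => (ha 3 j 0 fun _ => hj).trans h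

theorem Val.acc {j v : ℕ} (hj : j < r) (h : σ.nat 3 j 1 = v) : Val r σ (acc j) v :=
  fun _ ha => (ha 3 j 1 fun _ => hj).trans h

section Env

variable (h : Env p σ)
include h

theorem Env.vN : Val r σ HDQI.eN p.n := fun _ ha => (h.of_agree ha).eN
theorem Env.vM : Val r σ HDQI.eM p.m := fun _ ha => (h.of_agree ha).eM
theorem Env.vL : Val r σ HDQI.eL p.L := fun _ ha => (h.of_agree ha).eL
theorem Env.vW : Val r σ HDQI.eW p.W := fun _ ha => (h.of_agree ha).eW
theorem Env.vD : Val r σ HDQI.eD (p.l * p.W) := fun _ ha => (h.of_agree ha).eD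

variable {e f : NExpr} {v w : ℕ} (he : Val r σ e v)
include he

theorem Env.vB : Val r σ (HDQI.eB e) (p.m + v) :=
  fun τ ha => by rw [(h.of_agree ha).eB, he τ ha]
theorem Env.vC : Val r σ (HDQI.eC e) (p.m + (p.n + v)) :=
  fun τ ha => by rw [(h.of_agree ha).eC, he τ ha]
theorem Env.vw : Val r σ (HDQI.ew e) (p.wq v) :=
  fun τ ha => by rw [(h.of_agree ha).ew, he τ ha]
theorem Env.vg : Val r σ (HDQI.eg e) (p.gq v) :=
  fun τ ha => by rw [(h.of_agree ha).eg, he τ ha]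
theorem Env.vα (hf : Val r σ f w) : Val r σ (HDQI.eα e f) (p.α v w) :=
  fun τ ha => by rw [(h.of_agree ha).eα, he τ ha, hf τ ha]
theorem Env.vβ (hf : Val r σ f w) : Val r σ (HDQI.eβ e f) (p.β v w) :=
  fun τ ha => by rw [(h.of_agree ha).eβ, he τ ha, hf τ ha]

end Env

theorem Runs.gate₀ {t : NExpr} {t' : ℕ} {u : ZMod 2 → ZMod 2 → RExpr × RExpr}
    {U : Matrix (ZMod 2) (ZMod 2) ℂ} (hY : 1 ≤ Y) (ht : Val r σ t t') (hu : evalUnitary σ u = U)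
    (hC : gateCost [] t u ≤ 500) (hρ : σ.real = ρ) :
    Runs r (.gate [] t u) σ (500 * Y) (· = ρ) [.ctrl [] t' U] :=
  Runs.gate hY hC (by simp [ht.eval, hu]) hρ

theorem Runs.gate₁ {s t : NExpr} {s' t' : ℕ} {u : ZMod 2 → ZMod 2 → RExpr × RExpr}
    {U : Matrix (ZMod 2) (ZMod 2) ℂ} (hY : 1 ≤ Y) (hs : Val r σ s s') (ht : Val r σ t t')
    (hu : evalUnitary σ u = U)
    (hC : gateCost [s] t u ≤ 500) (hρ : σ.real = ρ) :
    Runs r (.gate [s] t u) σ (500 * Y) (· = ρ) [.ctrl [s'] t' U] :=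
  Runs.gate hY hC (by simp [ht.eval, hs.eval, hu]) hρ

theorem Runs.gate₂ {q s t : NExpr} {q' s' t' : ℕ} {u : ZMod 2 → ZMod 2 → RExpr × RExpr}
    {U : Matrix (ZMod 2) (ZMod 2) ℂ} (hY : 1 ≤ Y) (hq : Val r σ q q') (hs : Val r σ s s')
    (ht : Val r σ t t') (hu : evalUnitary σ u = U)
    (hC : gateCost [q, s] t u ≤ 500) (hρ : σ.real = ρ) :
    Runs r (.gate [q, s] t u) σ (500 * Y) (· = ρ) [.ctrl [q', s'] t' U] :=
  Runs.gate hY hC (by simp [ht.eval, hs.eval, hq.eval, hu]) hρ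

theorem Runs.when {e : NExpr} {c : Cmd} {C C' x : ℕ} {G : List Gate} (hY : 1 ≤ Y)
    (hx : Val r σ e x) (hC : C + (2 + e.cost) ≤ C') (hC1 : 1 ≤ C) (hQ : σ.real = ρ)
    (h₁ : Runs r c σ (C * Y) (· = ρ) G) :
    Runs r (guardPos e c) σ (C' * Y) (· = ρ) (if 1 ≤ x then G else []) :=
  Runs.whenPos hY hC hC1 hx.eval hQ h₁

theorem runs_bell {s t : NExpr} {s' t' : ℕ} (hs : Val r σ s s') (ht : Val r σ t t')
    (hc : gateCost [] s uH ≤ 500) (hc' : gateCost [s] t uX ≤ 500) (hρ : σ.real = ρ) :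
    Runs r (bellCmd s t) σ (1000 * 1) (· = ρ) (bellPair s' t') :=
  Runs.seq (C₁ := 500) (C₂ := 500) (Runs.gate₀ le_rfl hs (evalUnitary_uH σ) hc hρ)
    fun τ ha hτ => Runs.gate₁ le_rfl (hs.of_agree ha) (ht.of_agree ha) (evalUnitary_uX τ) hc' hτ

variable (h : Env p σ)
include h

theorem Env.vI (hr : 1 ≤ r) {v : ℕ} (h0 : σ.nat 3 0 0 = v) :
    Val r σ eI (p.m - 1 - v) :=
  (h.vM.sub (.const 1)).sub (.ctr (by omega) h0)

theorem Env.vR (hr : 2 ≤ r) {v : ℕ} (h0 : σ.nat 3 1 0 = v) :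
    Val r σ eR (p.L - 1 - v) :=
  (h.vL.sub (.const 1)).sub (.ctr (by omega) h0)

theorem Env.vQ (hr : 3 ≤ r) {v : ℕ} (h0 : σ.nat 3 2 0 = v) :
    Val r σ eQ (p.W - 1 - v) :=
  (h.vW.sub (.const 1)).sub (.ctr (by omega) h0)

/-- The angles are stored in the real tables `5` and `6`. -/
def Angles (p : Par) (ρ : Mem) : Prop := ∀ i < p.m, ∀ t < p.L, ∀ q < p.W, t < q →
  ρ 5 i (t * p.W + q) = p.cosA i t q ∧ ρ 6 i (t * p.W + q) = p.sinA i t q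

theorem runs_givens (hρa : Angles p ρ) {i t q : ℕ} (hi : i < p.m) (ht : t < p.L) (hq : q < p.W)
    (vi : Val 3 σ eI i) (vt : Val 3 σ eR t) (vq : Val 3 σ eQ q)
    (va : Val 3 σ eA (t * p.W + q)) (hρ : σ.real = ρ) :
    Runs 3 (givensCmd eI eR eQ eA) σ (2000 * 1) (· = ρ) (p.givens i t q) := by
  unfold givensCmd Par.givens
  refine Runs.ite le_rfl (C := 1900) (by decide) (fun hb => ?_) (fun hb => ?_) <;>
    simp only [Test.Holds, vt.eval, vq.eval] at hb
  · rw [if_pos hb]; exact Runs.skip _ le_rfl (by norm_num) hρ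
  · rw [if_neg hb]
    obtain ⟨h5, h6⟩ := hρa i hi t ht q hq (by omega)
    refine (Runs.seq (C₁ := 500) (C₂ := 1000) (Runs.gate₁ le_rfl (h.vw vt) (h.vw vq)
      (evalUnitary_uX σ) (by decide) hρ) fun τ ha hτ => ?_).weaken (by norm_num)
    have h' := h.of_agree ha
    refine Runs.seq (C₁ := 500) (C₂ := 500) (G₁ := [_]) (Runs.gate₁ le_rfl (h'.vw (vq.of_agree ha))
      (h'.vw (vt.of_agree ha)) ?_ (by decide) hτ) fun υ ha' hυ => ?_
    · rw [evalUnitary_uRot]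
      simp only [RExpr.eval, vi τ ha, va τ ha, hτ, h5, h6]
    · exact Runs.gate₁ le_rfl ((h.vw vt).of_agree (ha.trans ha'))
        ((h.vw vq).of_agree (ha.trans ha')) (evalUnitary_uX _) (by decide) hυ

theorem runs_merge {i s : ℕ} (vi : Val 2 σ eI i) (vs : Val 2 σ (ctr 1) s) (hρ : σ.real = ρ) :
    Runs 2 (mergeCmd eI (ctr 1)) σ (1500 * 1) (· = ρ) (p.merge i s) := by
  have v1 := h.vw (h.vL.add vs)
  have v2 := h.vw vs
  refine Runs.seq (C₁ := 500) (C₂ := 1000) (G₁ := [_])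
    (Runs.gate₁ le_rfl v1 vi (evalUnitary_uX σ) (by decide) hρ) fun τ ha hτ => ?_
  refine Runs.seq (C₁ := 500) (C₂ := 500) (G₁ := [_])
    (Runs.gate₁ le_rfl (v1.of_agree ha) (v2.of_agree ha) (evalUnitary_uX _) (by decide) hτ)
      fun υ ha' hυ => ?_
  have ha := ha.trans ha'
  exact Runs.gate₂ le_rfl (vi.of_agree ha) (v2.of_agree ha) (v1.of_agree ha) (evalUnitary_uX _)
    (by decide) hυ

theorem runs_site (hρa : Angles p ρ) {j : ℕ} (hj : j < p.m) (h0 : σ.nat 3 0 0 = j)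
    (hρ : σ.real = ρ) :
    Runs 1 siteCmd σ (5000 * (p.X * (2 * p.X * 1))) (· = ρ) (p.siteCirc (p.m - 1 - j)) := by
  obtain ⟨x1, x2, x3, x4, x5⟩ := p.bounds
  unfold Par.siteCirc
  rw [← flatMap_range_sub]
  refine (Runs.seq (C₁ := 2200) (C₂ := 1600) (Q₁ := (· = ρ)) ?_ fun τ ha hτ => ?_).weaken (by norm_num)
  · refine Runs.loop_emit (C := 2100) p.X (fun τ ha => h.vL τ ha) (fun τ ha => h.vW τ ha)
      (by omega) (by omega) (by omega) (by decide) hρ fun t ht τ ha n0 n1 hτ => ?_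
    rw [← flatMap_range_sub]
    refine Runs.loop_emit (C := 2000) (2 * p.X) (fun τ' ha' => (h.of_agree ha).vW τ' ha')
      (Val.const 0) (by omega) (by omega) (by omega) (by decide) hτ fun q hq υ ha' n0' n1' hυ => ?_
    have h' := (h.of_agree ha).of_agree ha'
    have e0 : υ.nat 3 1 0 = t := (ha' 3 1 0 (by omega)).trans n0
    have e1 : υ.nat 3 1 1 = t * p.W := (ha' 3 1 1 (by omega)).trans n1
    have e2 : υ.nat 3 0 0 = j :=
      (ha' 3 0 0 (by omega)).trans ((ha 3 0 0 (by omega)).trans h0)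
    refine runs_givens h' hρa (by omega) (by omega) (by omega) (h'.vI (by norm_num) e2)
      (h'.vR (by norm_num) e0) (h'.vQ (by norm_num) n0') ?_ hυ
    -- (l - t)·`W` + (`W` - 1 - q) is the address of the reflected pair, because `L` - 1 = l.
    have := (h'.vD.sub (Val.acc (j := 1) (r := 3) (by norm_num) e1)).add
      (h'.vQ (by norm_num) n0')
    rw [← Nat.sub_mul] at this
    exact this
  · have h' := h.of_agree ha
    have e2 : τ.nat 3 0 0 = j := (ha 3 0 0 (by omega)).trans h0
    refine (Runs.loop_emit (C := 1500) p.X (fun τ ha => h'.vL τ ha) (Val.const 0)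
      (by omega) (by omega) le_rfl (by decide) hτ fun s hs υ ha' n0 n1 hυ => ?_).raise (by gcongr; omega)
    have e3 : υ.nat 3 0 0 = j := (ha' 3 0 0 (by omega)).trans e2
    exact runs_merge (h'.of_agree ha') ((h'.of_agree ha').vI (by norm_num) e3)
      (Val.ctr (by norm_num) n0) hυ

theorem runs_prep (hm : 1 ≤ p.m) (hρa : Angles p ρ) (hρ : σ.real = ρ) :
    Runs 0 prepCmd σ (6000 * (p.m * (p.X * (2 * p.X * 1)))) (· = ρ) p.prepCirc := by
  obtain ⟨x1, x2, x3, x4, x5⟩ := p.bounds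
  unfold Par.prepCirc
  rw [← flatMap_range_sub]
  have hY : 1 ≤ p.m * (p.X * (2 * p.X * 1)) :=
    Nat.mul_pos hm (Nat.mul_pos (by omega) (by omega))
  refine (Runs.seq (C₁ := 500) (C₂ := 5100) (Runs.gate₀ hY (h.vw (.const 0)) (evalUnitary_uX σ)
    (by decide) hρ) fun τ ha hτ => ?_).weaken (by norm_num)
  have h' := h.of_agree ha
  exact Runs.loop_emit (C := 5000) p.m (fun τ ha => h'.vM τ ha) (Val.const 0) le_rfl hm
    (Nat.mul_pos (by omega) (by omega)) (by decide) hτ fun j hj υ ha' n0 n1 hυ =>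
    runs_site (h'.of_agree ha') hρa hj n0 hυ

theorem runs_pauli {i k : ℕ} (vi : Val 2 σ (ctr 0) i) (vk : Val 2 σ (ctr 1) k)
    (hρ : σ.real = ρ) :
    Runs 2 (pauliCmd (ctr 0) (ctr 1)) σ (3000 * 1) (· = ρ) (p.pauliCirc i k) := by
  refine (Runs.seq (C₁ := 600) (C₂ := 2000) (Runs.when le_rfl (h.vβ vi vk) (by decide) (by norm_num)
    hρ (Runs.gate₁ le_rfl vi (h.vB vk) (evalUnitary_uZ σ) (by decide) hρ)) fun τ ha hτ =>
    ?_).weaken (by norm_num)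
  have h := h.of_agree ha
  have vi := vi.of_agree ha
  have vk := vk.of_agree ha
  refine (Runs.seq (C₁ := 600) (C₂ := 1400) (Runs.when le_rfl (h.vα vi vk) (by decide) (by norm_num)
    hτ (Runs.gate₁ le_rfl vi (h.vB vk) (evalUnitary_uX τ) (by decide) hτ)) fun υ ha hυ => ?_)
  have h := h.of_agree ha
  have vi := vi.of_agree ha
  have vk := vk.of_agree ha
  refine (Runs.seq (C₁ := 600) (C₂ := 800) (Runs.when le_rfl (h.vβ vi vk) (by decide) (by norm_num)
    hυ (Runs.gate₁ le_rfl vi (h.vC vk) (evalUnitary_uX υ) (by decide) hυ)) fun σ ha hρ => ?_)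
  have h := h.of_agree ha
  have vi := vi.of_agree ha
  have vk := vk.of_agree ha
  exact Runs.when (C := 600) le_rfl (h.vα vi vk) (by decide) (by norm_num) hρ
    (Runs.when le_rfl (h.vβ vi vk) (by decide) (by norm_num) hρ
      (Runs.gate₁ le_rfl vi (h.vB vk) (evalUnitary_uPhase σ) (by decide) hρ))

theorem runs_syndrome (hm : 1 ≤ p.m) (hρ : σ.real = ρ) :
    Runs 0 syndromeCmd σ (3200 * (p.m * (p.X * 1))) (· = ρ) p.syndromeCirc := by
  obtain ⟨x1, x2, x3, x4, x5⟩ := p.bounds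
  exact Runs.loop_emit (C := 3100) p.m (fun τ ha => h.vM τ ha) (Val.const 0) le_rfl hm
    (by omega) (by decide) hρ fun i hi τ ha n0 n1 hτ =>
    Runs.loop_emit (C := 3000) p.X (fun τ' ha' => (h.of_agree ha).vN τ' ha') (Val.const 0)
      (by omega) (by omega) le_rfl (by decide) hτ fun k hk υ ha' n0' n1' hυ =>
      runs_pauli ((h.of_agree ha).of_agree ha')
        (Val.ctr (by norm_num) ((ha' 3 0 0 (by omega)).trans n0)) (Val.ctr (by norm_num) n0') hυ

theorem runs_ladder {e : NExpr} {j : ℕ} (ve : Val 1 σ e j)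
    (h₁ : gateCost [eg e] (eg (.add e (.const 1))) uX ≤ 500)
    (h₂ : gateCost [eg e, eB e] (eg (.add e (.const 1))) uX ≤ 500)
    (hρ : σ.real = ρ) :
    Runs 1 (ladderCmd e) σ (1000 * 1) (· = ρ) (p.ladder j) :=
  Runs.seq (C₁ := 500) (C₂ := 500) (Runs.gate₁ le_rfl (h.vg ve) (h.vg (ve.add (.const 1)))
    (evalUnitary_uX σ) h₁ hρ) fun τ ha hτ =>
    Runs.gate₂ le_rfl ((h.vg ve).of_agree ha) ((h.vB ve).of_agree ha)
      ((h.vg (ve.add (.const 1))).of_agree ha) (evalUnitary_uX τ) h₂ hτ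

theorem runs_shift (hρ : σ.real = ρ) :
    Runs 0 (forLoop 0 eN (.const 0) (shiftCmd (ctr 0))) σ (1300 * (p.X * 1)) (· = ρ)
      ((List.range p.n).flatMap p.flagShift) := by
  obtain ⟨x1, x2, x3, x4, x5⟩ := p.bounds
  refine Runs.loop_emit (C := 1200) p.X (fun τ ha => h.vN τ ha) (Val.const 0) (by omega)
    (by omega) le_rfl (by decide) hρ fun k hk τ ha n0 n1 hτ => ?_
  have h := h.of_agree ha
  have vk : Val 1 τ (ctr 0) k := Val.ctr (by norm_num) n0
  have vg := h.vg (h.vN.add (h.vN (r := 1)))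
  exact Runs.seq (C₁ := 600) (C₂ := 600)
    (Runs.when le_rfl (h.vα (.const 0) vk) (by decide) (by norm_num) hτ
      (Runs.gate₁ le_rfl vg (h.vB vk) (evalUnitary_uX τ) (by decide) hτ)) fun υ ha hυ =>
    Runs.when le_rfl ((h.vβ (.const 0) vk).of_agree ha) (by decide) (by norm_num) hυ
      (Runs.gate₁ le_rfl (vg.of_agree ha) ((h.vC vk).of_agree ha) (evalUnitary_uX υ)
        (by decide) hυ)

theorem runs_flag (hρ : σ.real = ρ) :
    Runs 0 flagCmd σ (4000 * (2 * p.X * 1)) (· = ρ) p.flagCirc := by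
  obtain ⟨x1, x2, x3, x4, x5⟩ := p.bounds
  refine (Runs.seq (C₁ := 500) (C₂ := 3000) (Runs.gate₀ (by omega) (h.vg (.const 0))
    (evalUnitary_uX σ) (by decide) hρ) fun τ ha hτ => ?_).weaken (by norm_num)
  have h := h.of_agree ha
  refine Runs.seq (C₁ := 1100) (C₂ := 1900) (Runs.loop_emit (C := 1000) (2 * p.X)
    (fun τ ha => (h.vN.add h.vN) τ ha) (Val.const 0) (by omega) (by omega) le_rfl (by decide) hτ
    fun j hj τ ha n0 n1 hτ => runs_ladder (h.of_agree ha) (Val.ctr (by norm_num) n0)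
      (by decide) (by decide) hτ) fun υ ha' hυ => ?_
  have h := h.of_agree ha'
  refine (Runs.seq (C₁ := 500) (C₂ := 1300) (Runs.gate₁ (by omega) (h.vg (h.vN.add h.vN))
    (.const 0) (evalUnitary_uX υ) (by decide) hυ) fun σ' ha hσ => ?_).weaken (by norm_num)
  exact (runs_shift (h.of_agree ha) hσ).raise (by omega)

theorem runs_unflag (hρ : σ.real = ρ) :
    Runs 0 unflagCmd σ (3000 * (2 * p.X * 1)) (· = ρ) p.unflagCirc := by
  obtain ⟨x1, x2, x3, x4, x5⟩ := p.bounds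
  unfold Par.unflagCirc
  rw [← flatMap_range_sub]
  refine (Runs.seq (C₁ := 1300) (C₂ := 1100) ((runs_shift h hρ).raise (by omega))
    fun τ ha hτ => ?_).weaken (by norm_num)
  have h := h.of_agree ha
  exact Runs.loop_emit (C := 1000) (2 * p.X)
    (fun τ ha => (h.vN.add h.vN) τ ha) (Val.const 0) (by omega) (by omega) le_rfl (by decide) hτ
    fun j hj τ ha n0 n1 hτ => by
      have h := h.of_agree ha
      exact runs_ladder h (((h.vN.add h.vN).sub (.const 1)).sub (Val.ctr (by norm_num) n0))
        (by decide) (by decide) hτ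

theorem runs_bellLoop (hρ : σ.real = ρ) :
    Runs 0 bellLoopCmd σ (1100 * (p.X * 1)) (· = ρ) p.bellCirc := by
  obtain ⟨x1, x2, x3, x4, x5⟩ := p.bounds
  exact Runs.loop_emit (C := 1000) p.X (fun τ ha => h.vN τ ha) (Val.const 0) (by omega)
    (by omega) le_rfl (by decide) hρ fun k hk τ ha n0 n1 hτ =>
    runs_bell ((h.of_agree ha).vB (Val.ctr (by norm_num) n0))
      ((h.of_agree ha).vC (Val.ctr (by norm_num) n0)) (by decide) (by decide) hτ

theorem runs_main (hm : 1 ≤ p.m) (hρa : Angles p ρ) (hρ : σ.real = ρ) :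
    Runs 0 mainCmd σ (20000 * (p.m * (p.X * (2 * p.X * 1)))) (· = ρ) p.mainCirc := by
  obtain ⟨x1, x2, x3, x4, x5⟩ := p.bounds
  have b1 : p.X ≤ p.m * (p.X * (2 * p.X * 1)) := by
    calc p.X = 1 * (p.X * 1) := by ring
      _ ≤ _ := Nat.mul_le_mul hm (Nat.mul_le_mul_left _ (by omega))
  have b2 : 2 * p.X ≤ p.m * (p.X * (2 * p.X * 1)) := by
    calc 2 * p.X = 1 * (1 * (2 * p.X * 1)) := by ring
      _ ≤ _ := Nat.mul_le_mul hm (Nat.mul_le_mul_right _ (by omega))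
  have b3 : p.m * (p.X * 1) ≤ p.m * (p.X * (2 * p.X * 1)) := by gcongr; omega
  have b4 := x1
  refine (Runs.seq (C₁ := 6000) (C₂ := 12000) (runs_prep h hm hρa hρ)
    fun τ ha hτ => ?_).weaken (by norm_num)
  have h := h.of_agree ha
  refine (Runs.seq (C₁ := 3200) (C₂ := 8500) ((runs_syndrome h hm hτ).raise b3)
    fun τ ha hτ => ?_).weaken (by norm_num)
  have h := h.of_agree ha
  refine (Runs.seq (C₁ := 4000) (C₂ := 4500) ((runs_flag h hτ).raise (by omega))
    fun τ ha hτ => ?_)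
  have h := h.of_agree ha
  refine (Runs.seq (C₁ := 1) (C₂ := 4100) (Q₁ := (· = ρ)) (Runs.oracle (b4.trans b1) le_rfl hτ)
    fun τ ha hτ => ?_).weaken (by norm_num)
  have h := h.of_agree ha
  refine (Runs.seq (C₁ := 3000) (C₂ := 1100) ((runs_unflag h hτ).raise (by omega))
    fun τ ha hτ => ?_)
  exact (runs_bellLoop (h.of_agree ha) hτ).raise (by omega)

theorem runs_const (hm : 1 ≤ p.m) (hρ : σ.real = ρ) :
    Runs 0 constCmd σ (1200 * (p.m + (p.n + p.n))) (· = ρ) p.constCirc := by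
  refine (Runs.seq (C₁ := 1100) (C₂ := 1) ((Runs.loop_emit (C := 1000) (p.m + (p.n + p.n))
    (fun τ ha => (h.vM.add (h.vN.add h.vN)) τ ha) (Val.const 0) le_rfl (by omega) le_rfl
    (by decide) hρ fun j hj τ ha n0 n1 hτ => ?_).raise (by omega)) fun τ ha hτ =>
      Runs.oracle (by omega) le_rfl hτ).weaken (by norm_num)
  have h := h.of_agree ha
  exact runs_bell ((h.vM.add (h.vN.add h.vN)).add (Val.ctr (by norm_num) n0))
    (Val.ctr (by norm_num) n0) (by decide) (by decide) hτ

end EmitRuns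

/-! ### The program: classical preprocessing -/

/-- Natural numbers cannot be converted to reals, so row 0 of real table 3 is filled with 0, 1, 2, …
by repeated addition. Row 1 receives the factorials, and column 0 of table 2, the working matrix,
the derivatives k! a_k. -/
def setupCmd : Cmd :=
  .seq (.setR 3 (.const 1) (.const 0) (.const 1))
    (forLoop 0 eL (.const 0)
      (.seq (.setR 2 (ctr 0) (.const 0)
          (.mul (.read 3 (.const 1) (ctr 0)) (.read 1 (.const 0) (ctr 0))))
        (.seq (.setR 3 (.const 0) (.add (ctr 0) (.const 1))
            (.add (.read 3 (.const 0) (ctr 0)) (.const 1)))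
          (.setR 3 (.const 1) (.add (ctr 0) (.const 1))
            (.mul (.read 3 (.const 1) (ctr 0))
              (.read 3 (.const 0) (.add (ctr 0) (.const 1))))))))

def nontrivCmd : Cmd :=
  .seq (.setR 4 (.const 2) (.const 0) (.const 0))
    (forLoop 1 eN (.const 0)
      (.ite (.nle (.const 1) (.add (eα (ctr 0) (ctr 1)) (eβ (ctr 0) (ctr 1))))
        (.setR 4 (.const 2) (.const 0) (.const 1)) .skip))

/-- The common factor `c / (d + 1)` of the recursion for `expCoef`. -/
def eRatio : RExpr :=
  .div (.read 0 (.const 0) (ctr 0)) (.read 3 (.const 0) (.add (ctr 1) (.const 1)))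

def eν : RExpr := .read 4 (.const 2) (.const 0)

def coefCmd : Cmd :=
  .seq (.setR 4 (.const 0) (.const 0) (.const 1))
    (.seq (.setR 4 (.const 1) (.const 0) (.const 0))
      (forLoop 1 eL (.const 0)
        (.seq (.setR 4 (.const 0) (.add (ctr 1) (.const 1))
            (.mul eRatio (.add (.mul eν (.read 4 (.const 1) (ctr 1)))
              (.mul (.sub (.const 1) eν) (.read 4 (.const 0) (ctr 1))))))
          (.setR 4 (.const 1) (.add (ctr 1) (.const 1))
            (.mul eRatio (.mul eν (.read 4 (.const 0) (ctr 1))))))))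

def eRow : NExpr := .add (ctr 1) (.add (ctr 3) (.const 1))

/-- The matrix can be updated in place: with rows treated in increasing order, row `k` reads only
rows below it, which still hold their old values. -/
def transferCmd : Cmd :=
  forLoop 1 eL (.const 0) (forLoop 2 eL (.const 0) (forLoop 3 eL (.const 0)
    (.seq (.setR 2 (ctr 1) (ctr 2) (.add (.read 2 (ctr 1) (ctr 2))
        (.mul (.read 4 (.const 0) (.add (ctr 3) (.const 1))) (.read 2 eRow (ctr 2)))))
      (.setR 2 (ctr 1) (.add eL (ctr 2)) (.add (.read 2 (ctr 1) (.add eL (ctr 2)))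
        (.mul (.read 4 (.const 1) (.add (ctr 3) (.const 1))) (.read 2 eRow (ctr 2))))))))

/-- The address of an angle. -/
def eAddr : NExpr := .add (acc 1) (ctr 2)

def eNorm : RExpr := .read 7 (.const 0) (.const 0)
def eCos : RExpr := .read 5 (ctr 0) eAddr
def eSin : RExpr := .read 6 (ctr 0) eAddr
def eX : RExpr := .read 2 (ctr 1) (ctr 1)
def eY : RExpr := .read 2 (ctr 1) (ctr 2)

def angleCmd : Cmd :=
  .seq (.setR 7 (.const 0) (.const 0) (.add (.mul eX eX) (.mul eY eY)))
    (.ite (.rle eNorm (.const 0))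
      (.seq (.setR 5 (ctr 0) eAddr (.const 1)) (.setR 6 (ctr 0) eAddr (.const 0)))
      (.seq (.setR 5 (ctr 0) eAddr (.div eX (.sqrt eNorm)))
        (.setR 6 (ctr 0) eAddr (.div eY (.sqrt eNorm)))))

def eP : RExpr := .read 2 (ctr 3) (ctr 1)
def eP' : RExpr := .read 2 (ctr 3) (ctr 2)

/-- Both new entries need both old ones, so the first is parked in table 7. The cosine and sine were
stored beforehand, since the pivot row itself is overwritten. -/
def columnsCmd : Cmd :=
  forLoop 3 eL (.const 0)
    (.seq (.setR 7 (.const 0) (.const 1) (.add (.mul eCos eP) (.mul eSin eP')))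
      (.seq (.setR 2 (ctr 3) (ctr 2) (.sub (.mul eCos eP') (.mul eSin eP)))
        (.setR 2 (ctr 3) (ctr 1) (.read 7 (.const 0) (.const 1)))))

def sweepCmd : Cmd :=
  forLoop 1 eL eW (forLoop 2 eW (.const 0)
    (.ite (.nle (ctr 2) (ctr 1)) .skip (.seq angleCmd columnsCmd)))

def anglesCmd : Cmd :=
  .seq setupCmd (forLoop 0 eM (.const 0)
    (.seq nontrivCmd (.seq coefCmd (.seq transferCmd sweepCmd))))

/-! ### Correctness and cost of the computation of the angles. -/

section ClassicalRuns

variable {p : Par} {r : ℕ} {σ τ : Store} {ρ : Mem} {Y : ℕ} {Q : Mem → Prop}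

theorem Runs.set {t C i' j' : ℕ} {i j : NExpr} {e : RExpr} {x : ℝ} (hY : 1 ≤ Y)
    (hC : 1 + i.cost + j.cost + e.cost ≤ C) (hi : i.eval σ = i') (hj : j.eval σ = j')
    (hx : e.eval σ = x) (hQ : Q (setMem σ.real t i' j' x)) :
    Runs r (.setR t i j e) σ (C * Y) Q [] := by
  subst hi hj hx
  exact Runs.setR hY hC hQ

theorem NExpr.eval_const (σ : Store) (v : ℕ) : (NExpr.const v).eval σ = v := rfl

theorem setMem_table {t t' : ℕ} (ρ : Mem) (i j : ℕ) (x : ℝ) (h : t' ≠ t) :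
    setMem ρ t i j x t' = ρ t' := by
  funext i' j'; simp [setMem, h]

/-- The rule for loops that emit no gates. -/
theorem Runs.loop_silent {e w : NExpr} {body : Cmd} {k s C Y : ℕ} {I : ℕ → Mem → Prop} (z : ℕ)
    (hk : ∀ τ, Agree r σ τ → e.eval τ = k) (hs : ∀ τ, Agree r σ τ → w.eval τ = s)
    (hkz : k ≤ z) (hz : 1 ≤ z) (hY : 1 ≤ Y) (hcost : e.cost + w.cost ≤ 30) (h0 : I 0 σ.real)
    (hb : ∀ j < k, ∀ τ, Agree r σ τ → τ.nat 3 r 0 = j → τ.nat 3 r 1 = j * s → I j τ.real →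
      Runs (r + 1) body τ (C * Y) (I (j + 1)) []) :
    Runs r (forLoop r e w body) σ ((C + 100) * (z * Y)) (I k) [] := by
  have := Runs.loop (G := fun _ => []) z hk hs hkz hz hY hcost h0 hb
  rwa [List.flatMap_eq_nil_iff.2 fun _ _ => rfl] at this

/-- The result of the set-up phase. -/
structure Setup (p : Par) (ρ : Mem) : Prop where
  c : ρ 0 0 = p.c
  num : ∀ d ≤ p.L, ρ 3 0 d = d

variable (h : Env p σ)
include h

theorem runs_setup (hc : σ.real 0 0 = p.c) (ha : σ.real 1 0 = p.a)
    (h2 : ∀ i j, σ.real 2 i j = 0) (h3 : ∀ i j, σ.real 3 i j = 0) :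
    Runs 0 setupCmd σ (500 * (p.X * 1)) (fun ρ => Setup p ρ ∧ ρ 2 = p.bond 0) [] := by
  obtain ⟨x1, x2, x3, x4, x5⟩ := p.bounds
  let I : ℕ → Mem → Prop := fun d ρ => ρ 0 0 = p.c ∧ ρ 1 0 = p.a ∧ (∀ e ≤ d, ρ 3 0 e = e) ∧
    (∀ e ≤ d, ρ 3 1 e = Nat.factorial e) ∧
    ∀ k s, ρ 2 k s = if s = 0 ∧ k < d then (Nat.factorial k : ℝ) * p.a k else 0
  refine Runs.mono (B := (50 + 300) * (p.X * 1)) (Q := I p.L) ?_ (by omega) ?_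
  swap
  · rintro ρ ⟨i1, i2, i3, i4, i5⟩
    exact ⟨⟨i1, i3⟩, by funext k s; exact i5 k s⟩
  refine Runs.seq_right (Q₁ := I 0) (Runs.set (by omega) (by decide) (NExpr.eval_const _ _) (NExpr.eval_const _ _) rfl ?_)
    fun τ ha hτ => ?_
  · refine ⟨by rw [setMem_table _ _ _ _ (by norm_num), hc],
      by rw [setMem_table _ _ _ _ (by norm_num), ha], ?_, ?_, ?_⟩
    · intro e he; obtain rfl : e = 0 := by omega
      simp [setMem, h3]
    · intro e he; obtain rfl : e = 0 := by omega
      simp [setMem, RExpr.eval]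
    · intro k s
      rw [setMem_table _ _ _ _ (by norm_num)]; simp [h2]
  · refine Runs.loop_silent (C := 200) p.X (fun τ' ha' => (h.of_agree ha).vL τ' ha') (Val.const 0) x4 x1
      le_rfl (by decide) hτ fun d hd τ ha' n0 _ hI => ?_
    obtain ⟨i1, i2, i3, i4, i5⟩ := hI
    refine Runs.mono (B := (50 + (50 + 100)) * 1) (Q := I (d + 1)) ?_ (by omega) fun _ h => h
    have v0 : Val 1 τ (ctr 0) d := .ctr (by norm_num) n0
    refine Runs.seq_right (Q₁ := (· = setMem τ.real 2 d 0 (Nat.factorial d * p.a d)))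
      (Runs.set le_rfl (by decide) v0.eval (NExpr.eval_const _ _) ?_ rfl) fun υ a1 h1 => ?_
    · simp [RExpr.eval, NExpr.eval, n0, i4 d le_rfl, i2]
    have v1 := v0.of_agree a1
    refine Runs.seq_right (Q₁ := (· = setMem (setMem τ.real 2 d 0 (Nat.factorial d * p.a d))
      3 0 (d + 1) (d + 1)))
      (Runs.set le_rfl (by decide) (NExpr.eval_const _ _) (v1.add (.const 1)).eval ?_ (by rw [h1])) fun υ' a2 h2 => ?_
    · have := i3 d le_rfl
      simp [RExpr.eval, NExpr.eval, h1, setMem, v1.eval, this, -ctr_eval]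
    have v2 := v1.of_agree a2
    refine Runs.set (x := (Nat.factorial (d + 1) : ℝ))
      le_rfl (by decide) (NExpr.eval_const _ _) (v2.add (.const 1)).eval ?_ ?_
    · have := i4 d le_rfl
      simp [RExpr.eval, NExpr.eval, h2, setMem, v2.eval, this, -ctr_eval, Nat.factorial_succ,
        mul_comm]
    · rw [h2]
      refine ⟨by simp [setMem_table, i1], by simp [setMem_table, i2], ?_, ?_, ?_⟩
      · intro e he
        by_cases h : e = d + 1
        · subst h; simp [setMem]
        · simpa [setMem, h] using i3 e (by omega)
      · intro e he
        by_cases h : e = d + 1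
        · subst h; simp [setMem]
        · simpa [setMem, h] using i4 e (by omega)
      · intro k s
        by_cases h : k = d ∧ s = 0
        · obtain ⟨rfl, rfl⟩ := h; simp [setMem]
        · have : (s = 0 ∧ k < d + 1) ↔ (s = 0 ∧ k < d) := by omega
          rw [if_congr this rfl rfl, ← i5 k s]
          simp [setMem, h]

theorem runs_nontriv {i : ℕ} (n0 : σ.nat 3 0 0 = i) (hρ : σ.real = ρ) :
    Runs 1 nontrivCmd σ (300 * (p.X * 1))
      (fun ρ' => (∀ t, t ≠ 4 → ρ' t = ρ t) ∧ ρ' 4 2 0 = p.nontriv i) [] := by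
  classical
  obtain ⟨x1, x2, x3, x4, x5⟩ := p.bounds
  let I : ℕ → Mem → Prop := fun j ρ' => (∀ t, t ≠ 4 → ρ' t = ρ t) ∧
    ρ' 4 2 0 = if ∃ k < j, 1 ≤ p.α i k ∨ 1 ≤ p.β i k then 1 else 0
  refine Runs.mono (B := (50 + 200) * (p.X * 1)) (Q := I p.n) ?_ (by omega) ?_
  swap
  · rintro ρ' ⟨i1, i2⟩
    refine ⟨i1, i2.trans ?_⟩
    unfold Par.nontriv Par.Nontriv
    congr
  refine Runs.seq_right (Q₁ := I 0) (Runs.set (by omega) (by decide) (NExpr.eval_const _ _) (NExpr.eval_const _ _) rfl ?_)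
    fun τ ha hτ => ?_
  · exact ⟨fun t ht => by rw [setMem_table _ _ _ _ ht, hρ], by simp [setMem, RExpr.eval]⟩
  · refine Runs.loop_silent (C := 100) p.X (fun τ' ha' => (h.of_agree ha).vN τ' ha') (Val.const 0) x2 x1
      le_rfl (by decide) hτ fun k hk τ' ha' n1 _ hI => ?_
    have h' := (h.of_agree ha).of_agree ha'
    have v0 : Val 2 τ' (ctr 0) i :=
      .ctr (by norm_num) ((ha' 3 0 0 (by omega)).trans ((ha 3 0 0 (by omega)).trans n0))
    have v1 : Val 2 τ' (ctr 1) k := .ctr (by norm_num) n1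
    have v2 := (h'.vα v0 v1).add (h'.vβ v0 v1)
    obtain ⟨i1, i2⟩ := hI
    refine Runs.ite le_rfl (C := 50) (by decide) (fun hb => ?_) (fun hb => ?_) <;>
      simp only [Test.Holds, NExpr.eval.eq_1, v2.eval] at hb
    · refine Runs.set le_rfl (by decide) (NExpr.eval_const _ _) (NExpr.eval_const _ _) rfl
        ⟨fun t ht => by rw [setMem_table _ _ _ _ ht, i1 t ht], ?_⟩
      rw [if_pos ⟨k, by omega, by omega⟩]
      simp [setMem, RExpr.eval]
    · refine Runs.skip _ le_rfl (by norm_num) ⟨i1, i2.trans ?_⟩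
      refine if_congr ⟨?_, ?_⟩ rfl rfl
      · rintro ⟨k', h1, h2⟩; exact ⟨k', by omega, h2⟩
      · rintro ⟨k', h1, h2⟩
        have : k' ≠ k := by rintro rfl; omega
        exact ⟨k', by omega, h2⟩

theorem runs_coef {i : ℕ} (n0 : σ.nat 3 0 0 = i) (hρ : σ.real = ρ) (hs : Setup p ρ)
    (hν : ρ 4 2 0 = p.nontriv i) :
    Runs 1 coefCmd σ (500 * (p.X * 1))
      (fun ρ' => (∀ t, t ≠ 4 → ρ' t = ρ t) ∧
        ∀ d ≤ p.L, ρ' 4 0 d = (p.coef i d).1 ∧ ρ' 4 1 d = (p.coef i d).2) [] := by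
  obtain ⟨x1, x2, x3, x4, x5⟩ := p.bounds
  let I : ℕ → Mem → Prop := fun j ρ' => (∀ t, t ≠ 4 → ρ' t = ρ t) ∧ ρ' 4 2 0 = p.nontriv i ∧
    ∀ d ≤ j, ρ' 4 0 d = (p.coef i d).1 ∧ ρ' 4 1 d = (p.coef i d).2
  refine Runs.mono (B := (50 + (50 + 350)) * (p.X * 1)) (Q := I p.L) ?_ (by omega)
    fun ρ' h => ⟨h.1, h.2.2⟩
  refine Runs.seq_right (Q₁ := (· = setMem ρ 4 0 0 1))
    (Runs.set (by omega) (by decide) (NExpr.eval_const _ _) (NExpr.eval_const _ _) rfl ?_) fun τ ha hτ => ?_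
  · simp [hρ, RExpr.eval]
  refine Runs.seq_right (Q₁ := I 0)
    (Runs.set (by omega) (by decide) (NExpr.eval_const _ _) (NExpr.eval_const _ _) rfl ?_) fun τ' ha' hτ' => ?_
  · rw [hτ]
    refine ⟨fun t ht => by rw [setMem_table _ _ _ _ ht, setMem_table _ _ _ _ ht], ?_, ?_⟩
    · simp [setMem, hν]
    · intro d hd
      obtain rfl : d = 0 := by omega
      simp [setMem, RExpr.eval, Par.coef, expCoef]
  have a0 := ha.trans ha'
  refine Runs.loop_silent (C := 250) p.X (fun τ' ha' => (h.of_agree a0).vL τ' ha') (Val.const 0) x4 x1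
    le_rfl (by decide) hτ' fun d hd υ a1 n1 _ hI => ?_
  obtain ⟨i1, i2, i3⟩ := hI
  obtain ⟨e1, e2⟩ := i3 d le_rfl
  have v0 : Val 2 υ (ctr 0) i :=
    .ctr (by norm_num) ((a1 3 0 0 (by omega)).trans ((a0 3 0 0 (by omega)).trans n0))
  have v1 : Val 2 υ (ctr 1) d := .ctr (by norm_num) n1
  have hnum := hs.num (d + 1) hd
  have hc := hs.c
  refine Runs.mono (B := (100 + 100) * 1) (Q := I (d + 1)) ?_ (by omega) fun _ h => h
  refine Runs.seq_right (Q₁ := (· = setMem υ.real 4 0 (d + 1) (p.coef i (d + 1)).1))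
    (Runs.set le_rfl (by decide) (NExpr.eval_const _ _) (v1.add (.const 1)).eval ?_ rfl) fun υ' a2 h2 => ?_
  · simp [eRatio, eν, RExpr.eval, NExpr.eval, v0.eval, v1.eval, -ctr_eval, i1, hnum, hc, i2, e1, e2,
      Par.coef, expCoef]
  refine Runs.set (x := (p.coef i (d + 1)).2)
      le_rfl (by decide) (NExpr.eval_const _ _) ((v1.of_agree a2).add (.const 1)).eval ?_ ?_
  · simp [eRatio, eν, RExpr.eval, NExpr.eval, v0 υ' a2, v1 υ' a2, -ctr_eval, h2, setMem, i1, hnum,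
      hc, i2, e1, Par.coef, expCoef]
  · rw [h2]
    refine ⟨fun t ht => by rw [setMem_table _ _ _ _ ht, setMem_table _ _ _ _ ht, i1 t ht], ?_, ?_⟩
    · simp [setMem, i2]
    · intro e he
      by_cases h : e = d + 1
      · subst h; simp [setMem]
      · simpa [setMem, h] using i3 e (by omega)

/-- The matrix in the course of the transfer step: the first `k` rows and the first `s` entries
of each half of row `k` are those of `T`. -/
def partTransfer (L : ℕ) (T R : ℕ → ℕ → ℝ) (k s : ℕ) : ℕ → ℕ → ℝ := fun k' s' =>
  if k' < k ∨ (k' = k ∧ (s' < s ∨ (L ≤ s' ∧ s' < L + s))) then T k' s' else R k' s'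

omit h in
theorem partTransfer_row (L : ℕ) (E : ℕ → ℝ × ℝ) (R : ℕ → ℕ → ℝ) (k : ℕ) :
    partTransfer L (transfer L E R) R k L = partTransfer L (transfer L E R) R (k + 1) 0 := by
  funext k' s'
  unfold partTransfer
  by_cases h : k' = k
  · subst h
    by_cases h' : s' < L + L
    · rw [if_pos (by omega), if_pos (by omega)]
    · rw [if_neg (by omega), if_pos (by omega)]
      simp only [transfer, if_neg (show ¬ s' < L by omega), if_neg h', ite_self]
  · refine if_congr ?_ rfl rfl
    omega

omit h in
theorem partTransfer_end (L : ℕ) (E : ℕ → ℝ × ℝ) (R : ℕ → ℕ → ℝ) :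
    partTransfer L (transfer L E R) R L 0 = transfer L E R := by
  funext k' s'
  unfold partTransfer
  by_cases h : k' < L
  · rw [if_pos (by omega)]
  · rw [if_neg (by omega), transfer, if_neg h]

theorem runs_transfer {E : ℕ → ℝ × ℝ} {R : ℕ → ℕ → ℝ} (hρ : σ.real = ρ) (hR : ρ 2 = R)
    (hE : ∀ d ≤ p.L, ρ 4 0 d = (E d).1 ∧ ρ 4 1 d = (E d).2) :
    Runs 1 transferCmd σ (500 * (p.X * (p.X * (p.X * 1))))
      (fun ρ' => (∀ t, t ≠ 2 → ρ' t = ρ t) ∧ ρ' 2 = transfer p.L E R) [] := by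
  obtain ⟨x1, x2, x3, x4, x5⟩ := p.bounds
  have x6 : 1 ≤ p.X * 1 := by omega
  have x7 : 1 ≤ p.X * (p.X * 1) := Nat.mul_pos x1 x6
  let T := transfer p.L E R
  let I : ℕ → Mem → Prop := fun k ρ' => (∀ t, t ≠ 2 → ρ' t = ρ t) ∧
    ρ' 2 = partTransfer p.L T R k 0
  let J : ℕ → ℕ → Mem → Prop := fun k s ρ' => (∀ t, t ≠ 2 → ρ' t = ρ t) ∧
    ρ' 2 = partTransfer p.L T R k s
  let K : ℕ → ℕ → ℕ → Mem → Prop := fun k s j ρ' => (∀ t, t ≠ 2 → ρ' t = ρ t) ∧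
    ρ' 2 = fun k' s' => if k' = k ∧ s' = s then
        R k s + ∑ d ∈ Finset.range j, (E (d + 1)).1 * R (k + (d + 1)) s
      else if k' = k ∧ s' = p.L + s then
        R k (p.L + s) + ∑ d ∈ Finset.range j, (E (d + 1)).2 * R (k + (d + 1)) s
      else partTransfer p.L T R k s k' s'
  refine Runs.mono (B := 500 * (p.X * (p.X * (p.X * 1)))) (Q := I p.L) ?_ le_rfl ?_
  swap
  · exact fun ρ' h => ⟨h.1, h.2.trans (partTransfer_end _ _ _)⟩
  refine Runs.loop_silent (C := 400) p.X (fun τ' ha' => h.vL τ' ha') (Val.const 0) x4 x1 x7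
    (by decide) ?_ fun k hk τ ha n1 _ hI => ?_
  · rw [hρ]
    refine ⟨fun _ _ => rfl, hR.trans ?_⟩
    funext k s
    simp [partTransfer]
  refine Runs.mono (B := 400 * (p.X * (p.X * 1))) (Q := J k p.L) ?_ le_rfl
    fun ρ' h => ⟨h.1, h.2.trans (partTransfer_row _ _ _ _)⟩
  have h1 := h.of_agree ha
  refine Runs.loop_silent (C := 300) p.X (fun τ' ha' => h1.vL τ' ha') (Val.const 0) x4 x1 x6
    (by decide) hI fun s hs τ' ha' n2 _ hJ => ?_
  have h2 := h1.of_agree ha'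
  have n1' : τ'.nat 3 1 0 = k := (ha' 3 1 0 (by omega)).trans n1
  refine Runs.mono (B := 300 * (p.X * 1)) (Q := K k s p.L) ?_ le_rfl fun ρ' h => ⟨h.1, h.2.trans ?_⟩
  swap
  · funext k' s'
    unfold partTransfer
    by_cases e1 : k' = k ∧ s' = s
    · obtain ⟨rfl, rfl⟩ := e1
      rw [if_pos ⟨rfl, rfl⟩, if_pos (by omega)]
      simp only [T, transfer]; rw [if_pos hk, if_pos hs]
    rw [if_neg e1]
    by_cases e2 : k' = k ∧ s' = p.L + s
    · obtain ⟨rfl, rfl⟩ := e2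
      rw [if_pos ⟨rfl, rfl⟩, if_pos (by omega)]
      simp only [T, transfer]; rw [if_pos hk, if_neg (by omega), if_pos (by omega)]
      simp only [Nat.add_sub_cancel_left]
    rw [if_neg e2]
    exact if_congr (by omega) rfl rfl
  refine Runs.loop_silent (C := 200) p.X (fun τ' ha' => h2.vL τ' ha') (Val.const 0) x4 x1 le_rfl
    (by decide) ?_ fun d hd υ a3 n3 _ hK => ?_
  · refine ⟨hJ.1, hJ.2.trans ?_⟩
    funext k' s'
    by_cases e1 : k' = k ∧ s' = s
    · obtain ⟨rfl, rfl⟩ := e1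
      rw [if_pos ⟨rfl, rfl⟩]
      unfold partTransfer
      rw [if_neg (by omega)]; simp
    rw [if_neg e1]
    by_cases e2 : k' = k ∧ s' = p.L + s
    · obtain ⟨rfl, rfl⟩ := e2
      rw [if_pos ⟨rfl, rfl⟩]
      unfold partTransfer
      rw [if_neg (by omega)]; simp
    rw [if_neg e2]
  have h3 := h2.of_agree a3
  have v1 : Val 4 υ (ctr 1) k := .ctr (by norm_num) ((a3 3 1 0 (by omega)).trans n1')
  have v2 : Val 4 υ (ctr 2) s := .ctr (by norm_num) ((a3 3 2 0 (by omega)).trans n2)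
  have v3 : Val 4 υ (ctr 3) d := .ctr (by norm_num) n3
  have vL : Val 4 υ eL p.L := h3.vL
  obtain ⟨k1, k2⟩ := hK
  obtain ⟨e0, e1⟩ := hE (d + 1) hd
  have old : ∀ s' < p.L, partTransfer p.L T R k s (k + (d + 1)) s' = R (k + (d + 1)) s' :=
    fun s' _ => if_neg (by omega)
  have c0 : ¬ s = p.L + s := by omega
  set v := R k s + ∑ d ∈ Finset.range (d + 1), (E (d + 1)).1 * R (k + (d + 1)) s with hv
  refine Runs.mono (B := (100 + 100) * 1) (Q := K k s (d + 1)) ?_ (by omega) fun _ h => h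
  refine Runs.seq_right (Q₁ := (· = setMem υ.real 2 k s v))
    (Runs.set le_rfl (by decide) v1.eval v2.eval ?_ rfl) fun υ' a4 h4 => ?_
  · simp only [RExpr.eval, NExpr.eval, eRow, v1.eval, v2.eval, v3.eval, k1 4 (by norm_num), e0, k2]
    simp [old s hs, hv, Finset.sum_range_succ]; ring
  refine Runs.set (x := R k (p.L + s) +
    ∑ d ∈ Finset.range (d + 1), (E (d + 1)).2 * R (k + (d + 1)) s)
    le_rfl (by decide) (v1.of_agree a4).eval ((vL.add v2).of_agree a4).eval ?_ ?_
  · simp only [RExpr.eval, NExpr.eval, eRow, v1 υ' a4, v2 υ' a4, v3 υ' a4, vL υ' a4, h4, setMem,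
      k1 4 (by norm_num), e1, k2]
    simp [old s hs, Finset.sum_range_succ]; ring
  · rw [h4]
    refine ⟨fun t ht => by rw [setMem_table _ _ _ _ ht, setMem_table _ _ _ _ ht, k1 t ht], ?_⟩
    funext k' s'
    simp only [setMem, k2, true_and]
    by_cases e2 : k' = k ∧ s' = p.L + s
    · rw [if_pos e2, if_neg (by omega), if_pos e2]
    · rw [if_neg e2]
      by_cases e3 : k' = k ∧ s' = s
      · rw [if_pos e3, if_pos e3]
      · simp only [if_neg e3, if_neg e2]

omit h in
theorem runs_angle {i t q a : ℕ} {M : ℕ → ℕ → ℝ} (v0 : Val 3 σ (ctr 0) i)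
    (v1 : Val 3 σ (ctr 1) t) (v2 : Val 3 σ (ctr 2) q) (va : Val 3 σ eAddr a)
    (hM : σ.real 2 = M) :
    Runs 3 angleCmd σ (500 * 1)
      (fun ρ' => (∀ t, t ≠ 5 → t ≠ 6 → t ≠ 7 → ρ' t = σ.real t) ∧
        (∀ i' a', ρ' 5 i' a' = if i' = i ∧ a' = a then cosG M t q else σ.real 5 i' a') ∧
        ∀ i' a', ρ' 6 i' a' = if i' = i ∧ a' = a then sinG M t q else σ.real 6 i' a') [] := by
  refine Runs.mono (B := (100 + 400) * 1) ?_ (by omega) fun _ h => h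
  refine Runs.seq_right (Q₁ := (· = setMem σ.real 7 0 0 (normSqG M t q)))
    (Runs.set le_rfl (by decide) (NExpr.eval_const _ _) (NExpr.eval_const _ _) ?_ rfl)
    fun τ ha hτ => ?_
  · simp only [eX, eY, RExpr.eval, v1.eval, v2.eval, hM, normSqG]
  have hN : eNorm.eval τ = normSqG M t q := by
    simp [eNorm, RExpr.eval, NExpr.eval, hτ, setMem]
  -- Both branches store a cosine and then a sine; only the two expressions differ.
  have step : ∀ x y : ℝ, cosG M t q = x → sinG M t q = y → ∀ e f : RExpr,
      (1 + 3 + eAddr.cost + e.cost ≤ 150) → (1 + 3 + eAddr.cost + f.cost ≤ 150) →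
      (∀ υ, Agree 3 τ υ → υ.real 2 = M → υ.real 7 = τ.real 7 → e.eval υ = x) →
      (∀ υ, Agree 3 τ υ → υ.real 2 = M → υ.real 7 = τ.real 7 → f.eval υ = y) →
      Runs 3 (.seq (.setR 5 (ctr 0) eAddr e) (.setR 6 (ctr 0) eAddr f)) τ (300 * 1)
      (fun ρ' => (∀ t, t ≠ 5 → t ≠ 6 → t ≠ 7 → ρ' t = σ.real t) ∧
        (∀ i' a', ρ' 5 i' a' = if i' = i ∧ a' = a then cosG M t q else σ.real 5 i' a') ∧
        ∀ i' a', ρ' 6 i' a' = if i' = i ∧ a' = a then sinG M t q else σ.real 6 i' a') [] := by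
    intro x y hx hy e f ce cf he hf
    have hM' : τ.real 2 = M := by rw [hτ, setMem_table _ _ _ _ (by norm_num), hM]
    refine Runs.seq_right (C₁ := 150) (C₂ := 150) (Q₁ := (· = setMem τ.real 5 i a x))
      (Runs.set le_rfl (by simpa using ce) (v0.of_agree ha).eval (va.of_agree ha).eval
        (he τ (.refl _ _) hM' rfl) rfl) fun υ ha' hυ => ?_
    refine Runs.set le_rfl (by simpa using cf) (v0 υ (ha.trans ha')) (va υ (ha.trans ha'))
      (hf υ ha' ?_ ?_) ?_
    · rw [hυ, setMem_table _ _ _ _ (by norm_num), hM']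
    · rw [hυ, setMem_table _ _ _ _ (by norm_num)]
    · rw [hυ, hτ]
      refine ⟨fun t h5 h6 h7 => ?_, fun i' a' => ?_, fun i' a' => ?_⟩
      · rw [setMem_table _ _ _ _ h6, setMem_table _ _ _ _ h5, setMem_table _ _ _ _ h7]
      · simp [setMem, hx]
      · simp [setMem, hy]
  have hXY : ∀ υ, Agree 3 τ υ → υ.real 2 = M → υ.real 7 = τ.real 7 →
      eX.eval υ = M t t ∧ eY.eval υ = M t q ∧ eNorm.eval υ = normSqG M t q := by
    intro υ ha' hυ h7
    refine ⟨?_, ?_, ?_⟩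
    · simp only [eX, RExpr.eval, v1 υ (ha.trans ha'), hυ]
    · simp only [eY, RExpr.eval, v1 υ (ha.trans ha'), v2 υ (ha.trans ha'), hυ]
    · simpa [eNorm, RExpr.eval, NExpr.eval, h7] using hN
  refine Runs.ite le_rfl (C := 300) (by decide) (fun hb => ?_) (fun hb => ?_) <;>
    simp only [Test.Holds, hN, RExpr.eval] at hb <;> norm_num at hb
  · exact step 1 0 (if_pos hb) (if_pos hb) _ _ (by decide) (by decide)
      (fun _ _ _ _ => by simp [RExpr.eval]) (fun _ _ _ _ => by simp [RExpr.eval])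
  · refine step _ _ (if_neg (not_le.2 hb)) (if_neg (not_le.2 hb)) _ _ (by decide) (by decide)
      (fun υ a b c => ?_) (fun υ a b c => ?_) <;>
    obtain ⟨h1, h2, h3⟩ := hXY υ a b c <;> simp only [RExpr.eval, h1, h2, h3]

theorem runs_columns {i t q a : ℕ} {M : ℕ → ℕ → ℝ} (v0 : Val 3 σ (ctr 0) i)
    (v1 : Val 3 σ (ctr 1) t) (v2 : Val 3 σ (ctr 2) q) (va : Val 3 σ eAddr a)
    (hρ : σ.real = ρ) (hM : ρ 2 = M) (hc : ρ 5 i a = cosG M t q) (hs : ρ 6 i a = sinG M t q) :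
    Runs 3 columnsCmd σ (500 * (p.X * 1))
      (fun ρ' => (∀ t, t ≠ 2 → t ≠ 7 → ρ' t = ρ t) ∧ ρ' 2 = rot p.L M t q) [] := by
  obtain ⟨x1, x2, x3, x4, x5⟩ := p.bounds
  let I : ℕ → Mem → Prop := fun k ρ' => (∀ t, t ≠ 2 → t ≠ 7 → ρ' t = ρ t) ∧
    ρ' 2 = fun k' s => if k' < k then rot p.L M t q k' s else M k' s
  refine Runs.mono (B := 500 * (p.X * 1)) (Q := I p.L) ?_ le_rfl fun ρ' h => ⟨h.1, h.2.trans ?_⟩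
  swap
  · funext k s
    by_cases h : k < p.L
    · rw [if_pos h]
    · rw [if_neg h, rot, if_neg h]
  refine Runs.loop_silent (C := 400) p.X (fun τ' ha' => h.vL τ' ha') (Val.const 0) x4 x1 le_rfl
    (by decide) ?_ fun k hk τ ha n3 _ hI => ?_
  · rw [hρ]
    refine ⟨fun _ _ _ => rfl, hM.trans ?_⟩
    simp
  have v0 : Val 4 τ (ctr 0) i := (v0.of_agree ha).mono (by norm_num)
  have v1 : Val 4 τ (ctr 1) t := (v1.of_agree ha).mono (by norm_num)
  have v2 : Val 4 τ (ctr 2) q := (v2.of_agree ha).mono (by norm_num)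
  have va : Val 4 τ eAddr a := (va.of_agree ha).mono (by norm_num)
  have v3 : Val 4 τ (ctr 3) k := .ctr (by norm_num) n3
  obtain ⟨i1, i2⟩ := hI
  have c0 : ∀ s, τ.real 2 k s = M k s := fun s => by rw [i2]; exact if_neg (by omega)
  have c5 := i1 5 (by norm_num) (by norm_num)
  have c6 := i1 6 (by norm_num) (by norm_num)
  refine Runs.mono (B := (100 + (150 + 50)) * 1) (Q := I (k + 1)) ?_ (by omega) fun _ h => h
  set x := cosG M t q * M k t + sinG M t q * M k q with hx
  set y := cosG M t q * M k q - sinG M t q * M k t with hy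
  refine Runs.seq_right (Q₁ := (· = setMem τ.real 7 0 1 x))
    (Runs.set le_rfl (by decide) (NExpr.eval_const _ _) (NExpr.eval_const _ _) ?_ rfl)
    fun υ a1 h1 => ?_
  · simp only [eCos, eSin, eP, eP', RExpr.eval, v0.eval, v1.eval, v2.eval, v3.eval, va.eval, c5, c6,
      hc, hs, c0, hx]
  refine Runs.seq_right (Q₁ := (· = setMem (setMem τ.real 7 0 1 x) 2 k q y))
    (Runs.set le_rfl (by decide) (v3 υ a1) (v2 υ a1) ?_ (by rw [h1])) fun υ' a2 h2 => ?_
  · have e1 : υ.real 5 = ρ 5 := by rw [h1, setMem_table _ _ _ _ (by norm_num), c5]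
    have e2 : υ.real 6 = ρ 6 := by rw [h1, setMem_table _ _ _ _ (by norm_num), c6]
    have e3 : υ.real 2 = τ.real 2 := by rw [h1, setMem_table _ _ _ _ (by norm_num)]
    simp only [eCos, eSin, eP, eP', RExpr.eval, v0 υ a1, v1 υ a1, v2 υ a1, v3 υ a1, va υ a1, e1, e2,
      e3, hc, hs, c0, hy]
  refine Runs.set (x := x) le_rfl (by decide) (v3 υ' (a1.trans a2)) (v1 υ' (a1.trans a2)) ?_ ?_
  · simp [RExpr.eval, NExpr.eval, h2, setMem]
  · rw [h2]
    refine ⟨fun t h5 h6 => ?_, ?_⟩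
    · rw [setMem_table _ _ _ _ h5, setMem_table _ _ _ _ h5, setMem_table _ _ _ _ h6, i1 t h5 h6]
    · funext k' s
      simp only [setMem, true_and, i2]
      by_cases e1 : k' = k
      · subst e1
        rw [if_pos (Nat.lt_succ_self _)]
        simp only [rot, if_pos hk, true_and, lt_irrefl, if_false]
        by_cases e2 : s = t
        · rw [if_pos e2, if_pos e2]
        · rw [if_neg e2, if_neg e2]
          norm_num [hy]
      · have e2 : k' < k + 1 ↔ k' < k := by omega
        simp only [e1, e2, false_and, if_false]
        exact if_neg (by omega)

/-- The pairs of columns treated before the pair `(r, q)` of site `i` have their angles in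
memory. -/
def AnglesUpTo (p : Par) (i r q : ℕ) (ρ : Mem) : Prop :=
  ∀ i' t' q', (i' < i ∨ (i' = i ∧ (t' < r ∨ (t' = r ∧ q' < q)))) → q' < p.W → t' < q' →
    t' < p.L →
    ρ 5 i' (t' * p.W + q') = p.cosA i' t' q' ∧ ρ 6 i' (t' * p.W + q') = p.sinA i' t' q'

theorem runs_sweep {i : ℕ} (n0 : σ.nat 3 0 0 = i) (hρ : σ.real = ρ) (hs : Setup p ρ)
    (hM : ρ 2 = transfer p.L (p.coef i) (p.bond i)) (hA : AnglesUpTo p i 0 0 ρ) :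
    Runs 1 sweepCmd σ (1300 * (p.X * (2 * p.X * (p.X * 1))))
      (fun ρ' => Setup p ρ' ∧ ρ' 2 = p.bond (i + 1) ∧ AnglesUpTo p (i + 1) 0 0 ρ') [] := by
  obtain ⟨x1, x2, x3, x4, x5⟩ := p.bounds
  have x6 : 1 ≤ p.X * 1 := by omega
  have x7 : 1 ≤ 2 * p.X * (p.X * 1) := Nat.mul_pos (by omega) x6
  let J : ℕ → ℕ → Mem → Prop := fun r q ρ' => Setup p ρ' ∧ ρ' 2 = p.stage i r q ∧
    AnglesUpTo p i r q ρ'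
  refine Runs.mono (B := 1300 * (p.X * (2 * p.X * (p.X * 1)))) (Q := J p.L 0) ?_ le_rfl
    fun ρ' h => ⟨h.1, h.2.1, fun i' t' q' h1 h2 h3 h4 => h.2.2 i' t' q' (by omega) h2 h3 h4⟩
  refine Runs.loop_silent (I := fun r => J r 0) (C := 1200) p.X (fun τ' ha' => h.vL τ' ha')
    (fun τ' ha' => h.vW τ' ha') x4 x1 x7
    (by decide) ?_ fun r hr τ ha n1 m1 hI => ?_
  · rw [hρ]
    exact ⟨hs, hM, hA⟩
  refine Runs.mono (B := 1200 * (2 * p.X * (p.X * 1))) (Q := J r p.W) ?_ le_rfl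
    fun ρ' h => ⟨h.1, h.2.1, fun i' t' q' h1 h2 h3 h4 => h.2.2 i' t' q' (by omega) h2 h3 h4⟩
  have h1 := h.of_agree ha
  refine Runs.loop_silent (C := 1100) (2 * p.X) (fun τ' ha' => h1.vW τ' ha') (Val.const 0) x5
    (by omega) x6 (by decide) hI fun q hq υ a2 n2 _ hJ => ?_
  have h2 := h1.of_agree a2
  have v0 : Val 3 υ (ctr 0) i :=
    .ctr (by norm_num) ((a2 3 0 0 (by omega)).trans ((ha 3 0 0 (by omega)).trans n0))
  have v1 : Val 3 υ (ctr 1) r := .ctr (by norm_num) ((a2 3 1 0 (by omega)).trans n1)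
  have v2 : Val 3 υ (ctr 2) q := .ctr (by norm_num) n2
  have va : Val 3 υ eAddr (r * p.W + q) :=
    (Val.acc (by norm_num) ((a2 3 1 1 (by omega)).trans m1)).add v2
  obtain ⟨j1, j2, j3⟩ := hJ
  refine Runs.ite x6 (C := 1000) (by decide) (fun hb => ?_) (fun hb => ?_) <;>
    simp only [Test.Holds, v1.eval, v2.eval] at hb
  · refine Runs.skip _ x6 (by norm_num) ⟨j1, j2.trans ?_, fun i' t' q' h1 h2 h3 h4 =>
      j3 i' t' q' (by omega) h2 h3 h4⟩
    simp only [Par.stage, sweepRow, if_pos hb]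
  · rw [not_le] at hb
    refine Runs.mono (B := (500 + 500) * (p.X * 1)) (Q := J r (q + 1)) ?_ (by omega) fun _ h => h
    refine Runs.seq_right ((runs_angle v0 v1 v2 va j2).raise x6) fun υ' a3 hυ' => ?_
    obtain ⟨k1, k2, k3⟩ := hυ'
    have k0 : υ'.real 2 = p.stage i r q := (k1 2 (by norm_num) (by norm_num) (by norm_num)).trans j2
    refine (runs_columns (h2.of_agree a3) (v0.of_agree a3) (v1.of_agree a3) (v2.of_agree a3)
      (va.of_agree a3) rfl k0 (by rw [k2, if_pos ⟨rfl, rfl⟩])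
      (by rw [k3, if_pos ⟨rfl, rfl⟩])).mono le_rfl ?_
    rintro ρ' ⟨l1, l2⟩
    refine ⟨⟨?_, ?_⟩, ?_, ?_⟩
    · rw [l1 0 (by norm_num) (by norm_num), k1 0 (by norm_num) (by norm_num) (by norm_num), j1.c]
    · rw [l1 3 (by norm_num) (by norm_num), k1 3 (by norm_num) (by norm_num) (by norm_num)]
      exact j1.num
    · rw [l2]
      simp only [Par.stage, sweepRow, if_neg (not_le.2 hb)]
    · intro i' t' q' e1 e2 e3 e4
      rw [l1 5 (by norm_num) (by norm_num), l1 6 (by norm_num) (by norm_num), k2, k3]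
      by_cases e : i' = i ∧ t' * p.W + q' = r * p.W + q
      · rw [if_pos e, if_pos e]
        obtain ⟨rfl, e⟩ := e
        have hq' : q' = q := by
          -- Addresses do not collide: `q` < `W` is the remainder of t·`W` + q modulo `W`, and then
          -- `t` is determined too.
          have := congrArg (· % p.W) e
          simpa [Nat.mul_add_mod', Nat.add_comm, Nat.mod_eq_of_lt e2, Nat.mod_eq_of_lt hq] using this
        subst hq'
        have ht' : t' = r := Nat.eq_of_mul_eq_mul_right (by omega) (Nat.add_right_cancel e)
        subst ht'
        exact ⟨rfl, rfl⟩
      · rw [if_neg e, if_neg e]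
        refine j3 i' t' q' ?_ e2 e3 e4
        by_contra hcon
        refine e ?_
        have : i' = i ∧ t' = r ∧ q' = q := by omega
        obtain ⟨rfl, rfl, rfl⟩ := this
        exact ⟨rfl, rfl⟩

theorem runs_angles (hm : 1 ≤ p.m) (hc : σ.real 0 0 = p.c) (ha : σ.real 1 0 = p.a)
    (h2 : ∀ i j, σ.real 2 i j = 0) (h3 : ∀ i j, σ.real 3 i j = 0) :
    Runs 0 anglesCmd σ (4000 * (p.m * (p.X * (2 * p.X * (p.X * 1))))) (Angles p) [] := by
  obtain ⟨x1, x2, x3, x4, x5⟩ := p.bounds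
  have x6 : 1 ≤ p.X * 1 := by omega
  have x7 : 1 ≤ 2 * p.X * (p.X * 1) := Nat.mul_pos (by omega) x6
  have x8 : 1 ≤ p.X * (2 * p.X * (p.X * 1)) := Nat.mul_pos x1 x7
  have y1 : p.X * 1 ≤ p.X * (2 * p.X * (p.X * 1)) := Nat.mul_le_mul_left _ x7
  have y2 : p.X * (p.X * (p.X * 1)) ≤ p.X * (2 * p.X * (p.X * 1)) := by gcongr; omega
  have y3 : p.X * 1 ≤ p.m * (p.X * (2 * p.X * (p.X * 1))) := by
    calc p.X * 1 = 1 * (p.X * 1) := by ring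
      _ ≤ _ := Nat.mul_le_mul hm y1
  let I : ℕ → Mem → Prop := fun i ρ => Setup p ρ ∧ ρ 2 = p.bond i ∧ AnglesUpTo p i 0 0 ρ
  refine Runs.mono (B := (500 + 3000) * (p.m * (p.X * (2 * p.X * (p.X * 1))))) (Q := I p.m) ?_
    (by omega) fun ρ' h i hi t ht q hq htq => h.2.2 i t q (by omega) hq htq ht
  refine Runs.seq_right ((runs_setup h hc ha h2 h3).raise y3) fun τ a1 hτ => ?_
  have h1 := h.of_agree a1
  refine Runs.loop_silent (C := 2900) p.m (fun τ' ha' => h1.vM τ' ha') (Val.const 0) le_rfl hm x8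
    (by decide) ⟨hτ.1, hτ.2, fun i' t' q' h1 => by omega⟩ fun i hi υ a2 n0 _ hI => ?_
  have h2 := h1.of_agree a2
  obtain ⟨i1, i2, i3⟩ := hI
  refine Runs.mono (B := (300 + (500 + (500 + 1300))) * (p.X * (2 * p.X * (p.X * 1))))
    (Q := I (i + 1)) ?_ (by omega) fun _ h => h
  refine Runs.seq_right ((runs_nontriv h2 n0 rfl).raise y1) fun υ₁ b1 q1 => ?_
  have hS1 : Setup p υ₁.real := ⟨by rw [q1.1 0 (by norm_num), i1.c],
    by rw [q1.1 3 (by norm_num)]; exact i1.num⟩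
  have n1 : υ₁.nat 3 0 0 = i := (b1 3 0 0 (by omega)).trans n0
  have h3 := h2.of_agree b1
  refine Runs.seq_right ((runs_coef h3 n1 rfl hS1 q1.2).raise y1) fun υ₂ b2 q2 => ?_
  have n2 : υ₂.nat 3 0 0 = i := (b2 3 0 0 (by omega)).trans n1
  have h4 := h3.of_agree b2
  have e2 : υ₂.real 2 = p.bond i := by
    rw [q2.1 2 (by norm_num), q1.1 2 (by norm_num), i2]
  refine Runs.seq_right ((runs_transfer h4 rfl e2 q2.2).raise y2) fun υ₃ b3 q3 => ?_
  have n3 : υ₃.nat 3 0 0 = i := (b3 3 0 0 (by omega)).trans n2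
  refine runs_sweep (h4.of_agree b3) n3 rfl ⟨?_, ?_⟩ q3.2 ?_
  · rw [q3.1 0 (by norm_num), q2.1 0 (by norm_num), hS1.c]
  · rw [q3.1 3 (by norm_num), q2.1 3 (by norm_num)]; exact hS1.num
  · intro i' t' q' e1 e2 e3 e4
    rw [q3.1 5 (by norm_num), q2.1 5 (by norm_num), q1.1 5 (by norm_num),
      q3.1 6 (by norm_num), q2.1 6 (by norm_num), q1.1 6 (by norm_num)]
    exact i3 i' t' q' e1 e2 e3 e4

end ClassicalRuns

/-- Compute `l * W` by repeated addition. -/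
def productCmd : Cmd :=
  .while (.nle (.add (.read 4 (.const 0) (.const 1)) (.const 1)) el)
    (.seq (.setN 4 (.const 0) (.const 1) (.add (.read 4 (.const 0) (.const 1)) (.const 1)))
      (.setN 4 (.const 0) (.const 0) (.add (.read 4 (.const 0) (.const 0)) eW)))

/-- The algorithm. -/
def algorithm : Cmd :=
  .seq productCmd (.ite (.nle (.const 1) el) (.seq anglesCmd mainCmd) constCmd)

theorem exec_product (l d : ℕ) : ∀ (j : ℕ) (σ : Store), j + d = l → σ.nat 0 0 2 = l →
    σ.nat 4 0 1 = j → σ.nat 4 0 0 = j * (l + 1 + (l + 1)) →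
    ∃ T τ, Exec productCmd σ T τ ∧ T ≤ d * 100 + 50 ∧ (∀ t, t ≠ 4 → τ.nat t = σ.nat t) ∧
      τ.nat 4 0 0 = l * (l + 1 + (l + 1)) ∧ τ.real = σ.real ∧ τ.gates = σ.gates := by
  induction d with
  | zero =>
    intro j σ hj hl h1 h0
    refine ⟨_, σ, .while_false ?_, by decide, fun _ _ => rfl, ?_, rfl, rfl⟩
    · simp only [Test.Holds, NExpr.eval, el, hl, h1]; omega
    · rw [h0, ← hj]; rfl
  | succ d ih =>
    intro j σ hj hl h1 h0
    set σ₁ := σ.setN 4 0 1 (j + 1) with hσ₁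
    set σ₂ := σ₁.setN 4 0 0 ((j + 1) * (l + 1 + (l + 1))) with hσ₂
    obtain ⟨T, τ, e, b, k1, k2, k3, k4⟩ := ih (j + 1) σ₂ (by omega)
      (by simp [hσ₂, hσ₁, Store.setN, hl]) (by simp [hσ₂, hσ₁, Store.setN])
      (by simp [hσ₂, Store.setN])
    have e1 := Exec.setN 4 (.const 0) (.const 1)
      (.add (.read 4 (.const 0) (.const 1)) (.const 1)) σ
    have e2 := Exec.setN 4 (.const 0) (.const 0) (.add (.read 4 (.const 0) (.const 0)) eW) σ₁
    have v1 : (NExpr.add (.read 4 (.const 0) (.const 1)) (.const 1)).eval σ = j + 1 := by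
      simp [NExpr.eval, h1]
    have v2 : (NExpr.add (.read 4 (.const 0) (.const 0)) eW).eval σ₁ =
        (j + 1) * (l + 1 + (l + 1)) := by
      simp [NExpr.eval, eW, eL, el, hσ₁, Store.setN, h0, hl]; ring
    rw [v1] at e1
    rw [v2] at e2
    refine ⟨_, τ, .while_true ?_ (e1.seq e2) e, ?_, ?_, k2, k3, k4⟩
    · simp only [Test.Holds, NExpr.eval, el, hl, h1]; omega
    · simp only [Test.cost, NExpr.cost, el, eW, eL]; omega
    · intro t ht
      rw [k1 t ht]
      funext i j'
      simp [hσ₂, hσ₁, Store.setN, ht]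

variable {n m : ℕ}

/-- The parameters of an input. -/
def Par.ofInput (l : ℕ) (v : Fin m → PauliLabel n) (c : Fin m → ℝ) (a : ℕ → ℝ) : Par where
  n := n
  m := m
  l := l
  α := (inputStore l v c a).nat 1
  β := (inputStore l v c a).nat 2
  c := (inputStore l v c a).real 0 0
  a := (inputStore l v c a).real 1 0

theorem exec_algorithm (l : ℕ) (v : Fin m → PauliLabel n) (c : Fin m → ℝ) (a : ℕ → ℝ)
    (hm : 1 ≤ m) :
    ∃ T τ, Exec algorithm (inputStore l v c a) T τ ∧
      T ≤ 100000 * m * (l + n + 1) ^ 100000 ∧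
      τ.gates = (Par.ofInput l v c a).circuit := by
  set p := Par.ofInput l v c a with hp
  obtain ⟨T, τ, e, b, k1, k2, k3, k4⟩ := exec_product l l 0 (inputStore l v c a) (by omega) rfl rfl
    (by simp [inputStore])
  have henv : Env p τ := by
    constructor
    · rw [k1 0 (by norm_num)]; rfl
    · rw [k1 0 (by norm_num)]; rfl
    · rw [k1 0 (by norm_num)]; rfl
    · exact k2
    · intro i k; rw [k1 1 (by norm_num)]; rfl
    · intro i k; rw [k1 2 (by norm_num)]; rfl
  have hX : p.X = l + n + 1 := rfl
  have hpm : p.m = m := rfl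
  obtain ⟨x1, x2, x3, x4, x5⟩ := p.bounds
  have x6 : 1 ≤ p.X * 1 := by omega
  have x7 : 1 ≤ 2 * p.X * (p.X * 1) := Nat.mul_pos (by omega) x6
  have x8 : 1 ≤ p.X * (2 * p.X * (p.X * 1)) := Nat.mul_pos x1 x7
  set Z := p.m * (p.X * (2 * p.X * (p.X * 1))) with hZ
  have z1 : p.m * (p.X * (2 * p.X * 1)) ≤ Z := by
    exact Nat.mul_le_mul_left _ (Nat.mul_le_mul_left _ (Nat.mul_le_mul_left _ x6))
  have z2 : p.m + (p.n + p.n) ≤ 3 * Z := by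
    have h1 : p.m * 1 ≤ Z := Nat.mul_le_mul_left _ x8
    have h2 : p.X ≤ Z := by
      calc p.X = 1 * (p.X * 1) := by ring
        _ ≤ Z := Nat.mul_le_mul hm (Nat.mul_le_mul_left _ x7)
    omega
  have z3 : 1 ≤ Z := Nat.mul_pos hm x8
  have hb : (Test.nle (.const 1) el).Holds τ ↔ 1 ≤ p.l := by
    simp only [Test.Holds, NExpr.eval.eq_1, henv.el]
  have run : Runs 0 (.ite (.nle (.const 1) el) (.seq anglesCmd mainCmd) constCmd) τ (25000 * Z)
      (fun _ => True) p.circuit := by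
    refine Runs.ite z3 (C := 24000) (by decide) (fun h => ?_) (fun h => ?_) <;> rw [hb] at h
    · rw [Par.circuit, if_pos h]
      refine Runs.seq_right (C₁ := 4000) (C₂ := 20000) (runs_angles henv hm ?_ ?_ ?_ ?_)
        fun υ ha hρ => ((runs_main (henv.of_agree ha) hm hρ rfl).raise z1).mono le_rfl
          fun _ _ => trivial
      · rw [k3]; rfl
      · rw [k3]; rfl
      · intro i j; rw [k3]; rfl
      · intro i j; rw [k3]; rfl
    · rw [Par.circuit, if_neg h]
      exact (runs_const henv hm rfl).mono (by omega) fun _ _ => trivial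
  obtain ⟨T', υ, e', b', -, -, g'⟩ := run
  refine ⟨_, υ, e.seq e', ?_, ?_⟩
  · have h1 : l ≤ Z := by
      have : l ≤ p.m * (p.X * (2 * p.X * 1)) := by
        calc l ≤ 2 * p.X * 1 := by omega
          _ ≤ p.X * (2 * p.X * 1) := Nat.le_mul_of_pos_left _ x1
          _ ≤ _ := Nat.le_mul_of_pos_left _ hm
      omega
    -- `Z` equals 2 m X³, so a cubic power would do; the exponent is inflated to agree with the
    -- constant. The product loop takes at most 100 l + 50 ≤ 150 `Z` steps and the rest 25000 `Z`.
    have h2 : Z ≤ 2 * m * (l + n + 1) ^ 100000 := by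
      rw [hZ, hpm, ← hX]
      calc m * (p.X * (2 * p.X * (p.X * 1))) = 2 * m * p.X ^ 3 := by ring
        _ ≤ _ := Nat.mul_le_mul_left _ (Nat.pow_le_pow_right x1 (by norm_num))
    generalize (l + n + 1) ^ 100000 = E at *
    have h3 : T + T' ≤ 25150 * Z := by omega
    nlinarith
  · rw [g', k4]; rfl

/-! ### Action of circuits on basis states -/

section Kets

variable {n m : ℕ} (D : Matrix (OracleLabel n m) (OracleLabel n m) ℂ) (N : ℕ)

abbrev Vec (N : ℕ) : Type := (Fin N → ZMod 2) → ℂ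

/-- The basis state whose `q`-th qubit is `x q`. -/
def ket (N : ℕ) (x : ℕ → ZMod 2) : Vec N := Pi.single (fun q => x q) 1

/-- The linear map implemented by a circuit. -/
def run : List Gate → Vec N →ₗ[ℂ] Vec N
  | [] => LinearMap.id
  | g :: gs => run gs ∘ₗ Matrix.mulVecLin (g.matrix D N)

theorem run_nil (ψ : Vec N) : run D N [] ψ = ψ := rfl

theorem run_cons (g : Gate) (gs : List Gate) (ψ : Vec N) :
    run D N (g :: gs) ψ = run D N gs ((g.matrix D N).mulVec ψ) := rfl

theorem run_append (gs hs : List Gate) (ψ : Vec N) :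
    run D N (gs ++ hs) ψ = run D N hs (run D N gs ψ) := by
  induction gs generalizing ψ with
  | nil => rfl
  | cons g gs ih => exact ih _

theorem finalVector_eq (gs : List Gate) : finalVector D N gs = run D N gs (ket N 0) := by
  have : ∀ ψ : Vec N, gs.foldl (fun ψ g => (g.matrix D N).mulVec ψ) ψ = run D N gs ψ := by
    induction gs with
    | nil => exact fun _ => rfl
    | cons g gs ih => exact fun ψ => ih _
  exact this _

variable {N}

theorem bit_eq {q : ℕ} (hq : q < N) (z : Fin N → ZMod 2) : bit z q = z ⟨q, hq⟩ := dif_pos hq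

theorem zmod_two (a : ZMod 2) : a = 0 ∨ a = 1 := by revert a; decide

theorem sum_zmod_two {M : Type*} [AddCommMonoid M] (f : ZMod 2 → M) : ∑ b, f b = f 0 + f 1 :=
  Fin.sum_univ_two f

theorem ctrl_ket {cs : List ℕ} {t : ℕ} (U : Matrix (ZMod 2) (ZMod 2) ℂ) (ht : t < N)
    (hcs : ∀ q ∈ cs, q < N ∧ q ≠ t) (x : ℕ → ZMod 2) :
    ((Gate.ctrl cs t U).matrix D N).mulVec (ket N x) =
      if ∀ q ∈ cs, x q = 1 then ∑ b, U b (x t) • ket N (Function.update x t b) else ket N x := by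
  classical
  funext z
  rw [ket, Matrix.mulVec_single_one, Matrix.col_apply, Gate.matrix, Matrix.of_apply]
  by_cases hz : ∀ q : Fin N, (q : ℕ) ≠ t → z q = x q
  · have hc : (∀ q ∈ cs, bit z q = 1) ↔ ∀ q ∈ cs, x q = 1 :=
      forall₂_congr fun q hq => by rw [bit_eq (hcs q hq).1, hz _ (hcs q hq).2]
    rw [if_congr hc rfl rfl, if_pos hz, bit_eq ht, bit_eq ht]
    split_ifs with h1 h2
    · rw [Finset.sum_apply, Finset.sum_eq_single (z ⟨t, ht⟩)]
      · have : (fun q : Fin N => Function.update x t (z ⟨t, ht⟩) q) = z := by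
          funext q
          by_cases hq : (q : ℕ) = t
          · subst hq; simp
          · rw [Function.update_of_ne hq, hz q hq]
        simp [ket, this]
      · intro b _ hb
        rw [Pi.smul_apply, ket, Pi.single_eq_of_ne, smul_zero]
        rintro rfl
        simp at hb
      · simp
    · subst h2; simp
    · rw [Pi.single_eq_of_ne h2]
  · have hne : ∀ x' : ℕ → ZMod 2, (∀ q, q ≠ t → x' q = x q) → ket N x' z = 0 := by
      intro x' hx'
      rw [ket, Pi.single_eq_of_ne]
      rintro rfl
      exact hz fun q hq => hx' q hq
    have h0 : ¬ z = fun q : Fin N => x q := by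
      rintro rfl
      exact hz fun q hq => rfl
    rw [if_neg hz, if_neg h0]
    split_ifs with h1 h2 h2
    · rw [Finset.sum_apply, Finset.sum_eq_zero]
      intro b _
      rw [Pi.smul_apply, hne _ fun q hq => Function.update_of_ne hq _ _, smul_zero]
    · exact (hne x fun _ _ => rfl).symm
    · rw [Finset.sum_apply, Finset.sum_eq_zero]
      intro b _
      rw [Pi.smul_apply, hne _ fun q hq => Function.update_of_ne hq _ _, smul_zero]
    · exact (hne x fun _ _ => rfl).symm

theorem x_ket {cs : List ℕ} {t : ℕ} (ht : t < N) (hcs : ∀ q ∈ cs, q < N ∧ q ≠ t)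
    (x : ℕ → ZMod 2) :
    ((Gate.x cs t).matrix D N).mulVec (ket N x) =
      if ∀ q ∈ cs, x q = 1 then ket N (Function.update x t (x t + 1)) else ket N x := by
  rw [ctrl_ket D _ ht hcs]
  refine if_congr Iff.rfl ?_ rfl
  rw [sum_zmod_two]
  rcases zmod_two (x t) with h | h <;> rw [h] <;> simp [pauliX]
  rfl

theorem x₀_ket {t : ℕ} (ht : t < N) (x : ℕ → ZMod 2) :
    ((Gate.x [] t).matrix D N).mulVec (ket N x) = ket N (Function.update x t (x t + 1)) := by
  rw [x_ket D ht (by simp)]; simp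

theorem x₁_ket {s t : ℕ} (ht : t < N) (hs : s < N) (hst : s ≠ t) (x : ℕ → ZMod 2) :
    ((Gate.x [s] t).matrix D N).mulVec (ket N x) =
      ket N (Function.update x t (x t + x s)) := by
  rw [x_ket D ht (by simp [hs, hst])]
  rcases zmod_two (x s) with h | h <;> simp [h]

theorem x₂_ket {r s t : ℕ} (ht : t < N) (hr : r < N) (hs : s < N) (hrt : r ≠ t) (hst : s ≠ t)
    (x : ℕ → ZMod 2) :
    ((Gate.x [r, s] t).matrix D N).mulVec (ket N x) =
      ket N (Function.update x t (x t + x r * x s)) := by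
  rw [x_ket D ht (by simp [hr, hs, hrt, hst])]
  rcases zmod_two (x s) with h | h <;> rcases zmod_two (x r) with h' | h' <;> simp [h, h']

theorem ctrl₁_ket {s t : ℕ} (U : Matrix (ZMod 2) (ZMod 2) ℂ) (ht : t < N) (hs : s < N)
    (hst : s ≠ t) (x : ℕ → ZMod 2) :
    ((Gate.ctrl [s] t U).matrix D N).mulVec (ket N x) =
      if x s = 1 then U 0 (x t) • ket N (Function.update x t 0) +
        U 1 (x t) • ket N (Function.update x t 1) else ket N x := by
  rw [ctrl_ket D U ht (by simp [hs, hst]), sum_zmod_two]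
  simp

/-- A unit vector as image fixes one whole column of `D`, and this is the only column that the gate
uses on the basis state `x`. -/
theorem oracle_ket {x x' : ℕ → ZMod 2}
    (hx : ∀ q, m + 2 * n ≤ q → x' q = x q)
    (hD : D.mulVec (Pi.single (oracleLabel n m (fun q : Fin N => x q)) 1) =
      Pi.single (oracleLabel n m (fun q : Fin N => x' q)) 1) :
    (Gate.oracle.matrix D N).mulVec (ket N x) = ket N x' := by
  classical
  funext z
  rw [ket, Matrix.mulVec_single_one, Matrix.col_apply, Gate.matrix, Matrix.of_apply]
  have hcol := congrFun hD (oracleLabel n m z)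
  rw [Matrix.mulVec_single_one, Matrix.col_apply] at hcol
  rw [hcol]
  by_cases hz : z = fun q : Fin N => x' q
  · subst hz
    refine (if_pos fun (q : Fin N) hq => hx q hq).trans ?_
    rw [ket, Pi.single_eq_same, Pi.single_eq_same]
  · rw [ket, Pi.single_eq_of_ne hz]
    split_ifs with h
    · rw [Pi.single_eq_of_ne]
      intro he
      refine hz (funext fun q => ?_)
      have hA : ∀ i : Fin m, bit z i = bit (fun q : Fin N => x' q) i := fun i =>
        congrFun (congrArg Prod.fst he) i
      have hB : ∀ k : Fin n, bit z (m + k) = bit (fun q : Fin N => x' q) (m + k) := fun k =>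
        congrFun (congrArg Prod.snd he) (Sum.inl k)
      have hC : ∀ k : Fin n, bit z (m + n + k) = bit (fun q : Fin N => x' q) (m + n + k) :=
        fun k => congrFun (congrArg Prod.snd he) (Sum.inr k)
      have key : bit z q = bit (fun q : Fin N => x' q) q := by
        by_cases h1 : (q : ℕ) < m
        · exact hA ⟨q, h1⟩
        by_cases h2 : (q : ℕ) < m + n
        · have := hB ⟨q - m, by omega⟩
          rwa [show m + ((⟨q - m, by omega⟩ : Fin n) : ℕ) = q by simp; omega] at this
        by_cases h3 : (q : ℕ) < m + n + n
        · have := hC ⟨q - (m + n), by omega⟩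
          rwa [show m + n + ((⟨q - (m + n), by omega⟩ : Fin n) : ℕ) = q by simp; omega] at this
        · rw [bit_eq q.2, bit_eq q.2]
          exact (h q (by omega)).trans (hx q (by omega)).symm
      rwa [bit_eq q.2, bit_eq q.2] at key
    · rfl

end Kets

/-! ### The registers -/

namespace Par

variable (p : Par)

abbrev size : ℕ := p.m + (p.n + p.n) + p.W + (p.n + p.n + 1)

/-- The assignment with `y` in register `A`, `u` in `BC`, `w` in the walker, `g` in the ladder. -/
def lay (y u w g : ℕ → ZMod 2) : ℕ → ZMod 2 := fun q =>
  if q < p.m then y q else if q < p.m + (p.n + p.n) then u (q - p.m)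
  else if q < p.m + (p.n + p.n) + p.W then w (q - (p.m + (p.n + p.n)))
  else g (q - (p.m + (p.n + p.n) + p.W))

variable {p} (y u w g : ℕ → ZMod 2)

theorem lay_y {i : ℕ} (hi : i < p.m) : p.lay y u w g i = y i := if_pos hi

theorem lay_u {j : ℕ} (hj : j < p.n + p.n) : p.lay y u w g (p.m + j) = u j := by
  rw [lay, if_neg (by omega), if_pos (by omega), Nat.add_sub_cancel_left]

theorem lay_w {s : ℕ} (hs : s < p.W) : p.lay y u w g (p.wq s) = w s := by
  change p.lay y u w g (p.m + (p.n + p.n) + s) = w s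
  rw [lay, if_neg (by omega), if_neg (by omega), if_pos (by omega), Nat.add_sub_cancel_left]

theorem lay_g (j : ℕ) : p.lay y u w g (p.gq j) = g j := by
  change p.lay y u w g (p.m + (p.n + p.n) + p.W + j) = g j
  rw [lay, if_neg (by omega), if_neg (by omega), if_neg (by omega), Nat.add_sub_cancel_left]

theorem update_y {i : ℕ} (hi : i < p.m) (b : ZMod 2) :
    Function.update (p.lay y u w g) i b = p.lay (Function.update y i b) u w g := by
  funext q
  by_cases h : q = i
  · subst h; rw [lay_y _ _ _ _ hi]; simp
  · rw [Function.update_of_ne h]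
    unfold lay
    rw [Function.update_of_ne h]

theorem update_u {j : ℕ} (hj : j < p.n + p.n) (b : ZMod 2) :
    Function.update (p.lay y u w g) (p.m + j) b = p.lay y (Function.update u j b) w g := by
  funext q
  by_cases h : q = p.m + j
  · subst h; rw [lay_u _ _ _ _ hj]; simp
  · rw [Function.update_of_ne h]
    unfold lay
    split_ifs with h1 h2
    · rfl
    · rw [Function.update_of_ne (by omega)]
    all_goals rfl

theorem update_w {s : ℕ} (hs : s < p.W) (b : ZMod 2) :
    Function.update (p.lay y u w g) (p.wq s) b = p.lay y u (Function.update w s b) g := by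
  funext q
  by_cases h : q = p.wq s
  · subst h; rw [lay_w _ _ _ _ hs]; simp
  · rw [Function.update_of_ne h]
    unfold lay
    split_ifs with h1 h2 h3
    · rfl
    · rfl
    · rw [Function.update_of_ne (by simp only [wq] at h; omega)]
    · rfl

theorem update_g (j : ℕ) (b : ZMod 2) :
    Function.update (p.lay y u w g) (p.gq j) b = p.lay y u w (Function.update g j b) := by
  funext q
  by_cases h : q = p.gq j
  · subst h; rw [lay_g]; simp
  · rw [Function.update_of_ne h]
    unfold lay
    split_ifs with h1 h2 h3
    · rfl
    · rfl
    · rfl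
    · rw [Function.update_of_ne (by simp only [gq] at h; omega)]

end Par

/-! ### The walker -/

section Walker

variable {n m : ℕ} (D : Matrix (OracleLabel n m) (OracleLabel n m) ℂ) {p : Par}
  (u g : ℕ → ZMod 2)

/-- The walker is at `s`. -/
abbrev Par.walk (p : Par) (y u g : ℕ → ZMod 2) (s : ℕ) : Vec p.size :=
  ket p.size (p.lay y u (Pi.single s 1) g)

theorem run_givens_gates (c s : ℝ) {q r : ℕ} (hrq : r < q) (hq : q < p.W) (y : ℕ → ZMod 2) (t : ℕ) :
    run D p.size [.x [p.wq r] (p.wq q), .ctrl [p.wq q] (p.wq r) (rotation c s),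
      .x [p.wq r] (p.wq q)] (p.walk y u g t) =
    if t = r then (c : ℂ) • p.walk y u g r + (s : ℂ) • p.walk y u g q
    else if t = q then (c : ℂ) • p.walk y u g q - (s : ℂ) • p.walk y u g r
    else p.walk y u g t := by
  have hr : r < p.W := by omega
  have aq : p.wq q < p.size := by simp only [Par.wq, Par.size]; omega
  have ar : p.wq r < p.size := by simp only [Par.wq, Par.size]; omega
  have hne : p.wq r ≠ p.wq q := by simp only [Par.wq]; omega
  have hne' : p.wq q ≠ p.wq r := hne.symm
  have rq : r ≠ q := by omega
  have qr : q ≠ r := by omega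
  simp only [run_cons, run_nil, Par.walk]
  rw [x₁_ket D aq ar hne, Par.lay_w _ _ _ _ hq, Par.lay_w _ _ _ _ hr, Par.update_w _ _ _ _ hq,
    ctrl₁_ket D _ ar aq hne', Par.lay_w _ _ _ _ hq, Par.lay_w _ _ _ _ hr, Par.update_w _ _ _ _ hr,
    Par.update_w _ _ _ _ hr]
  by_cases h1 : t = r
  · subst h1
    simp [rq, qr, rotation, Matrix.mulVec_add, Matrix.mulVec_smul]
    rw [x₁_ket D aq ar hne, x₁_ket D aq ar hne, Par.lay_w _ _ _ _ hq, Par.lay_w _ _ _ _ hr,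
      Par.lay_w _ _ _ _ hq, Par.lay_w _ _ _ _ hr, Par.update_w _ _ _ _ hq,
      Par.update_w _ _ _ _ hq]
    rw [add_comm]
    congr 4 <;> funext j <;> simp [Function.update_apply, Pi.single_apply, qr] <;>
      split_ifs <;> first | rfl | omega
  by_cases h2 : t = q
  · subst h2
    simp [rq, qr, rotation, Matrix.mulVec_add, Matrix.mulVec_smul, Matrix.mulVec_neg]
    rw [x₁_ket D aq ar hne, x₁_ket D aq ar hne, Par.lay_w _ _ _ _ hq, Par.lay_w _ _ _ _ hr,
      Par.lay_w _ _ _ _ hq, Par.lay_w _ _ _ _ hr, Par.update_w _ _ _ _ hq,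
      Par.update_w _ _ _ _ hq, sub_eq_add_neg]
    refine congrArg₂ (· + ·)
      (congrArg (fun w => (c : ℂ) • ket p.size (p.lay y u w g)) ?_)
      (congrArg (fun w => -((s : ℂ) • ket p.size (p.lay y u w g))) ?_) <;>
    · funext j
      simp [Function.update_apply, Pi.single_apply, qr]
      try (split_ifs <;> first | rfl | omega)
  · have e1 : r ≠ t := Ne.symm h1
    have e2 : q ≠ t := Ne.symm h2
    simp [h1, h2, e1, e2]
    rw [x₁_ket D aq ar hne, Par.lay_w _ _ _ _ hq, Par.lay_w _ _ _ _ hr, Par.update_w _ _ _ _ hq]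
    refine congrArg (fun w => ket p.size (p.lay y u w g)) (funext fun j => ?_)
    simp [Function.update_apply, e1]
    try (split_ifs <;> simp_all)

/-- The superposition of the walker states with the entries of a row of `M` as amplitudes. -/
def Par.rowKet (p : Par) (M : ℕ → ℕ → ℝ) (k : ℕ) (y u g : ℕ → ZMod 2) : Vec p.size :=
  ∑ s ∈ Finset.range p.W, (M k s : ℂ) • p.walk y u g s

theorem cosG_sq_add_sinG_sq (M : ℕ → ℕ → ℝ) (r q : ℕ) :
    cosG M r q * cosG M r q + sinG M r q * sinG M r q = 1 := by
  unfold cosG sinG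
  split_ifs with h
  · norm_num
  · rw [not_le] at h
    have h1 : √(normSqG M r q) * √(normSqG M r q) = normSqG M r q := Real.mul_self_sqrt h.le
    rw [div_mul_div_comm, div_mul_div_comm, h1, ← add_div]
    exact div_self h.ne'

/-- If the norm vanishes, so does the entry already; otherwise the two products of the pivot row
cancel. -/
theorem rot_eliminates (L : ℕ) (M : ℕ → ℕ → ℝ) {r q : ℕ} (hr : r < L) (hrq : r < q) :
    rot L M r q r q = 0 := by
  unfold rot
  rw [if_pos hr, if_neg (by omega), if_pos rfl]
  unfold cosG sinG
  split_ifs with h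
  · have : M r q = 0 := by
      unfold normSqG at h
      nlinarith [mul_self_nonneg (M r r), mul_self_nonneg (M r q)]
    simp [this]
  · ring

/-- On amplitudes the gates are the transpose, hence the inverse, of the column rotation `rot`; this
is cos² + sin² = 1. -/
theorem run_rot (M : ℕ → ℕ → ℝ) {k q r : ℕ} (hk : k < p.L) (hrq : r < q) (hq : q < p.W)
    (y : ℕ → ZMod 2) :
    run D p.size [.x [p.wq r] (p.wq q), .ctrl [p.wq q] (p.wq r) (rotation (cosG M r q) (sinG M r q)),
      .x [p.wq r] (p.wq q)] (p.rowKet (rot p.L M r q) k y u g) = p.rowKet M k y u g := by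
  unfold Par.rowKet
  have hr : r ∈ Finset.range p.W := Finset.mem_range.2 (by omega)
  have hq' : q ∈ (Finset.range p.W).erase r :=
    Finset.mem_erase.2 ⟨by omega, Finset.mem_range.2 hq⟩
  rw [map_sum]
  simp only [map_smul, run_givens_gates D u g _ _ hrq hq]
  rw [← Finset.add_sum_erase _ _ hr, ← Finset.add_sum_erase _ _ hq', ← Finset.add_sum_erase _ _ hr,
    ← Finset.add_sum_erase _ _ hq', ← add_assoc, ← add_assoc]
  have qr : q ≠ r := by omega
  congr 1
  · have h := cosG_sq_add_sinG_sq M r q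
    have h' : (cosG M r q : ℂ) * cosG M r q + sinG M r q * sinG M r q = 1 := by exact_mod_cast h
    simp only [rot, if_pos hk, if_true, if_neg qr]
    generalize p.walk y u g r = a
    generalize p.walk y u g q = b
    push_cast
    match_scalars
    · linear_combination (M k r : ℂ) * h'
    · linear_combination (M k q : ℂ) * h'
  · refine Finset.sum_congr rfl fun s hs => ?_
    obtain ⟨h1, h2⟩ := Finset.mem_erase.1 hs
    obtain ⟨h3, -⟩ := Finset.mem_erase.1 h2
    simp only [rot, if_pos hk, if_neg h1, if_neg h3]

theorem run_site_rotations (i : ℕ) {k : ℕ} (hk : k < p.L) (y : ℕ → ZMod 2) :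
    run D p.size (desc (fun r => desc (p.givens i r) p.W) p.L) (p.rowKet (p.bond (i + 1)) k y u g) =
      p.rowKet (transfer p.L (p.coef i) (p.bond i)) k y u g := by
  have inner : ∀ r q, q ≤ p.W → run D p.size (desc (p.givens i r) q)
      (p.rowKet (p.stage i r q) k y u g) = p.rowKet (p.stage i r 0) k y u g := by
    intro r q
    induction q with
    | zero => exact fun _ => rfl
    | succ q ih =>
      intro hq
      rw [desc, run_append, Par.givens]
      split_ifs with h
      · rw [run_nil, ← ih (by omega)]
        simp only [Par.stage, sweepRow, if_pos h]
      · rw [← ih (by omega)]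
        congr 1
        have := run_rot D u g (p.stage i r q) hk (not_le.1 h) (by omega) y
        rw [← this]
        simp only [Par.cosA, Par.sinA]
        simp only [Par.stage, sweepRow, if_neg h]
  have outer : ∀ r, run D p.size (desc (fun r => desc (p.givens i r) p.W) r)
      (p.rowKet (p.stage i r 0) k y u g) = p.rowKet (p.stage i 0 0) k y u g := by
    intro r
    induction r with
    | zero => rfl
    | succ r ih =>
      rw [desc, run_append, ← ih]
      congr 1
      exact inner r p.W le_rfl
  exact outer p.L

/-- The alternative `h` excludes a set bit `i` with the walker at `s` or `L + s`, where the Toffoli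
gate would misfire. Its second half is the situation after an earlier merge has set the bit. -/
theorem run_merge (i s t : ℕ) (hi : i < p.m) (hs : s < p.L) (y : ℕ → ZMod 2)
    (h : y i = 0 ∨ (t ≠ s ∧ t ≠ p.L + s)) :
    run D p.size (p.merge i s) (p.walk y u g t) =
      if t = p.L + s then p.walk (Function.update y i 1) u g s else p.walk y u g t := by
  have w1 : s < p.W := by simp only [Par.W]; omega
  have w2 : p.L + s < p.W := by simp only [Par.W]; omega
  have ai : i < p.size := by simp only [Par.size]; omega
  have aq : p.wq (p.L + s) < p.size := by simp only [Par.wq, Par.size]; omega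
  have ar : p.wq s < p.size := by simp only [Par.wq, Par.size]; omega
  have hne : p.wq s ≠ p.wq (p.L + s) := by simp only [Par.wq]; omega
  have hne1 : p.wq (p.L + s) ≠ i := by simp only [Par.wq]; omega
  have sL : s ≠ p.L + s := by omega
  have Ls : p.L + s ≠ s := by omega
  simp only [Par.merge, run_cons, run_nil, Par.walk]
  rw [x₁_ket D ai aq hne1, Par.lay_w _ _ _ _ w2, Par.lay_y _ _ _ _ hi, Par.update_y _ _ _ _ hi,
    x₁_ket D ar aq hne.symm, Par.lay_w _ _ _ _ w2, Par.lay_w _ _ _ _ w1, Par.update_w _ _ _ _ w1,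
    x₂_ket D aq ai ar hne1.symm hne, Par.lay_w _ _ _ _ w2, Par.lay_w _ _ _ _ w1,
    Par.lay_y _ _ _ _ hi, Par.update_w _ _ _ _ w2]
  by_cases ht : t = p.L + s
  · subst ht
    have h0 : y i = 0 := by simpa [sL] using h
    rw [if_pos rfl, h0]
    congr 2
    · simp
    · funext j
      simp [Function.update_apply, Pi.single_apply]
      split_ifs <;> first | rfl | omega
  · have ht' : p.L + s ≠ t := Ne.symm ht
    rw [if_neg ht]
    by_cases hts : s = t
    · subst hts
      have h0 : y i = 0 := by simpa using h
      refine congrArg (ket p.size) ?_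
      simp only [h0, Pi.single_apply, if_neg Ls, add_zero, Function.update_apply]
      congr 1 <;> funext j
      · by_cases hj : j = i <;> simp [hj, h0]
      · simp [Function.update_apply, Pi.single_apply]
        split_ifs <;> first | rfl | omega
    · refine congrArg (ket p.size) ?_
      congr 1 <;> funext j
      · simp [Function.update_apply, ht']
        rintro rfl; rfl
      · simp [Function.update_apply, Pi.single_apply, ht', hts]
        try (split_ifs <;> first | rfl | omega)

theorem run_merges (i t : ℕ) (hi : i < p.m) (ht : t < p.W) (y : ℕ → ZMod 2) (h : y i = 0) :
    run D p.size ((List.range p.L).flatMap (p.merge i)) (p.walk y u g t) =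
      if p.L ≤ t then p.walk (Function.update y i 1) u g (t - p.L) else p.walk y u g t := by
  have key : ∀ j ≤ p.L, run D p.size ((List.range j).flatMap (p.merge i)) (p.walk y u g t) =
      if p.L ≤ t ∧ t < p.L + j then p.walk (Function.update y i 1) u g (t - p.L)
      else p.walk y u g t := by
    intro j
    induction j with
    | zero => intro _; rw [if_neg (by omega)]; rfl
    | succ j ih =>
      intro hj
      rw [List.range_succ, List.flatMap_append, run_append, ih (by omega)]
      simp only [List.flatMap_cons, List.flatMap_nil, List.append_nil]
      split_ifs with h1 h2 h2
      · rw [run_merge D u g i j _ hi (by omega) _ (Or.inr (by omega)), if_neg (by omega)]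
      · omega
      · rw [run_merge D u g i j _ hi (by omega) _ (Or.inl h), if_pos (by omega)]
        congr 1; omega
      · rw [run_merge D u g i j _ hi (by omega) _ (Or.inl h), if_neg (by omega)]
  rw [key p.L le_rfl]
  exact if_congr (by simp only [Par.W] at ht; omega) rfl rfl

/-! ### Triangularity of the bond matrices. -/

section Bond

theorem sweepRow_row {L : ℕ} (M : ℕ → ℕ → ℝ) (r q : ℕ) {k : ℕ} (hk : L ≤ k) :
    sweepRow L M r q k = M k := by
  induction q with
  | zero => rfl
  | succ q ih =>
    rw [sweepRow]
    split_ifs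
    · exact ih
    · funext s
      rw [rot, if_neg (by omega), ih]

theorem sweep_row {L : ℕ} (M : ℕ → ℕ → ℝ) (r : ℕ) {k : ℕ} (hk : L ≤ k) :
    sweep L M r k = M k := by
  induction r with
  | zero => rfl
  | succ r ih => rw [sweep, sweepRow_row _ _ _ hk, ih]

/-- Derivatives of order above l vanish, which is why sums over `k + d` need no truncation. -/
theorem Par.bond_row (p : Par) (i : ℕ) {k : ℕ} (hk : p.L ≤ k) (s : ℕ) : p.bond i k s = 0 := by
  induction i generalizing s with
  | zero => exact if_neg (by omega)
  | succ i ih => rw [Par.bond, sweep_row _ _ hk, transfer, if_neg (by omega), ih]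

theorem rot_of_ne {L r q : ℕ} (M : ℕ → ℕ → ℝ) (k : ℕ) {s : ℕ} (hr : s ≠ r) (hq : s ≠ q) :
    rot L M r q k s = M k s := by
  rw [rot, if_neg hr, if_neg hq, ite_self]

theorem rot_zero {L r q : ℕ} {M : ℕ → ℕ → ℝ} {k : ℕ} (hr : M k r = 0) (hq : M k q = 0) (s : ℕ)
    (hs : M k s = 0) : rot L M r q k s = 0 := by
  rw [rot]; split_ifs <;> simp [hr, hq, hs]

/-- Zeros once made survive: a later rotation acts on two columns to the right of the diagonal of
every finished row, and there it combines zeros with zeros. -/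
theorem sweep_lower {L : ℕ} (M : ℕ → ℕ → ℝ) (r : ℕ) (hr : r ≤ L) :
    ∀ r' < r, ∀ s, r' < s → s < L + L → sweep L M r r' s = 0 := by
  induction r with
  | zero => intro r' h; omega
  | succ r ih =>
    have ih := ih (by omega)
    have inner : ∀ q ≤ L + L, (∀ r' < r, ∀ s, r' < s → s < L + L →
        sweepRow L (sweep L M r) r q r' s = 0) ∧
        ∀ s, r < s → s < q → sweepRow L (sweep L M r) r q r s = 0 := by
      intro q
      induction q with
      | zero => exact fun _ => ⟨ih, fun s _ h => by omega⟩
      | succ q ihq =>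
        intro hq
        obtain ⟨h1, h2⟩ := ihq (by omega)
        rw [sweepRow]
        split_ifs with h
        · exact ⟨h1, fun s hs hs' => by omega⟩
        · refine ⟨fun r' hr' s hs hs' => ?_, fun s hs hs' => ?_⟩
          · exact rot_zero (h1 r' hr' r hr' (by omega)) (h1 r' hr' q (by omega) (by omega)) s
              (h1 r' hr' s hs hs')
          · by_cases hsq : s = q
            · subst hsq; exact rot_eliminates L _ (by omega) hs
            · rw [rot_of_ne _ _ (by omega) hsq]
              exact h2 s hs (by omega)
    obtain ⟨h1, h2⟩ := inner (L + L) le_rfl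
    intro r' hr' s hs hs'
    rw [sweep]
    by_cases h : r' = r
    · subst h; exact h2 s hs hs'
    · exact h1 r' (by omega) s hs hs'

theorem Par.bond_lower (p : Par) (i k : ℕ) {s : ℕ} (hs : k < s) (hsW : s < p.W) :
    p.bond i k s = 0 := by
  by_cases hk : k < p.L
  · cases i with
    | zero => exact if_neg (by omega)
    | succ i => exact sweep_lower _ _ le_rfl k hk s hs hsW
  · exact p.bond_row i (by omega) s

/-- A lower triangular matrix with `L` rows lives in its first `L` columns. So elimination folds
2`L` columns back into `L` and the bond dimension does not grow. -/
theorem Par.bond_col (p : Par) (i k : ℕ) {s : ℕ} (hs : p.L ≤ s) (hsW : s < p.W) :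
    p.bond i k s = 0 := by
  by_cases hk : k < p.L
  · exact p.bond_lower i k (by omega) hsW
  · exact p.bond_row i (by omega) s

end Bond

/-- The amplitude of the set `S` of terms after `i` sites, starting with bond index `k`. -/
def Par.amp (p : Par) : ℕ → ℕ → Finset ℕ → ℝ
  | 0, k, _ => p.bond 0 k 0
  | i + 1, k, S =>
    if i ∈ S then ∑ d ∈ Finset.range p.L, (p.coef i (d + 1)).2 * amp p i (k + (d + 1)) S
    else amp p i k S + ∑ d ∈ Finset.range p.L, (p.coef i (d + 1)).1 * amp p i (k + (d + 1)) S

theorem Par.amp_row (i : ℕ) {k : ℕ} (hk : p.L ≤ k) (S : Finset ℕ) : p.amp i k S = 0 := by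
  induction i generalizing k with
  | zero => exact p.bond_row 0 hk 0
  | succ i ih =>
    rw [Par.amp, ih hk, Finset.sum_eq_zero, Finset.sum_eq_zero]
    · simp
    all_goals intro d _; rw [ih (by omega), mul_zero]

theorem Par.amp_congr (i k : ℕ) {S S' : Finset ℕ} (h : ∀ j < i, j ∈ S ↔ j ∈ S') :
    p.amp i k S = p.amp i k S' := by
  induction i generalizing k with
  | zero => rfl
  | succ i ih =>
    have ih := fun k => ih k fun j hj => h j (by omega)
    simp only [Par.amp, ih, h i (by omega)]

/-- `y` with the bits in `S` set to `1`. -/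
def setBits (y : ℕ → ZMod 2) (S : Finset ℕ) : ℕ → ZMod 2 := fun q => if q ∈ S then 1 else y q

theorem setBits_empty (y : ℕ → ZMod 2) : setBits y ∅ = y := by funext q; simp [setBits]

theorem setBits_update (y : ℕ → ZMod 2) (S : Finset ℕ) (i : ℕ) :
    setBits (Function.update y i 1) S = setBits y (insert i S) := by
  funext q
  by_cases h : q = i
  · subst h; simp [setBits]
  · simp [setBits, h]

theorem rowKet_zero (k : ℕ) (y : ℕ → ZMod 2) (M : ℕ → ℕ → ℝ) (h : ∀ s, M k s = 0) :
    p.rowKet M k y u g = 0 :=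
  Finset.sum_eq_zero fun s _ => by rw [h]; simp

theorem rowKet_eq (i k : ℕ) (y : ℕ → ZMod 2) :
    p.rowKet (p.bond i) k y u g = ∑ s ∈ Finset.range p.L, (p.bond i k s : ℂ) • p.walk y u g s := by
  rw [Par.rowKet, Par.W, Finset.sum_range_add, add_eq_left]
  refine Finset.sum_eq_zero fun s hs => ?_
  rw [Finset.mem_range] at hs
  rw [p.bond_col i k (by omega) (by simp only [Par.W]; omega)]
  simp

/-- The physical form of the Taylor step: raising the order by `d + 1` either leaves bit `i` alone
or sets it, with the two components of `coef` as weights; the summand without `d` is the constant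
term of the exponential. -/
theorem run_merges_rowKet (i : ℕ) (hi : i < p.m) {k : ℕ} (hk : k < p.L) (y : ℕ → ZMod 2)
    (h : y i = 0) :
    run D p.size ((List.range p.L).flatMap (p.merge i))
      (p.rowKet (transfer p.L (p.coef i) (p.bond i)) k y u g) =
      p.rowKet (p.bond i) k y u g + ∑ d ∈ Finset.range p.L,
        (((p.coef i (d + 1)).1 : ℂ) • p.rowKet (p.bond i) (k + (d + 1)) y u g +
          ((p.coef i (d + 1)).2 : ℂ) •
            p.rowKet (p.bond i) (k + (d + 1)) (Function.update y i 1) u g) := by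
  have e1 : ∀ s < p.L, run D p.size ((List.range p.L).flatMap (p.merge i)) (p.walk y u g s) =
      p.walk y u g s := fun s hs => by
    rw [run_merges D u g i s hi (by simp only [Par.W]; omega) y h, if_neg (by omega)]
  have e2 : ∀ s < p.L, run D p.size ((List.range p.L).flatMap (p.merge i))
      (p.walk y u g (p.L + s)) = p.walk (Function.update y i 1) u g s := fun s hs => by
    rw [run_merges D u g i _ hi (by simp only [Par.W]; omega) y h, if_pos (by omega),
      Nat.add_sub_cancel_left]
  have t1 : ∀ s < p.L, transfer p.L (p.coef i) (p.bond i) k s = p.bond i k s +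
      ∑ d ∈ Finset.range p.L, (p.coef i (d + 1)).1 * p.bond i (k + (d + 1)) s := fun s hs => by
    rw [transfer, if_pos hk, if_pos hs]
  have t2 : ∀ s < p.L, transfer p.L (p.coef i) (p.bond i) k (p.L + s) =
      ∑ d ∈ Finset.range p.L, (p.coef i (d + 1)).2 * p.bond i (k + (d + 1)) s := fun s hs => by
    rw [transfer, if_pos hk, if_neg (by omega), if_pos (by omega), Nat.add_sub_cancel_left,
      p.bond_col i k (by omega) (by simp only [Par.W]; omega), zero_add]
  simp only [rowKet_eq, Finset.smul_sum, Finset.sum_add_distrib]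
  rw [Par.rowKet, Par.W, Finset.sum_range_add, map_add, map_sum, map_sum, ← add_assoc]
  congr 1
  · rw [Finset.sum_comm, ← Finset.sum_add_distrib]
    refine Finset.sum_congr rfl fun s hs => ?_
    rw [Finset.mem_range] at hs
    rw [map_smul, e1 s hs, t1 s hs]
    push_cast
    rw [add_smul, Finset.sum_smul]
    simp only [smul_smul]
  · rw [Finset.sum_comm]
    refine Finset.sum_congr rfl fun s hs => ?_
    rw [Finset.mem_range] at hs
    rw [map_smul, e2 s hs, t2 s hs]
    push_cast
    rw [Finset.sum_smul]
    simp only [smul_smul]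

/-- Each round undoes one elimination and one transfer step, which is exactly the recursion defining
`amp`; splitting the subsets by membership of `i` matches the two values of its bit. -/
theorem run_sites (i : ℕ) (hi : i ≤ p.m) (k : ℕ) (y : ℕ → ZMod 2) (hy : ∀ j < i, y j = 0) :
    run D p.size (desc p.siteCirc i) (p.rowKet (p.bond i) k y u g) =
      ∑ S ∈ (Finset.range i).powerset, (p.amp i k S : ℂ) • p.walk (setBits y S) u g 0 := by
  induction i generalizing k y with
  | zero =>
    rw [rowKet_eq, Finset.sum_eq_single_of_mem 0 (by simp)]
    · simp [desc, run_nil, setBits_empty, Par.amp]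
    · intro s hs hs0
      rw [Finset.mem_range] at hs
      rw [show p.bond 0 k s = 0 from if_neg fun h => hs0 h.1]
      simp
  | succ i ih =>
    by_cases hk : k < p.L
    swap
    · rw [rowKet_zero _ _ _ _ _ fun s => p.bond_row _ (by omega) s, map_zero,
        Finset.sum_eq_zero]
      intro S _
      rw [p.amp_row _ (by omega)]; simp
    have hyi := hy i (by omega)
    have ih0 := fun k => ih (by omega) k y fun j hj => hy j (by omega)
    have ih1 := fun k => ih (by omega) k (Function.update y i 1) fun j hj => by
      rw [Function.update_of_ne (by omega), hy j (by omega)]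
    rw [desc, run_append, Par.siteCirc, run_append, run_site_rotations D u g i hk,
      run_merges_rowKet D u g i (by omega) hk y hyi, map_add, map_sum]
    simp only [map_add, map_smul, ih0, ih1]
    rw [show Finset.range (i + 1) = insert i (Finset.range i) from Finset.range_add_one,
      Finset.sum_powerset_insert Finset.notMem_range_self]
    have hS : ∀ S ∈ (Finset.range i).powerset, i ∉ S := fun S hS h => by
      have := Finset.mem_powerset.1 hS h; simp at this
    simp only [Finset.smul_sum, Finset.sum_add_distrib]
    rw [← add_assoc]
    congr 1
    · rw [Finset.sum_comm, ← Finset.sum_add_distrib]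
      refine Finset.sum_congr rfl fun S h => ?_
      rw [Par.amp, if_neg (hS S h)]
      push_cast
      rw [add_smul, Finset.sum_smul]
      simp only [smul_smul]
    · rw [Finset.sum_comm]
      refine Finset.sum_congr rfl fun S h => ?_
      rw [Par.amp, if_pos (Finset.mem_insert_self _ _), setBits_update]
      push_cast
      rw [Finset.sum_smul]
      refine Finset.sum_congr rfl fun d _ => ?_
      rw [smul_smul, p.amp_congr i _ (S := S) (S' := insert i S)]
      intro j hj
      simp [show j ≠ i by omega]

end Walker

/-! ### The amplitudes are the coefficients of the polynomial of the Hamiltonian -/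

section Taylor

variable {A : Type*} [Ring A] [Algebra ℝ A]

/-- Taylor's formula, checked on monomials, where it is the binomial theorem for commuting elements;
terms with d above the degree vanish. -/
theorem aeval_add_of_commute {x h : A} (hxh : Commute x h) (Q : Polynomial ℝ) {N : ℕ}
    (hQ : Q.natDegree ≤ N) :
    Polynomial.aeval (x + h) Q = ∑ d ∈ Finset.range (N + 1),
      ((Nat.factorial d : ℝ)⁻¹) • (x ^ d * Polynomial.aeval h (Polynomial.derivative^[d] Q)) := by
  refine Polynomial.induction_with_natDegree_le (motive := fun Q => Polynomial.aeval (x + h) Q =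
    ∑ d ∈ Finset.range (N + 1), ((Nat.factorial d : ℝ)⁻¹) •
      (x ^ d * Polynomial.aeval h (Polynomial.derivative^[d] Q))) N ?_ ?_ ?_ Q hQ
  · simp
  · intro n r hr hn
    have hd : ∀ d, Polynomial.derivative^[d] (Polynomial.C r * Polynomial.X ^ n) =
        ((n.descFactorial d : ℝ) * r) • (Polynomial.X ^ (n - d) : Polynomial ℝ) := fun d => by
      rw [← Polynomial.smul_eq_C_mul, Polynomial.iterate_derivative_smul,
        Polynomial.iterate_derivative_X_pow_eq_smul, smul_smul, mul_comm]
    simp only [hd]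
    rw [← Polynomial.smul_eq_C_mul]
    simp only [map_smul, map_pow, Polynomial.aeval_X]
    rw [hxh.add_pow, Finset.smul_sum, ← Finset.sum_subset (Finset.range_mono
      (show n + 1 ≤ N + 1 by omega))]
    · refine Finset.sum_congr rfl fun d hd => ?_
      rw [mul_smul_comm, smul_smul, Nat.descFactorial_eq_factorial_mul_choose, ← nsmul_eq_mul',
        ← Nat.cast_smul_eq_nsmul ℝ, smul_smul]
      congr 1
      have : (Nat.factorial d : ℝ) ≠ 0 := by exact_mod_cast Nat.factorial_ne_zero d
      push_cast
      field_simp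
    · intro d _ hd
      rw [Finset.mem_range, not_lt] at hd
      rw [Nat.descFactorial_of_lt (by omega)]
      simp
  · intro f g _ _ hf hg
    simp only [iterate_map_add, map_add, hf, hg, mul_add, smul_add,
      Finset.sum_add_distrib]

/-- Since x² = 1, multiplying by x swaps the coefficients of 1 and x, which is the recursion for ν =
1. If x = 1, everything is collected in the coefficient of 1. -/
theorem expCoef_spec (c ν : ℝ) (x : A) (hx : x * x = 1) (hν : ν = 1 ∨ (ν = 0 ∧ x = 1)) (d : ℕ) :
    (expCoef c ν d).1 • (1 : A) + (expCoef c ν d).2 • x =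
      (c ^ d * (Nat.factorial d : ℝ)⁻¹) • x ^ d := by
  induction d with
  | zero => simp [expCoef]
  | succ d ih =>
    have e : (c ^ (d + 1) * (Nat.factorial (d + 1) : ℝ)⁻¹) • x ^ (d + 1) =
        (c / (d + 1 : ℝ)) • (x * ((c ^ d * (Nat.factorial d : ℝ)⁻¹) • x ^ d)) := by
      rw [mul_smul_comm, ← pow_succ', smul_smul, Nat.factorial_succ]
      push_cast
      congr 1
      rw [pow_succ, mul_inv]; ring
    rw [e, ← ih, mul_add, mul_smul_comm, mul_smul_comm, hx, mul_one]
    rcases hν with rfl | ⟨rfl, rfl⟩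
    · simp only [expCoef, one_mul, sub_self, zero_mul, add_zero]
      module
    · simp only [expCoef]
      have h2 : (expCoef c 0 d).2 = 0 := by
        cases d <;> simp [expCoef]
      rw [h2]
      module

/-- The product of the `x j`, `j ∈ S`, `j < i`, later factors to the left. -/
def opProd (x : ℕ → A) : ℕ → Finset ℕ → A
  | 0, _ => 1
  | i + 1, S => (if i ∈ S then x i else 1) * opProd x i S

omit [Algebra ℝ A] in
theorem opProd_congr (x : ℕ → A) (i : ℕ) {S S' : Finset ℕ} (h : ∀ j < i, j ∈ S ↔ j ∈ S') :
    opProd x i S = opProd x i S' := by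
  induction i with
  | zero => rfl
  | succ i ih =>
    simp only [opProd, ih fun j hj => h j (by omega), h i (by omega)]

theorem opProd_sum_step (p : Par) (x : ℕ → A) (i k : ℕ) (F : ℕ → A)
    (hF : ∀ k, ∑ S ∈ (Finset.range i).powerset, p.amp i k S • opProd x i S = F k) :
    ∑ S ∈ (Finset.range (i + 1)).powerset, p.amp (i + 1) k S • opProd x (i + 1) S =
      F k + ∑ d ∈ Finset.range p.L, ((p.coef i (d + 1)).1 • (1 : A) + (p.coef i (d + 1)).2 • x i) *
        F (k + (d + 1)) := by
  have hS : ∀ S ∈ (Finset.range i).powerset, i ∉ S := fun S hS h => by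
    have := Finset.mem_powerset.1 hS h; simp at this
  rw [show Finset.range (i + 1) = insert i (Finset.range i) from Finset.range_add_one,
    Finset.sum_powerset_insert Finset.notMem_range_self]
  simp only [add_mul, smul_mul_assoc, one_mul, Finset.sum_add_distrib]
  simp only [← hF]
  simp only [Finset.smul_sum, Finset.mul_sum]
  rw [← add_assoc]
  congr 1
  · rw [Finset.sum_comm, ← Finset.sum_add_distrib]
    refine Finset.sum_congr rfl fun S h => ?_
    rw [Par.amp, if_neg (hS S h), opProd, if_neg (hS S h), one_mul, add_smul, Finset.sum_smul]
    simp only [smul_smul]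
  · rw [Finset.sum_comm]
    refine Finset.sum_congr rfl fun S h => ?_
    have hc : ∀ j < i, j ∈ S ↔ j ∈ insert i S := fun j hj => by simp [show j ≠ i by omega]
    rw [Par.amp, if_pos (Finset.mem_insert_self _ _), opProd, if_pos (Finset.mem_insert_self _ _),
      Finset.sum_smul, ← opProd_congr x i hc]
    refine Finset.sum_congr rfl fun d _ => ?_
    rw [mul_smul_comm, smul_smul, p.amp_congr i _ hc]

/-- The meaning of the amplitudes: bond index `k` stands for the k-th derivative, evaluated at the
partial sum of the first `i` terms. Adding a term is Taylor's formula, with commutativity used to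
expand around that partial sum. -/
theorem sum_amp_opProd (p : Par) (x : ℕ → A) (hx : ∀ i < p.m, x i * x i = 1)
    (hc : ∀ i < p.m, ∀ j < p.m, Commute (x i) (x j)) (hn : ∀ i < p.m, ¬ p.Nontriv i → x i = 1)
    (Q : Polynomial ℝ) (hQ : Q.natDegree ≤ p.l) (ha : ∀ k ≤ p.l, p.a k = Q.coeff k) (i : ℕ)
    (hi : i ≤ p.m) (k : ℕ) :
    ∑ S ∈ (Finset.range i).powerset, p.amp i k S • opProd x i S =
      Polynomial.aeval (∑ j ∈ Finset.range i, p.c j • x j) (Polynomial.derivative^[k] Q) := by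
  have hL : p.L = p.l + 1 := rfl
  induction i generalizing k with
  | zero =>
    have : p.amp 0 k ∅ = (Polynomial.derivative^[k] Q).coeff 0 := by
      rw [Polynomial.coeff_iterate_derivative, zero_add, Nat.descFactorial_self, Par.amp, Par.bond,
        nsmul_eq_mul]
      show (if 0 = 0 ∧ k < p.L then _ else _) = _
      by_cases hk : k < p.L
      · rw [if_pos ⟨rfl, hk⟩, ha k (by omega)]
      · rw [if_neg fun h => hk h.2, Polynomial.coeff_eq_zero_of_natDegree_lt (by omega), mul_zero]
    simp only [Finset.range_zero, Finset.powerset_empty, Finset.sum_singleton, Finset.sum_empty]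
    rw [this, ← Polynomial.coeff_zero_eq_aeval_zero', opProd, Algebra.smul_def, mul_one]
  | succ i ih =>
    have ih := ih (by omega)
    have hcomm : Commute (p.c i • x i) (∑ j ∈ Finset.range i, p.c j • x j) := by
      refine Commute.sum_right _ _ _ fun j hj => ?_
      rw [Finset.mem_range] at hj
      exact ((hc i (by omega) j (by omega)).smul_left _).smul_right _
    have hν : p.nontriv i = 1 ∨ (p.nontriv i = 0 ∧ x i = 1) := by
      unfold Par.nontriv
      by_cases h : p.Nontriv i
      · exact Or.inl (if_pos h)
      · exact Or.inr ⟨if_neg h, hn i (by omega) h⟩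
    -- Taylor's formula is applied with `N` = `L`, one above the degree bound, so that the terms of
    -- positive order are indexed by `range L` as in `amp`.
    rw [opProd_sum_step p x i k _ ih, Finset.sum_range_succ (fun j => p.c j • x j) i, add_comm (∑ j ∈ _, _),
      aeval_add_of_commute hcomm _ (N := p.L)
        (by have := Polynomial.natDegree_iterate_derivative Q k; omega), Finset.sum_range_succ' (n := p.L)]
    rw [add_comm]
    congr 1
    · refine Finset.sum_congr rfl fun d _ => ?_
      rw [Par.coef, expCoef_spec _ _ _ (hx i (by omega)) hν, ← Function.iterate_add_apply,
        smul_pow, smul_mul_assoc, smul_mul_assoc, smul_smul, mul_comm (_ ^ _),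
        Nat.add_comm (d + 1) k]
    · simp

end Taylor

/-- Setting a bit raises the order of the derivative by at least one and orders beyond l give zero,
so |S| + k ≤ l. Bits of identity terms carry weight zero. These are the conditions under which the
decoder works. -/
theorem Par.amp_support (p : Par) (i k : ℕ) (S : Finset ℕ) (hS : S ⊆ Finset.range i)
    (h : p.amp i k S ≠ 0) : S.card + k ≤ p.l ∧ ∀ j ∈ S, p.Nontriv j := by
  induction i generalizing k S with
  | zero =>
    obtain rfl : S = ∅ := by simpa using hS
    refine ⟨?_, by simp⟩
    by_contra hk
    exact h (p.amp_row _ (by rw [Finset.card_empty] at hk; change p.l + 1 ≤ k; omega) _)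
  | succ i ih =>
    rw [Par.amp] at h
    by_cases hi : i ∈ S
    · rw [if_pos hi] at h
      obtain ⟨d, -, hd⟩ := Finset.exists_ne_zero_of_sum_ne_zero h
      rw [p.amp_congr i _ (S' := S.erase i) fun j hj => by simp [show j ≠ i by omega]] at hd
      obtain ⟨h1, h2⟩ := ih _ (S.erase i) (fun j hj => by
        have h3 := Finset.mem_erase.1 hj
        have := Finset.mem_range.1 (hS h3.2)
        exact Finset.mem_range.2 (by omega)) (right_ne_zero_of_mul hd)
      have h3 := Finset.card_erase_add_one hi
      refine ⟨by omega, fun j hj => ?_⟩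
      by_cases hji : j = i
      · subst hji
        by_contra hn
        refine left_ne_zero_of_mul hd ?_
        simp [Par.coef, Par.nontriv, hn, expCoef]
      · exact h2 j (Finset.mem_erase.2 ⟨hji, hj⟩)
    · rw [if_neg hi] at h
      have hS' : S ⊆ Finset.range i := fun j hj => by
        have := Finset.mem_range.1 (hS hj)
        have : j ≠ i := fun e => hi (e ▸ hj)
        exact Finset.mem_range.2 (by omega)
      by_cases h0 : p.amp i k S = 0
      · rw [h0, zero_add] at h
        obtain ⟨d, -, hd⟩ := Finset.exists_ne_zero_of_sum_ne_zero h
        obtain ⟨h1, h2⟩ := ih _ S hS' (right_ne_zero_of_mul hd)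
        exact ⟨by omega, h2⟩
      · exact ih k S hS' h0

/-! ### Tensor products of one-qubit operators -/

section Tensor

variable {n : ℕ}

def tensor (M : Fin n → Matrix (ZMod 2) (ZMod 2) ℂ) :
    Matrix (Fin n → ZMod 2) (Fin n → ZMod 2) ℂ :=
  Matrix.of fun x y => ∏ k, M k (x k) (y k)

theorem tensor_mul (M M' : Fin n → Matrix (ZMod 2) (ZMod 2) ℂ) :
    tensor M * tensor M' = tensor fun k => M k * M' k := by
  ext x y
  simp only [tensor, Matrix.mul_apply, Matrix.of_apply, ← Finset.prod_mul_distrib]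
  rw [Finset.prod_univ_sum, Fintype.piFinset_univ]

theorem tensor_smul (c : Fin n → ℂ) (M : Fin n → Matrix (ZMod 2) (ZMod 2) ℂ) :
    tensor (fun k => c k • M k) = (∏ k, c k) • tensor M := by
  ext x y
  simp only [tensor, Matrix.of_apply, Matrix.smul_apply, smul_eq_mul, Finset.prod_mul_distrib]

theorem tensor_one : tensor (fun _ : Fin n => 1) = 1 := by
  ext x y
  simp only [tensor, Matrix.of_apply, Matrix.one_apply]
  by_cases h : x = y
  · simp [h]
  · obtain ⟨k, hk⟩ := Function.ne_iff.1 h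
    rw [if_neg h]
    exact Finset.prod_eq_zero (Finset.mem_univ k) (if_neg hk)

theorem tensor_conjTranspose (M : Fin n → Matrix (ZMod 2) (ZMod 2) ℂ) :
    (tensor M).conjTranspose = tensor fun k => (M k).conjTranspose := by
  ext x y
  simp [tensor, Matrix.conjTranspose_apply]

def sgn (a x : ZMod 2) : ℂ := if a = 1 ∧ x = 1 then -1 else 1

def zx (a b : ZMod 2) : Matrix (ZMod 2) (ZMod 2) ℂ :=
  Matrix.of fun x y => if x = y + b then sgn a x else 0

def phase (a b : ZMod 2) : ℂ := if a = 1 ∧ b = 1 then -Complex.I else 1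

theorem zx_zero : zx 0 0 = 1 := by
  ext x y
  simp [zx, sgn, Matrix.one_apply]

theorem pauliOne_eq (a b : ZMod 2) : pauliOne a b = phase a b • zx a b := by
  have v1 : (1 : ZMod 2).val = 1 := rfl
  have e : (1 + 1 : ZMod 2) = 0 := by decide
  rcases zmod_two a with rfl | rfl <;> rcases zmod_two b with rfl | rfl <;> ext x y <;>
    rcases zmod_two x with rfl | rfl <;> rcases zmod_two y with rfl | rfl <;>
    simp [pauliOne, phase, zx, sgn, pauliX, pauliZ, v1, e, Matrix.diagonal_mul]

theorem pauliOne_mul_self (a b : ZMod 2) : pauliOne a b * pauliOne a b = 1 := by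
  have e : (1 + 1 : ZMod 2) = 0 := by decide
  rw [pauliOne_eq]
  rcases zmod_two a with rfl | rfl <;> rcases zmod_two b with rfl | rfl <;> ext x y <;>
    rcases zmod_two x with rfl | rfl <;> rcases zmod_two y with rfl | rfl <;>
    simp [phase, zx, sgn, e, Matrix.mul_apply]

theorem pauliOne_conjTranspose (a b : ZMod 2) : (pauliOne a b).conjTranspose = pauliOne a b := by
  have e : (1 + 1 : ZMod 2) = 0 := by decide
  rw [pauliOne_eq]
  rcases zmod_two a with rfl | rfl <;> rcases zmod_two b with rfl | rfl <;> ext x y <;>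
    rcases zmod_two x with rfl | rfl <;> rcases zmod_two y with rfl | rfl <;>
    simp [phase, zx, sgn, e, Matrix.conjTranspose_apply]

theorem pauliOne_zero : pauliOne 0 0 = 1 := by simp [pauliOne]

/-- Moving X^b past Z^{a'} costs the sign (-1)^{a'b}; the rest is addition of exponents modulo 2. -/
theorem pauliOne_mul_zx (a b a' b' : ZMod 2) :
    pauliOne a b * zx a' b' = (phase a b * sgn b a') • zx (a' + a) (b' + b) := by
  have e : (1 + 1 : ZMod 2) = 0 := by decide
  rw [pauliOne_eq]
  ext x y
  simp only [Matrix.smul_mul, Matrix.smul_apply, mul_smul]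
  congr 1
  rcases zmod_two a with rfl | rfl <;> rcases zmod_two b with rfl | rfl <;>
    rcases zmod_two a' with rfl | rfl <;> rcases zmod_two b' with rfl | rfl <;>
    rcases zmod_two x with rfl | rfl <;> rcases zmod_two y with rfl | rfl <;>
    simp [zx, sgn, e, Matrix.mul_apply]

/-- `Z^{u₀} X^{uₙ} ⊗ Z^{u₁} X^{uₙ₊₁} ⊗ ⋯`. -/
def zxTensor (n : ℕ) (u : ℕ → ZMod 2) : Matrix (Fin n → ZMod 2) (Fin n → ZMod 2) ℂ :=
  tensor fun k => zx (u k) (u (n + k))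

theorem zxTensor_zero : zxTensor n 0 = 1 := by simp [zxTensor, zx_zero, tensor_one]

end Tensor

/-! ### Symplectic labels and the controlled Pauli circuit. -/

namespace Par

variable (p : Par)

def zBit (i k : ℕ) : ZMod 2 := if 1 ≤ p.α i k then 1 else 0
def xBit (i k : ℕ) : ZMod 2 := if 1 ≤ p.β i k then 1 else 0

/-- The `i`-th Pauli operator. -/
def op (i : ℕ) : Matrix (Fin p.n → ZMod 2) (Fin p.n → ZMod 2) ℂ :=
  tensor fun k => pauliOne (p.zBit i k) (p.xBit i k)

/-- The part of the symplectic representation of the `i`-th Pauli operator on the qubits `< K`. -/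
def sympPart (K i j : ℕ) : ZMod 2 :=
  if j < p.n then (if j < K then p.zBit i j else 0)
  else if j < p.n + K then p.xBit i (j - p.n) else 0

/-- The symplectic representation of the `i`-th Pauli operator. -/
abbrev symp : ℕ → ℕ → ZMod 2 := p.sympPart p.n

theorem op_mul_self (i : ℕ) : p.op i * p.op i = 1 := by
  simp only [op, tensor_mul, pauliOne_mul_self, tensor_one]

theorem op_conjTranspose (i : ℕ) : (p.op i).conjTranspose = p.op i := by
  simp only [op, tensor_conjTranspose, pauliOne_conjTranspose]

theorem op_of_not_nontriv {i : ℕ} (h : ¬ p.Nontriv i) : p.op i = 1 := by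
  unfold op
  rw [← tensor_one]
  congr 1
  funext k
  have h1 : ¬ 1 ≤ p.α i k := fun hk => h ⟨k, k.2, Or.inl hk⟩
  have h2 : ¬ 1 ≤ p.β i k := fun hk => h ⟨k, k.2, Or.inr hk⟩
  rw [zBit, xBit, if_neg h1, if_neg h2, pauliOne_zero]

/-- The sign and phase picked up by the `i`-th Pauli operator on the qubits `< K`. -/
def twist (i : ℕ) (u : ℕ → ZMod 2) (K : ℕ) : ℂ :=
  ∏ k ∈ Finset.range K, phase (p.zBit i k) (p.xBit i k) * sgn (p.xBit i k) (u k)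

theorem op_mul_zxTensor (i : ℕ) (u : ℕ → ZMod 2) :
    p.op i * zxTensor p.n u = p.twist i u p.n • zxTensor p.n (u + p.symp i) := by
  unfold op zxTensor
  rw [tensor_mul, twist, ← Fin.prod_univ_eq_prod_range
    (fun k => phase (p.zBit i k) (p.xBit i k) * sgn (p.xBit i k) (u k)), ← tensor_smul]
  congr 1
  funext k
  rw [pauliOne_mul_zx]
  congr 2
  · simp [symp, sympPart]
  · simp [symp, sympPart]

section Run

variable {p} {n m : ℕ} (D : Matrix (OracleLabel n m) (OracleLabel n m) ℂ)

/-- The scalar and the shift of the label are those of `pauliOne_mul_zx`, so the register BC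
imitates left multiplication by a tensor factor. -/
theorem run_pauli (i k : ℕ) (hi : i < p.m) (hk : k < p.n) (y u w g : ℕ → ZMod 2) :
    run D p.size (p.pauliCirc i k) (ket p.size (p.lay y u w g)) =
      if y i = 1 then (phase (p.zBit i k) (p.xBit i k) * sgn (p.xBit i k) (u k)) •
        ket p.size (p.lay y (Function.update (Function.update u k (u k + p.zBit i k)) (p.n + k)
          (u (p.n + k) + p.xBit i k)) w g)
      else ket p.size (p.lay y u w g) := by
  have bi : i < p.size := by unfold size; omega
  have bk : p.m + k < p.size := by unfold size; omega
  have bn : p.m + (p.n + k) < p.size := by unfold size; omega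
  have ne1 : i ≠ p.m + k := by omega
  have ne2 : i ≠ p.m + (p.n + k) := by omega
  have hk' : k < p.n + p.n := by omega
  have hn' : p.n + k < p.n + p.n := by omega
  have kn : p.n + k ≠ k := by omega
  have nk : k ≠ p.n + k := by omega
  have z : ∀ u, run D p.size [.ctrl [i] (p.m + k) pauliZ] (ket p.size (p.lay y u w g)) =
      if y i = 1 then sgn 1 (u k) • ket p.size (p.lay y u w g)
      else ket p.size (p.lay y u w g) := by
    intro u
    rw [run_cons, run_nil, ctrl₁_ket D _ bk bi ne1, lay_y _ _ _ _ hi, lay_u _ _ _ _ hk',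
      update_u _ _ _ _ hk', update_u _ _ _ _ hk']
    refine if_congr Iff.rfl ?_ rfl
    rcases zmod_two (u k) with h | h <;> simp [h, pauliZ, sgn] <;> rw [← h] <;> simp
  have f : ∀ u, run D p.size [.ctrl [i] (p.m + k) phaseMat] (ket p.size (p.lay y u w g)) =
      if y i = 1 then -Complex.I • ket p.size (p.lay y u w g)
      else ket p.size (p.lay y u w g) := by
    intro u
    rw [run_cons, run_nil, ctrl₁_ket D _ bk bi ne1, lay_y _ _ _ _ hi, lay_u _ _ _ _ hk',
      update_u _ _ _ _ hk', update_u _ _ _ _ hk']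
    refine if_congr Iff.rfl ?_ rfl
    rcases zmod_two (u k) with h | h <;> simp [h, phaseMat] <;> rw [← h] <;> simp
  have x1 : ∀ u, run D p.size [.x [i] (p.m + k)] (ket p.size (p.lay y u w g)) =
      ket p.size (p.lay y (Function.update u k (u k + y i)) w g) := by
    intro u
    rw [run_cons, run_nil, x₁_ket D bk bi ne1, lay_y _ _ _ _ hi, lay_u _ _ _ _ hk',
      update_u _ _ _ _ hk']
  have x2 : ∀ u, run D p.size [.x [i] (p.m + (p.n + k))] (ket p.size (p.lay y u w g)) =
      ket p.size (p.lay y (Function.update u (p.n + k) (u (p.n + k) + y i)) w g) := by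
    intro u
    rw [run_cons, run_nil, x₁_ket D bn bi ne2, lay_y _ _ _ _ hi, lay_u _ _ _ _ hn',
      update_u _ _ _ _ hn']
  have hself : ∀ b, Function.update (Function.update u k b) (p.n + k) (u (p.n + k)) =
      Function.update u k b := fun b =>
    Function.update_eq_iff.2 ⟨(Function.update_of_ne kn _ _).symm, fun _ _ => rfl⟩
  unfold pauliCirc
  simp only [run_append]
  rcases zmod_two (y i) with hy | hy
  · by_cases ha : 1 ≤ p.α i k <;> by_cases hb : 1 ≤ p.β i k <;>
      simp [ha, hb, hy, z, f, x1, x2, run_nil]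
  · have hn0 : p.n ≠ 0 := by omega
    have hu' := Function.update_eq_self k u
    rcases zmod_two (u k) with hu | hu <;> rw [hu] at hu' <;> by_cases ha : 1 ≤ p.α i k <;>
      by_cases hb : 1 ≤ p.β i k <;>
      simp [ha, hb, hy, z, f, x1, x2, run_nil, zBit, xBit, phase, sgn, hn0, hu, hu', hself]

theorem run_pauli_range (i : ℕ) (hi : i < p.m) (y u w g : ℕ → ZMod 2) (K : ℕ) (hK : K ≤ p.n) :
    run D p.size ((List.range K).flatMap (p.pauliCirc i)) (ket p.size (p.lay y u w g)) =
      if y i = 1 then p.twist i u K • ket p.size (p.lay y (u + p.sympPart K i) w g)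
      else ket p.size (p.lay y u w g) := by
  induction K with
  | zero =>
    have : u + p.sympPart 0 i = u := by
      funext j
      simp only [Pi.add_apply, sympPart]
      split_ifs <;> first | omega | simp
    simp [run_nil, twist, this]
  | succ K ih =>
    rw [List.range_succ, List.flatMap_append, run_append, ih (by omega), List.flatMap_singleton]
    by_cases hy : y i = 1
    · rw [if_pos hy, if_pos hy, map_smul, run_pauli D i K hi (by omega), if_pos hy, smul_smul,
        twist, twist, Finset.prod_range_succ]
      have e : (u + p.sympPart K i) K = u K := by
        simp [sympPart]; omega
      rw [e]
      congr 4
      funext j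
      simp only [Function.update_apply, Pi.add_apply, sympPart]
      split_ifs <;> first | omega | skip
      all_goals first | rfl | (subst_vars; simp)
    · rw [if_neg hy, if_neg hy, run_pauli D i K hi (by omega), if_neg hy]

/-- The syndrome of the first `i` bits of `y`. -/
def synd (p : Par) (y : ℕ → ZMod 2) (i j : ℕ) : ZMod 2 :=
  ∑ i' ∈ Finset.range i, p.symp i' j * y i'

/-- What matters is that one `θ` serves both conclusions: the phase gathered by the circuit is the
scalar relating the product of Pauli operators to its unphased label. -/
theorem run_syndrome (S : Finset ℕ) (y w g : ℕ → ZMod 2) (i : ℕ) (hi : i ≤ p.m)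
    (hy : ∀ j < i, y j = if j ∈ S then 1 else 0) :
    ∃ θ : ℂ, run D p.size ((List.range i).flatMap fun i => (List.range p.n).flatMap (p.pauliCirc i))
        (ket p.size (p.lay y 0 w g)) = θ • ket p.size (p.lay y (p.synd y i) w g) ∧
      opProd p.op i S = θ • zxTensor p.n (p.synd y i) := by
  induction i with
  | zero =>
    have : p.synd y 0 = 0 := by funext j; simp [synd]
    exact ⟨1, by simp [run_nil, this], by simp [opProd, this, zxTensor_zero]⟩
  | succ i ih =>
    obtain ⟨θ, h1, h2⟩ := ih (by omega) fun j hj => hy j (by omega)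
    have hs : ∀ b, y i = b → p.synd y (i + 1) = fun j => p.synd y i j + p.symp i j * b := by
      rintro _ rfl
      funext j
      exact Finset.sum_range_succ _ _
    rw [List.range_succ, List.flatMap_append, run_append, h1, List.flatMap_singleton, map_smul,
      run_pauli_range D i (by omega) _ _ _ _ _ le_rfl, opProd, h2]
    have hyi := hy i (by omega)
    by_cases hS : i ∈ S
    · rw [if_pos hS] at hyi
      have e : p.synd y (i + 1) = p.synd y i + p.symp i := by
        rw [hs _ hyi]; funext j; simp
      refine ⟨θ * p.twist i (p.synd y i) p.n, ?_, ?_⟩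
      · rw [if_pos hyi, smul_smul, e]
      · rw [if_pos hS, mul_smul_comm, op_mul_zxTensor, smul_smul, e]
    · rw [if_neg hS] at hyi
      have e : p.synd y (i + 1) = p.synd y i := by
        rw [hs _ hyi]; funext j; simp
      refine ⟨θ, ?_, ?_⟩
      · rw [if_neg (by rw [hyi]; decide), e]
      · rw [if_neg hS, one_mul, e]

end Run

end Par

namespace Par

/-! ### The flag -/

section Flag

variable {p : Par} {n m : ℕ} (D : Matrix (OracleLabel n m) (OracleLabel n m) ℂ)

/-- The ladder register after `K` steps; the `t`-th bit is `1` if `u` vanishes below `t`. -/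
def ladderBits (u : ℕ → ZMod 2) (K t : ℕ) : ZMod 2 :=
  if t ≤ K then ∏ j ∈ Finset.range t, (1 + u j) else 0

theorem ladderBits_zero (u : ℕ → ZMod 2) : ladderBits u 0 = Pi.single 0 1 := by
  funext t
  by_cases h : t = 0 <;> simp [ladderBits, h]

theorem run_ladder (K : ℕ) (hK : K < p.n + p.n) (y u w g : ℕ → ZMod 2) :
    run D p.size (p.ladder K) (ket p.size (p.lay y u w g)) =
      ket p.size (p.lay y u w (Function.update g (K + 1) (g (K + 1) + g K * (1 + u K)))) := by
  have b1 : p.gq K < p.size := by simp only [gq, size]; omega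
  have b2 : p.gq (K + 1) < p.size := by simp only [gq, size]; omega
  have b3 : p.m + K < p.size := by simp only [size]; omega
  have n1 : p.gq K ≠ p.gq (K + 1) := by simp only [gq]; omega
  have n2 : p.m + K ≠ p.gq (K + 1) := by simp only [gq]; omega
  rw [ladder, run_cons, x₁_ket D b2 b1 n1, lay_g, lay_g, update_g, run_cons, run_nil,
    x₂_ket D b2 b1 b3 n1 n2, lay_g, lay_g, lay_u _ _ _ _ hK, update_g]
  simp [mul_add, add_assoc]

theorem update_ladderBits (u : ℕ → ZMod 2) (K : ℕ) :
    Function.update (ladderBits u K) (K + 1)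
      (ladderBits u K (K + 1) + ladderBits u K K * (1 + u K)) = ladderBits u (K + 1) := by
  funext t
  by_cases h : t = K + 1
  · subst h; simp [ladderBits, Finset.prod_range_succ]
  · rw [Function.update_of_ne h]
    exact if_congr (by omega) rfl rfl

/-- A ladder step is its own inverse, since adding the same bit twice cancels. -/
theorem update_ladderBits_succ (u : ℕ → ZMod 2) (K : ℕ) :
    Function.update (ladderBits u (K + 1)) (K + 1)
      (ladderBits u (K + 1) (K + 1) + ladderBits u (K + 1) K * (1 + u K)) = ladderBits u K := by
  funext t
  by_cases h : t = K + 1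
  · subst h
    simp only [Function.update_self, ladderBits, le_refl, if_true, Nat.le_succ,
      Finset.prod_range_succ, CharTwo.add_self_eq_zero]
    simp
  · rw [Function.update_of_ne h]
    exact if_congr (by omega) rfl rfl

theorem run_ladders (y u w : ℕ → ZMod 2) (K : ℕ) (hK : K ≤ p.n + p.n) :
    run D p.size ((List.range K).flatMap p.ladder)
      (ket p.size (p.lay y u w (ladderBits u 0))) =
        ket p.size (p.lay y u w (ladderBits u K)) := by
  induction K with
  | zero => rfl
  | succ K ih =>
    rw [List.range_succ, List.flatMap_append, run_append, ih (by omega), List.flatMap_singleton,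
      run_ladder D K (by omega), update_ladderBits]

theorem run_desc_ladders (y u w : ℕ → ZMod 2) (K : ℕ) (hK : K ≤ p.n + p.n) :
    run D p.size (desc p.ladder K) (ket p.size (p.lay y u w (ladderBits u K))) =
      ket p.size (p.lay y u w (ladderBits u 0)) := by
  induction K with
  | zero => rfl
  | succ K ih =>
    rw [desc, run_append, run_ladder D K (by omega), update_ladderBits_succ, ih (by omega)]

theorem run_flagShift (y u w g : ℕ → ZMod 2) (K : ℕ) (hK : K ≤ p.n) :
    run D p.size ((List.range K).flatMap p.flagShift) (ket p.size (p.lay y u w g)) =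
      ket p.size (p.lay y (u + g (p.n + p.n) • p.sympPart K 0) w g) := by
  have b1 : p.gq (p.n + p.n) < p.size := by simp only [gq, size]; omega
  induction K with
  | zero =>
    have : u + g (p.n + p.n) • p.sympPart 0 0 = u := by
      funext j
      simp only [Pi.add_apply, Pi.smul_apply, sympPart]
      split_ifs <;> first | omega | simp
    rw [this]; rfl
  | succ K ih =>
    rw [List.range_succ, List.flatMap_append, run_append, ih (by omega), List.flatMap_singleton,
      flagShift, run_append]
    generalize hu : u + g (p.n + p.n) • p.sympPart K 0 = u'
    have x1 : run D p.size (if 1 ≤ p.α 0 K then [.x [p.gq (p.n + p.n)] (p.m + K)] else [])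
        (ket p.size (p.lay y u' w g)) = ket p.size
          (p.lay y (Function.update u' K (u' K + g (p.n + p.n) * p.zBit 0 K)) w g) := by
      by_cases h : 1 ≤ p.α 0 K
      · rw [if_pos h, run_cons, run_nil, x₁_ket D (by simp only [size]; omega) b1
          (by simp only [gq]; omega), lay_g, lay_u _ _ _ _ (by omega), update_u _ _ _ _ (by omega)]
        simp [zBit, h]
      · rw [if_neg h, run_nil]
        simp [zBit, h]
    have x2 : ∀ u', run D p.size
        (if 1 ≤ p.β 0 K then [.x [p.gq (p.n + p.n)] (p.m + (p.n + K))] else [])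
        (ket p.size (p.lay y u' w g)) = ket p.size (p.lay y (Function.update u' (p.n + K)
          (u' (p.n + K) + g (p.n + p.n) * p.xBit 0 K)) w g) := by
      intro u'
      by_cases h : 1 ≤ p.β 0 K
      · rw [if_pos h, run_cons, run_nil, x₁_ket D (by simp only [size]; omega) b1
          (by simp only [gq]; omega), lay_g, lay_u _ _ _ _ (by omega), update_u _ _ _ _ (by omega)]
        simp [xBit, h]
      · rw [if_neg h, run_nil]
        simp [xBit, h]
    rw [x1, x2]
    refine congrArg (fun u => ket p.size (p.lay y u w g)) ?_
    funext j
    subst hu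
    simp only [Function.update_apply, Pi.add_apply, Pi.smul_apply, sympPart, smul_eq_mul]
    split_ifs <;> first | omega | skip
    all_goals first | rfl | (subst_vars; simp)

theorem prod_one_add (u : ℕ → ZMod 2) (K : ℕ) :
    ∏ j ∈ Finset.range K, (1 + u j) = if ∀ j < K, u j = 0 then 1 else 0 := by
  split_ifs with h
  · exact Finset.prod_eq_one fun j hj => by rw [h j (Finset.mem_range.1 hj), add_zero]
  · push Not at h
    obtain ⟨j, hj, hu⟩ := h
    refine Finset.prod_eq_zero (Finset.mem_range.2 hj) ?_
    rcases zmod_two (u j) with h | h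
    · exact absurd h hu
    · rw [h]; decide

end Flag

/-! ### The oracle -/

section Oracle

variable (p : Par) (D : Matrix (OracleLabel p.n p.m) (OracleLabel p.n p.m) ℂ)

/-- The symplectic representations. -/
def vec (i : Fin p.m) : PauliLabel p.n :=
  Sum.elim (fun k => p.zBit i k) (fun k => p.xBit i k)

/-- The label of the registers `A` and `BC`. -/
def label (y u : ℕ → ZMod 2) : OracleLabel p.n p.m :=
  (fun i => y i, Sum.elim (fun k => u k) (fun k => u (p.n + k)))

theorem run_oracle {y y' u : ℕ → ZMod 2} (w g : ℕ → ZMod 2)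
    (h : D.mulVec (Pi.single (p.label y u) 1) = Pi.single (p.label y' u) 1) :
    run D p.size [.oracle] (ket p.size (p.lay y u w g)) = ket p.size (p.lay y' u w g) := by
  have hl : ∀ y, oracleLabel p.n p.m (fun q : Fin p.size => p.lay y u w g q) = p.label y u := by
    intro y
    have hb : ∀ q < p.size, bit (fun q : Fin p.size => p.lay y u w g q) q = p.lay y u w g q :=
      fun q hq => bit_eq hq _
    refine Prod.ext (funext fun i => ?_) (funext fun k => ?_)
    · exact (hb i (by simp only [size]; omega)).trans (lay_y _ _ _ _ i.2)
    · rcases k with k | k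
      · exact (hb (p.m + k) (by simp only [size]; omega)).trans (lay_u _ _ _ _ (by omega))
      · refine (hb (p.m + p.n + k) (by simp only [size]; omega)).trans ?_
        rw [add_assoc]
        exact lay_u _ _ _ _ (by omega)
  rw [run_cons, run_nil]
  refine oracle_ket D (fun q hq => ?_) (by rw [hl, hl, h])
  simp only [lay, if_neg (show ¬ q < p.m by omega)]

theorem sympMatrix_mulVec (y : ℕ → ZMod 2) :
    (sympMatrix p.vec).mulVec (fun i => y i) = (p.label y (p.synd y p.m)).2 := by
  funext k
  rcases k with k | k
  all_goals
    simp only [Matrix.mulVec, dotProduct, sympMatrix, Matrix.of_apply, vec, label, synd,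
      Sum.elim_inl, Sum.elim_inr]
  · rw [← Fin.sum_univ_eq_sum_range fun i => p.symp i k * y i]
    simp [symp, sympPart]
  · rw [← Fin.sum_univ_eq_sum_range fun i => p.symp i (p.n + k) * y i]
    simp [symp, sympPart]

theorem hammingNorm_setBits {S : Finset ℕ} (hS : S ⊆ Finset.range p.m) :
    hammingNorm (fun i : Fin p.m => setBits 0 S i) = S.card := by
  unfold hammingNorm
  rw [← Finset.card_map Fin.valEmbedding]
  congr 1
  ext j
  simp only [Finset.mem_map, setBits, Fin.valEmbedding_apply]
  constructor
  · rintro ⟨i, hi, rfl⟩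
    by_contra h
    simp [h] at hi
  · intro h
    exact ⟨⟨j, Finset.mem_range.1 (hS h)⟩, by simp [h], rfl⟩

variable {p D}

theorem decode (hD : IsDecodingOracle p.vec p.l D) {S : Finset ℕ} (hS : S ⊆ Finset.range p.m)
    (h1 : S.Nonempty) (h2 : S.card ≤ p.l) :
    D.mulVec (Pi.single (p.label (setBits 0 S) (p.synd (setBits 0 S) p.m)) 1) =
      Pi.single (p.label 0 (p.synd (setBits 0 S) p.m)) 1 := by
  have h := hD.2 (fun i => setBits 0 S i) (by rw [p.hammingNorm_setBits hS]; exact h1.card_pos)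
    (by rw [p.hammingNorm_setBits hS]; exact h2)
  rw [sympMatrix_mulVec] at h
  exact h

theorem synd_setBits {S : Finset ℕ} (hS : S ⊆ Finset.range p.m) (j : ℕ) :
    p.synd (setBits 0 S) p.m j = ∑ i ∈ S, p.symp i j := by
  rw [synd, ← Finset.sum_subset hS]
  · exact Finset.sum_congr rfl fun i hi => by simp [setBits, hi]
  · intro i _ hi
    simp [setBits, hi]

/-- No nonempty set of at most `l` terms has syndrome zero. -/
theorem synd_ne_zero (hD : IsDecodingOracle p.vec p.l D) {S : Finset ℕ}
    (hS : S ⊆ Finset.range p.m) (h1 : S.Nonempty) (h2 : S.card ≤ p.l)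
    (h3 : ∀ i ∈ S, p.Nontriv i) : ¬ ∀ j < p.n + p.n, p.synd (setBits 0 S) p.m j = 0 := by
  intro h0
  obtain ⟨i, hi⟩ := h1
  have hc := Finset.card_erase_add_one hi
  have hm : {i} ⊆ Finset.range p.m := Finset.singleton_subset_iff.2 (hS hi)
  have hm' : S.erase i ⊆ Finset.range p.m := (Finset.erase_subset _ _).trans hS
  -- A vanishing sum over `S` means, in characteristic 2, that `S.erase i` and `{i}` have the same
  -- syndrome.
  have key : ∀ j < p.n + p.n,
      p.synd (setBits 0 (S.erase i)) p.m j = p.synd (setBits 0 {i}) p.m j := by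
    intro j hj
    have h := h0 j hj
    rw [synd_setBits hS, ← Finset.add_sum_erase _ _ hi] at h
    rw [synd_setBits hm, synd_setBits hm', Finset.sum_singleton]
    exact (CharTwo.add_eq_zero.1 h).symm
  have hl : ∀ y, p.label y (p.synd (setBits 0 (S.erase i)) p.m) =
      p.label y (p.synd (setBits 0 {i}) p.m) := by
    intro y
    refine Prod.ext rfl (funext fun k => ?_)
    rcases k with k | k
    · exact key k (by omega)
    · exact key (p.n + k) (by omega)
  rcases (S.erase i).eq_empty_or_nonempty with he | he
  · obtain ⟨k, hk, h⟩ := h3 i hi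
    have hz : ∀ j < p.n + p.n, p.symp i j = 0 := fun j hj => by
      have := key j hj
      rw [synd_setBits hm, synd_setBits hm', he, Finset.sum_empty, Finset.sum_singleton] at this
      exact this.symm
    rcases h with h | h
    · have := hz k (by omega)
      simp [symp, sympPart, hk, zBit, h] at this
    · have := hz (p.n + k) (by omega)
      simp [symp, sympPart, hk, xBit, h] at this
  -- Two different error patterns with the same syndrome would both be mapped to |0⟩ with that
  -- syndrome. Cancelling the unitary `D` identifies the patterns, but they differ in bit `i`.
  · have e1 := decode hD hm (Finset.singleton_nonempty i) (by rw [Finset.card_singleton]; omega)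
    have e2 := decode hD hm' he (by omega)
    rw [hl, hl, ← e1] at e2
    have hu := Matrix.mem_unitaryGroup_iff'.1 hD.1
    have e3 := congrArg (fun ψ => (star D).mulVec ψ) e2
    simp only [Matrix.mulVec_mulVec, hu, Matrix.one_mulVec] at e3
    have e4 := congrFun e3 (p.label (setBits 0 {i}) (p.synd (setBits 0 {i}) p.m))
    rw [Pi.single_eq_same, Pi.single_apply] at e4
    split_ifs at e4 with e5
    · have e6 := congrFun (congrArg Prod.fst e5) ⟨i, Finset.mem_range.1 (hS hi)⟩
      simp [label, setBits] at e6
    · exact zero_ne_one e4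

/-- The decoder erases the register `A`. -/
theorem run_decode (hD : IsDecodingOracle p.vec p.l D) (hm : 1 ≤ p.m) (hl : 1 ≤ p.l)
    {S : Finset ℕ} (hS : S ⊆ Finset.range p.m) (h2 : S.card ≤ p.l) (h3 : ∀ i ∈ S, p.Nontriv i)
    (w : ℕ → ZMod 2) :
    run D p.size (p.flagCirc ++ ([.oracle] ++ p.unflagCirc))
      (ket p.size (p.lay (setBits 0 S) (p.synd (setBits 0 S) p.m) w 0)) =
      ket p.size (p.lay 0 (p.synd (setBits 0 S) p.m) w (Pi.single 0 1)) := by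
  set y := setBits 0 S with hy
  set u := p.synd y p.m with hu
  set f : ZMod 2 := if ∀ j < p.n + p.n, u j = 0 then 1 else 0 with hf
  have hg : ladderBits u (p.n + p.n) (p.n + p.n) = f := by
    rw [ladderBits, if_pos le_rfl, prod_one_add]
  have e0 : Function.update (0 : ℕ → ZMod 2) 0 1 = ladderBits u 0 := by
    rw [ladderBits_zero]; rfl
  -- The ladder still holds the bits computed from the original `u`. The shift under the flag must
  -- restore `u` first; only then can the ladder be uncomputed.
  have down : ∀ u' y', u' + f • p.symp 0 = u →
      run D p.size p.unflagCirc
        (ket p.size (p.lay y' u' w (ladderBits u (p.n + p.n)))) =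
      ket p.size (p.lay y' u w (Pi.single 0 1)) := by
    intro u' y' h
    rw [unflagCirc, run_append, run_flagShift D _ _ _ _ _ le_rfl, hg, h,
      run_desc_ladders D _ _ _ _ le_rfl, ladderBits_zero]
  have init : run D p.size [.x [] (p.gq 0)] (ket p.size (p.lay y u w 0)) =
      ket p.size (p.lay y u w (ladderBits u 0)) := by
    rw [run_cons, run_nil, x₀_ket D (by simp only [gq, size]; omega), lay_g, update_g,
      Pi.zero_apply, zero_add, e0]
  have flag : run D p.size [.x [p.gq (p.n + p.n)] 0]
      (ket p.size (p.lay y u w (ladderBits u (p.n + p.n)))) =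
      ket p.size (p.lay (Function.update y 0 (y 0 + f)) u w (ladderBits u (p.n + p.n))) := by
    rw [run_cons, run_nil, x₁_ket D (by simp only [size]; omega) (by simp only [gq, size]; omega)
      (by simp only [gq]; omega), lay_g, hg, lay_y _ _ _ _ hm, update_y _ _ _ _ hm]
  rw [run_append, run_append, flagCirc, run_append, run_append, run_append, init,
    run_ladders D _ _ _ _ le_rfl, flag,
    run_flagShift D _ _ _ _ _ le_rfl, hg]
  -- For `S` = ∅ the flag is 1 and the oracle sees the set {0}, of weight 1 ≤ l, with its own
  -- syndrome. Otherwise the flag is 0 and the oracle sees `S` itself.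
  rcases S.eq_empty_or_nonempty with he | he
  · have hu0 : u = 0 := by
      funext j
      rw [hu, hy, synd_setBits hS, he, Finset.sum_empty]; rfl
    have hf1 : f = 1 := if_pos fun j _ => by rw [hu0]; rfl
    have hy1 : Function.update y 0 (y 0 + f) = setBits 0 {0} := by
      funext j
      by_cases hj : j = 0 <;> simp [hy, he, hf1, setBits, hj]
    have hm0 : {0} ⊆ Finset.range p.m :=
      Finset.singleton_subset_iff.2 (Finset.mem_range.2 (by omega))
    have hu1 : u + f • p.symp 0 = p.synd (setBits 0 {0}) p.m := by
      funext j
      rw [synd_setBits hm0, Finset.sum_singleton, hf1, hu0]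
      simp
    rw [hy1, hu1, run_oracle p D w _ (decode hD hm0 (Finset.singleton_nonempty 0) (by simpa))]
    refine down _ _ ?_
    rw [← hu1]
    funext j
    simp only [Pi.add_apply, add_assoc, CharTwo.add_self_eq_zero, add_zero]
  · have hf0 : f = 0 := if_neg (synd_ne_zero hD hS he h2 h3)
    have e1 : u + f • p.symp 0 = u := by rw [hf0, zero_smul, add_zero]
    rw [e1, hf0, add_zero, Function.update_eq_self, run_oracle p D w _ (decode hD hS he h2)]
    exact down _ _ e1

end Oracle

end Par

/-! ### Unitarity and partial traces -/

section Unitarity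

variable {n m N : ℕ} (D : Matrix (OracleLabel n m) (OracleLabel n m) ℂ)

/-- The basis state `x` with the registers `A`, `B` and `C` set to `e`. -/
def fill (x : Fin N → ZMod 2) (e : OracleLabel n m) : Fin N → ZMod 2 := fun q =>
  if hA : (q : ℕ) < m then e.1 ⟨q, hA⟩
  else if hB : (q : ℕ) - m < n then e.2 (Sum.inl ⟨q - m, hB⟩)
  else if hC : (q : ℕ) - (m + n) < n then e.2 (Sum.inr ⟨q - (m + n), hC⟩)
  else x q

theorem fill_of_le (x : Fin N → ZMod 2) (e : OracleLabel n m) (q : Fin N)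
    (hq : m + 2 * n ≤ (q : ℕ)) : fill x e q = x q := by
  rw [fill, dif_neg (by omega), dif_neg (by omega), dif_neg (by omega)]

theorem oracleLabel_fill (hN : m + 2 * n ≤ N) (x : Fin N → ZMod 2) (e : OracleLabel n m) :
    oracleLabel n m (fill x e) = e := by
  refine Prod.ext (funext fun i => ?_) (funext fun k => ?_)
  · change bit (fill x e) i = _
    rw [bit_eq (by omega), fill, dif_pos i.2]
  · rcases k with k | k
    · change bit (fill x e) (m + k) = _
      rw [bit_eq (by omega), fill, dif_neg (by simp), dif_pos (by simp)]
      exact Fin.ext (by simp)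
    · change bit (fill x e) (m + n + k) = _
      rw [bit_eq (by omega), fill, dif_neg (by simp; omega), dif_neg (by simp; omega),
        dif_pos (by simp)]
      exact Fin.ext (by simp)

theorem eq_of_oracleLabel_eq {x y : Fin N → ZMod 2}
    (h : oracleLabel n m x = oracleLabel n m y)
    (h' : ∀ q : Fin N, m + 2 * n ≤ (q : ℕ) → x q = y q) : x = y := by
  funext q
  have hA : ∀ i : Fin m, bit x i = bit y i := fun i => congrFun (congrArg Prod.fst h) i
  have hB : ∀ k : Fin n, bit x (m + k) = bit y (m + k) := fun k =>
    congrFun (congrArg Prod.snd h) (Sum.inl k)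
  have hC : ∀ k : Fin n, bit x (m + n + k) = bit y (m + n + k) := fun k =>
    congrFun (congrArg Prod.snd h) (Sum.inr k)
  have key : m + 2 * n ≤ (q : ℕ) ∨ bit x q = bit y q := by
    by_cases h1 : (q : ℕ) < m
    · exact Or.inr (hA ⟨q, h1⟩)
    by_cases h2 : (q : ℕ) < m + n
    · have := hB ⟨q - m, by omega⟩
      rw [show m + ((⟨q - m, by omega⟩ : Fin n) : ℕ) = q by simp; omega] at this
      exact Or.inr this
    by_cases h3 : (q : ℕ) < m + n + n
    · have := hC ⟨q - (m + n), by omega⟩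
      rw [show m + n + ((⟨q - (m + n), by omega⟩ : Fin n) : ℕ) = q by simp; omega] at this
      exact Or.inr this
    · exact Or.inl (by omega)
  rcases key with h1 | h1
  · exact h' q h1
  · rwa [bit_eq q.2, bit_eq q.2] at h1

theorem eq_fill {x y : Fin N → ZMod 2} (hN : m + 2 * n ≤ N)
    (h : ∀ q : Fin N, m + 2 * n ≤ (q : ℕ) → y q = x q) : fill x (oracleLabel n m y) = y :=
  eq_of_oracleLabel_eq (oracleLabel_fill hN _ _) fun q hq => by
    rw [fill_of_le _ _ _ hq, h q hq]

theorem sum_fill (hN : m + 2 * n ≤ N) (x : Fin N → ZMod 2) (f : (Fin N → ZMod 2) → ℂ)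
    (h : ∀ y, (¬ ∀ q : Fin N, m + 2 * n ≤ (q : ℕ) → y q = x q) → f y = 0) :
    ∑ y, f y = ∑ e : OracleLabel n m, f (fill x e) := by
  symm
  refine Fintype.sum_of_injective (fun e => fill x e) ?_ _ _ ?_ fun _ => rfl
  · intro e e' he
    rw [← oracleLabel_fill hN x e, ← oracleLabel_fill hN x e']
    exact congrArg _ he
  · intro y hy
    exact h y fun h => hy ⟨_, eq_fill hN h⟩

theorem sum_update {t : ℕ} (ht : t < N) (x : Fin N → ZMod 2) (f : (Fin N → ZMod 2) → ℂ)
    (h : ∀ y, (¬ ∀ q : Fin N, (q : ℕ) ≠ t → y q = x q) → f y = 0) :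
    ∑ y, f y = ∑ b, f (Function.update x ⟨t, ht⟩ b) := by
  symm
  refine Fintype.sum_of_injective (fun b => Function.update x ⟨t, ht⟩ b)
    (Function.update_injective x _) _ _ ?_ fun _ => rfl
  intro y hy
  refine h y fun h => hy ⟨y ⟨t, ht⟩, ?_⟩
  funext q
  by_cases hq : q = ⟨t, ht⟩
  · subst hq; simp
  · simp only [Function.update_of_ne hq]
    exact (h q fun h => hq (Fin.ext h)).symm

theorem ctrl_isometry {cs : List ℕ} {t : ℕ} {U : Matrix (ZMod 2) (ZMod 2) ℂ}
    (hv : (Gate.ctrl cs t U).Valid N) :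
    ((Gate.ctrl cs t U).matrix D N).conjTranspose * (Gate.ctrl cs t U).matrix D N = 1 := by
  classical
  obtain ⟨-, hnd, hlt, hU⟩ := hv
  have ht : t < N := hlt t (by simp)
  have htc : t ∉ cs := (List.nodup_cons.1 hnd).1
  have hctrl : ∀ x y : Fin N → ZMod 2, (∀ q : Fin N, (q : ℕ) ≠ t → y q = x q) →
      ((∀ q ∈ cs, bit y q = 1) ↔ ∀ q ∈ cs, bit x q = 1) := fun x y h =>
    forall₂_congr fun q hq => by
      have hqN : q < N := hlt q (List.mem_cons_of_mem _ hq)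
      rw [bit_eq hqN, bit_eq hqN, h ⟨q, hqN⟩ fun e => htc (e ▸ hq)]
  have hcol : ∀ x y : Fin N → ZMod 2, (Gate.ctrl cs t U).matrix D N y x =
      if ∀ q ∈ cs, bit x q = 1 then
        (if ∀ q : Fin N, (q : ℕ) ≠ t → y q = x q then U (bit y t) (bit x t) else 0)
      else (if y = x then 1 else 0) := by
    intro x y
    rw [Gate.matrix, Matrix.of_apply]
    by_cases h : ∀ q : Fin N, (q : ℕ) ≠ t → y q = x q
    · exact if_congr (hctrl x y h) rfl rfl
    · have hne : y ≠ x := fun e => h fun q _ => by rw [e]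
      simp only [if_neg h, if_neg hne, ite_self]
  have hU' : ∀ a b, ∑ d, star (U d a) * U d b = if a = b then 1 else 0 := by
    intro a b
    have := congrFun (congrFun (Matrix.mem_unitaryGroup_iff'.1 hU) a) b
    rwa [Matrix.mul_apply, Matrix.one_apply] at this
  ext x z
  rw [Matrix.mul_apply, Matrix.one_apply]
  simp only [Matrix.conjTranspose_apply]
  by_cases hx : ∀ q ∈ cs, bit x q = 1
  · simp only [hcol x, if_pos hx]
    rw [sum_update ht x _ fun y hy => by rw [if_neg hy, star_zero, zero_mul]]
    have hup : ∀ (b : ZMod 2) (q : Fin N), (q : ℕ) ≠ t →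
        Function.update x ⟨t, ht⟩ b q = x q := fun b q hq =>
      Function.update_of_ne (fun e => hq (congrArg Fin.val e)) _ _
    have hbt : ∀ b, bit (Function.update x ⟨t, ht⟩ b) t = b := fun b => by
      rw [bit_eq ht, Function.update_self]
    have hz : ∀ b, (Gate.ctrl cs t U).matrix D N (Function.update x ⟨t, ht⟩ b) z =
        if ∀ q : Fin N, (q : ℕ) ≠ t → x q = z q then U b (bit z t) else 0 := by
      intro b
      rw [Gate.matrix, Matrix.of_apply, if_pos ((hctrl x _ (hup b)).2 hx), hbt]
      exact if_congr (forall₂_congr fun q hq => by rw [hup b q hq]) rfl rfl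
    simp only [hz, if_pos (hup _), hbt]
    by_cases h : ∀ q : Fin N, (q : ℕ) ≠ t → x q = z q
    · simp only [if_pos h]
      rw [hU']
      refine if_congr ⟨fun e => ?_, fun e => by rw [e]⟩ rfl rfl
      funext q
      by_cases hq : (q : ℕ) = t
      · subst hq
        rwa [bit_eq q.2, bit_eq q.2] at e
      · exact h q hq
    · simp only [if_neg h, mul_zero, Finset.sum_const_zero]
      rw [if_neg fun e => h fun q _ => by rw [e]]
  · simp only [hcol x, if_neg hx]
    rw [Finset.sum_eq_single x]
    · rw [if_pos rfl, star_one, one_mul, Gate.matrix, Matrix.of_apply, if_neg hx]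
    · intro y _ hy
      rw [if_neg hy, star_zero, zero_mul]
    · simp

theorem oracle_isometry (hN : m + 2 * n ≤ N)
    (hD : D ∈ Matrix.unitaryGroup (OracleLabel n m) ℂ) :
    (Gate.oracle.matrix D N).conjTranspose * Gate.oracle.matrix D N = 1 := by
  classical
  have hD' : ∀ a b, ∑ d, star (D d a) * D d b = if a = b then 1 else 0 := by
    intro a b
    have := congrFun (congrFun (Matrix.mem_unitaryGroup_iff'.1 hD) a) b
    rwa [Matrix.mul_apply, Matrix.one_apply] at this
  ext x z
  rw [Matrix.mul_apply, Matrix.one_apply]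
  simp only [Matrix.conjTranspose_apply, Gate.matrix, Matrix.of_apply]
  rw [sum_fill (m := m) (n := n) hN x _ fun y hy => by rw [if_neg hy, star_zero, zero_mul]]
  have hf : ∀ e : OracleLabel n m, ∀ q : Fin N, m + 2 * n ≤ (q : ℕ) → fill x e q = x q :=
    fun e q hq => fill_of_le _ _ _ hq
  simp only [if_pos (hf _), oracleLabel_fill hN]
  by_cases h : ∀ q : Fin N, m + 2 * n ≤ (q : ℕ) → x q = z q
  · have h' : ∀ e : OracleLabel n m, ∀ q : Fin N, m + 2 * n ≤ (q : ℕ) → fill x e q = z q :=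
      fun e q hq => (hf e q hq).trans (h q hq)
    simp only [if_pos (h' _)]
    rw [hD']
    exact if_congr ⟨fun e => eq_of_oracleLabel_eq e h, fun e => by rw [e]⟩ rfl rfl
  · have h' : ∀ e : OracleLabel n m,
        ¬ ∀ q : Fin N, m + 2 * n ≤ (q : ℕ) → fill x e q = z q :=
      fun e h1 => h fun q hq => (hf e q hq).symm.trans (h1 q hq)
    simp only [if_neg (h' _), mul_zero, Finset.sum_const_zero]
    rw [if_neg fun e => h fun q _ => by rw [e]]

/-- Norm preservation makes the trace of the output equal to 1 and thereby determines the unknown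
scalar in front of P(H)². -/
theorem sum_norm_run (hN : m + 2 * n ≤ N) (hD : D ∈ Matrix.unitaryGroup (OracleLabel n m) ℂ)
    (gs : List Gate) (hv : ∀ g ∈ gs, g.Valid N) (ψ : Vec N) :
    ∑ z, star (run D N gs ψ z) * run D N gs ψ z = ∑ z, star (ψ z) * ψ z := by
  induction gs generalizing ψ with
  | nil => rfl
  | cons g gs ih =>
    rw [run_cons, ih fun g hg => hv g (List.mem_cons_of_mem _ hg)]
    have hg : (g.matrix D N).conjTranspose * g.matrix D N = 1 := by
      have hg := hv g (by simp)
      cases g with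
      | ctrl cs t U => exact ctrl_isometry D hg
      | oracle => exact oracle_isometry D hN hD
    change star ((g.matrix D N).mulVec ψ) ⬝ᵥ (g.matrix D N).mulVec ψ = star ψ ⬝ᵥ ψ
    rw [Matrix.star_mulVec, Matrix.dotProduct_mulVec, Matrix.vecMul_vecMul, hg, Matrix.vecMul_one]

end Unitarity

/-! ### The partial trace onto register B. -/

section PartialTrace

variable {n m N : ℕ} (D : Matrix (OracleLabel n m) (OracleLabel n m) ℂ)

/-- The basis state `x` with the register `B` set to `b`. -/
def setB (m : ℕ) {n : ℕ} (x : Fin N → ZMod 2) (b : Fin n → ZMod 2) : Fin N → ZMod 2 :=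
  fun q => if h : m ≤ (q : ℕ) ∧ (q : ℕ) - m < n then b ⟨q - m, h.2⟩ else x q

theorem setB_of_notMem (x : Fin N → ZMod 2) (b : Fin n → ZMod 2) (q : Fin N)
    (hq : (q : ℕ) < m ∨ m + n ≤ (q : ℕ)) : setB m x b q = x q :=
  dif_neg (by omega)

theorem regB_setB (hN : m + n ≤ N) (x : Fin N → ZMod 2) (b : Fin n → ZMod 2) :
    regB m n (setB m x b) = b := by
  funext k
  rw [regB, bit_eq (by omega), setB, dif_pos (by simp)]
  congr 1
  exact Fin.ext (by simp)

theorem eq_setB {x x' : Fin N → ZMod 2}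
    (h : ∀ q : Fin N, (q : ℕ) < m ∨ m + n ≤ (q : ℕ) → x q = x' q) :
    x' = setB m x (regB m n x') := by
  funext q
  by_cases hq : m ≤ (q : ℕ) ∧ (q : ℕ) - m < n
  · rw [setB, dif_pos hq, regB, bit_eq (by simp; omega)]
    congr 1
    exact Fin.ext (by simp; omega)
  · rw [setB, dif_neg hq, h q (by omega)]

/-- Once `x` is given, the second basis state is determined by its register B, so one of the two
sums collapses. -/
theorem outputState_apply (hN : m + n ≤ N) (gs : List Gate) (b b' : Fin n → ZMod 2) :
    outputState D N gs b b' = ∑ x : Fin N → ZMod 2, if regB m n x = b then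
      finalVector D N gs x * star (finalVector D N gs (setB m x b')) else 0 := by
  classical
  rw [outputState, Matrix.of_apply]
  refine Finset.sum_congr rfl fun x _ => ?_
  rw [Finset.sum_eq_single (setB m x b')]
  · refine if_congr ⟨fun h => h.1, fun h => ⟨h, regB_setB hN _ _, fun q hq => ?_⟩⟩ rfl rfl
    exact (setB_of_notMem _ _ _ hq).symm
  · rintro x' - hx'
    refine if_neg fun h => hx' ?_
    rw [← h.2.1]
    exact eq_setB h.2.2
  · simp

theorem trace_outputState (hN : m + n ≤ N) (gs : List Gate) :
    (outputState D N gs).trace =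
      ∑ z, star (finalVector D N gs z) * finalVector D N gs z := by
  classical
  simp only [Matrix.trace, Matrix.diag_apply, outputState_apply D hN]
  rw [Finset.sum_comm]
  refine Finset.sum_congr rfl fun x _ => ?_
  rw [Finset.sum_ite_eq, if_pos (Finset.mem_univ _), ← eq_setB fun _ _ => rfl, mul_comm]

end PartialTrace

/-! ### Bell pairs -/

section Bell

variable {n m N : ℕ} (D : Matrix (OracleLabel n m) (OracleLabel n m) ℂ)

theorem hadamard_apply (a b : ZMod 2) : hadamard a b = (((√2)⁻¹ : ℝ) : ℂ) * sgn b a := by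
  simp only [hadamard, sgn, Matrix.of_apply, and_comm]

-- The qubits `s j`, `t j` are arbitrary because the lemma serves twice: for the pairs of BC, and
-- for pairing registers with ancillas when l = 0. The induction peels off the first pair, which
-- later gates do not touch.
open Classical in
theorem run_bellPairs (k : ℕ) (s t : ℕ → ℕ) (hs : ∀ j < k, s j < N) (ht : ∀ j < k, t j < N)
    (hst : ∀ i < k, ∀ j < k, s i ≠ t j) (hs' : ∀ i < k, ∀ j < k, s i = s j → i = j)
    (ht' : ∀ i < k, ∀ j < k, t i = t j → i = j) (x : ℕ → ZMod 2) (z : Fin N → ZMod 2) :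
    run D N ((List.range k).flatMap fun j => bellPair (s j) (t j)) (ket N x) z =
      if ∀ q : Fin N, (∀ j < k, (q : ℕ) ≠ s j ∧ (q : ℕ) ≠ t j) → z q = x q then
        (((√2)⁻¹ : ℝ) : ℂ) ^ k * ∏ j ∈ Finset.range k,
          (if bit z (s j) = bit z (t j) + x (t j) then sgn (x (s j)) (bit z (s j)) else 0)
      else 0 := by
  induction k generalizing s t x with
  | zero =>
    simp only [List.range_zero, List.flatMap_nil, run_nil, pow_zero, Finset.range_zero,
      Finset.prod_empty, mul_one, ket, Pi.single_apply]
    exact if_congr (by simp [funext_iff]) rfl rfl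
  | succ k ih =>
    have s0 := hs 0 (by omega)
    have t0 := ht 0 (by omega)
    have st0 := hst 0 (by omega) 0 (by omega)
    have run0 : run D N (bellPair (s 0) (t 0)) (ket N x) = ∑ b, hadamard b (x (s 0)) •
        ket N (Function.update (Function.update x (s 0) b) (t 0) (x (t 0) + b)) := by
      rw [bellPair, run_cons, ctrl_ket D _ s0 (by simp), if_pos (by simp), map_sum]
      refine Finset.sum_congr rfl fun b _ => ?_
      rw [map_smul, run_cons, run_nil, x₁_ket D t0 s0 st0, Function.update_self,
        Function.update_of_ne st0.symm]
    rw [List.range_succ_eq_map, List.flatMap_cons, List.flatMap_map, run_append, run0, map_sum,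
      Finset.sum_apply]
    simp only [map_smul, Pi.smul_apply, smul_eq_mul]
    have hih := ih (fun j => s (j + 1)) (fun j => t (j + 1)) (fun j hj => hs _ (by omega))
      (fun j hj => ht _ (by omega)) (fun i hi j hj => hst _ (by omega) _ (by omega))
      (fun i hi j hj h => by have := hs' _ (by omega) _ (by omega) h; omega)
      (fun i hi j hj h => by have := ht' _ (by omega) _ (by omega) h; omega)
    simp only [Nat.succ_eq_add_one, hih]
    have far : ∀ b, ∀ j ∈ Finset.range k,
        (if bit z (s (j + 1)) = bit z (t (j + 1)) + Function.update (Function.update x (s 0) b)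
            (t 0) (x (t 0) + b) (t (j + 1)) then sgn (Function.update (Function.update x (s 0) b)
            (t 0) (x (t 0) + b) (s (j + 1))) (bit z (s (j + 1))) else 0) =
        if bit z (s (j + 1)) = bit z (t (j + 1)) + x (t (j + 1)) then
          sgn (x (s (j + 1))) (bit z (s (j + 1))) else 0 := by
      intro b j hj
      rw [Finset.mem_range] at hj
      have h1 : s (j + 1) ≠ s 0 := fun h => by have := hs' _ (by omega) _ (by omega) h; omega
      have h2 : t (j + 1) ≠ t 0 := fun h => by have := ht' _ (by omega) _ (by omega) h; omega
      have h3 : s (j + 1) ≠ t 0 := hst _ (by omega) _ (by omega)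
      have h4 : t (j + 1) ≠ s 0 := (hst _ (by omega) _ (by omega)).symm
      rw [Function.update_of_ne h2, Function.update_of_ne h4, Function.update_of_ne h3,
        Function.update_of_ne h1]
    -- The outcome `z` reveals the branch `b` of the first Hadamard gate at `s 0`, so a single
    -- branch contributes.
    have cond : ∀ b, (∀ q : Fin N, (∀ j < k, (q : ℕ) ≠ s (j + 1) ∧ (q : ℕ) ≠ t (j + 1)) →
        z q = Function.update (Function.update x (s 0) b) (t 0) (x (t 0) + b) q) ↔
        (b = bit z (s 0) ∧ bit z (t 0) = x (t 0) + b) ∧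
        ∀ q : Fin N, (∀ j < k + 1, (q : ℕ) ≠ s j ∧ (q : ℕ) ≠ t j) → z q = x q := by
      intro b
      constructor
      · intro h
        refine ⟨⟨?_, ?_⟩, fun q hq => ?_⟩
        · have := h ⟨s 0, s0⟩ fun j hj =>
            ⟨fun e => by have := hs' _ (by omega) _ (by omega) e; omega,
              hst _ (by omega) _ (by omega)⟩
          rw [bit_eq s0, this, Function.update_of_ne st0, Function.update_self]
        · have := h ⟨t 0, t0⟩ fun j hj => ⟨(hst _ (by omega) _ (by omega)).symm,
            fun e => by have := ht' _ (by omega) _ (by omega) e; omega⟩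
          rw [bit_eq t0, this, Function.update_self]
        · obtain ⟨h1, h2⟩ := hq 0 (by omega)
          rw [h q fun j hj => hq (j + 1) (by omega), Function.update_of_ne h2,
            Function.update_of_ne h1]
      · rintro ⟨⟨h1, h2⟩, h3⟩ q hq
        by_cases e2 : (q : ℕ) = t 0
        · rw [e2, Function.update_self, ← h2, ← e2, bit_eq q.2]
        · rw [Function.update_of_ne e2]
          by_cases e1 : (q : ℕ) = s 0
          · rw [e1, Function.update_self, h1, ← e1, bit_eq q.2]
          · rw [Function.update_of_ne e1]
            refine h3 q fun j hj => ?_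
            rcases j with _ | j
            · exact ⟨e1, e2⟩
            · exact hq j (by omega)
    simp only [Finset.prod_congr rfl (far _), cond]
    rw [Finset.sum_eq_single (bit z (s 0))]
    · by_cases h : ∀ q : Fin N, (∀ j < k + 1, (q : ℕ) ≠ s j ∧ (q : ℕ) ≠ t j) → z q = x q
      · by_cases h2 : bit z (t 0) = x (t 0) + bit z (s 0)
        · have h3 : bit z (s 0) = bit z (t 0) + x (t 0) := by
            rw [h2, add_comm, ← add_assoc, CharTwo.add_self_eq_zero, zero_add]
          rw [if_pos ⟨⟨rfl, h2⟩, h⟩, if_pos h, Finset.prod_range_succ', if_pos h3, hadamard_apply,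
            pow_succ]
          ring
        · have h3 : ¬ bit z (s 0) = bit z (t 0) + x (t 0) := fun h3 => h2 (by
            rw [h3, add_comm, add_assoc, CharTwo.add_self_eq_zero, add_zero])
          rw [if_neg fun h' => h2 h'.1.2, if_pos h, Finset.prod_range_succ', if_neg h3]
          simp
      · rw [if_neg fun h' => h h'.2, if_neg h, mul_zero]
    · intro b _ hb
      rw [if_neg fun h' => hb h'.1.1, mul_zero]
    · simp

end Bell

/-! ### The final state -/

namespace Par

variable {p : Par} {D : Matrix (OracleLabel p.n p.m) (OracleLabel p.n p.m) ℂ}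

/-- The Hamiltonian. -/
def ham (p : Par) : Matrix (Fin p.n → ZMod 2) (Fin p.n → ZMod 2) ℂ :=
  ∑ i ∈ Finset.range p.m, p.c i • p.op i

/-- The registers other than `BC` are in their final state. -/
def Rest (p : Par) (z : Fin p.size → ZMod 2) : Prop :=
  ∀ q : Fin p.size, ((q : ℕ) < p.m ∨ p.m + (p.n + p.n) ≤ q) →
    z q = p.lay 0 0 (Pi.single 0 1) (Pi.single 0 1) q

-- The Bell circuit turns the label `u` into the entries of Z^a X^b, with row index in B and column
-- index in C.
open Classical in
theorem run_bell (u : ℕ → ZMod 2) (z : Fin p.size → ZMod 2) :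
    run D p.size p.bellCirc (ket p.size (p.lay 0 u (Pi.single 0 1) (Pi.single 0 1))) z =
      if p.Rest z then (((√2)⁻¹ : ℝ) : ℂ) ^ p.n *
        zxTensor p.n u (regB p.m p.n z) (regC p.m p.n z) else 0 := by
  rw [bellCirc, run_bellPairs D p.n (fun k => p.m + k) (fun k => p.m + (p.n + k))
    (fun j hj => by simp only [size]; omega) (fun j hj => by simp only [size]; omega)
    (fun i hi j hj => by omega) (fun i hi j hj h => by omega) (fun i hi j hj h => by omega)]
  refine if_congr ⟨fun h q hq => ?_, fun h q hq => ?_⟩ ?_ rfl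
  · rw [h q fun j hj => by omega]
    unfold lay
    split_ifs <;> first | rfl | omega
  · have hq' : (q : ℕ) < p.m ∨ p.m + (p.n + p.n) ≤ q := by
      by_contra hc
      by_cases h1 : (q : ℕ) < p.m + p.n
      · exact (hq (q - p.m) (by omega)).1 (by omega)
      · exact (hq (q - (p.m + p.n)) (by omega)).2 (by omega)
    rw [h q hq']
    unfold lay
    split_ifs <;> first | rfl | omega
  · congr 1
    rw [zxTensor, tensor, Matrix.of_apply, ← Fin.prod_univ_eq_prod_range
      (fun j => if bit z (p.m + j) = bit z (p.m + (p.n + j)) +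
        p.lay 0 u (Pi.single 0 1) (Pi.single 0 1) (p.m + (p.n + j)) then
        sgn (p.lay 0 u (Pi.single 0 1) (Pi.single 0 1) (p.m + j)) (bit z (p.m + j)) else 0)]
    refine Finset.prod_congr rfl fun k _ => ?_
    rw [lay_u _ _ _ _ (by omega), lay_u _ _ _ _ (by omega), zx, Matrix.of_apply, regB, regC,
      add_assoc p.m]

/-- Row 0 of the last bond matrix is zero off its first entry, so preparing the walker at 0
suffices, up to the scalar `bond p.m 0 0`. The scalar stays on the left to avoid a division before
it is known to be nonzero. -/
theorem run_prep (D : Matrix (OracleLabel p.n p.m) (OracleLabel p.n p.m) ℂ) :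
    (p.bond p.m 0 0 : ℂ) • run D p.size p.prepCirc (ket p.size 0) =
      ∑ S ∈ (Finset.range p.m).powerset,
        (p.amp p.m 0 S : ℂ) • p.walk (setBits 0 S) 0 0 0 := by
  have hW : 0 < p.W := by change 0 < p.l + 1 + (p.l + 1); omega
  have h0 : (0 : ℕ → ZMod 2) = p.lay 0 0 0 0 := by
    funext q
    simp [lay]
  have h1 : run D p.size [.x [] (p.wq 0)] (ket p.size 0) = p.walk 0 0 0 0 := by
    rw [show ket p.size 0 = ket p.size (p.lay 0 0 0 0) from congrArg _ h0, run_cons, run_nil,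
      x₀_ket D (by simp only [wq, size]; omega), lay_w _ _ _ _ hW, update_w _ _ _ _ hW,
      Pi.zero_apply, zero_add]
    rfl
  rw [← run_sites D 0 0 p.m le_rfl 0 0 fun _ _ => rfl, rowKet_eq,
    Finset.sum_eq_single_of_mem 0 (by simp), prepCirc, run_append, map_smul]
  · rw [h1]
  · intro s hs hs0
    rw [Finset.mem_range] at hs
    rw [p.bond_lower p.m 0 (by omega) (by simp only [W]; omega)]
    simp

-- By linearity each set `S` is followed separately; all of them end with the same contents outside
-- BC, so the vectorised products add up coherently to the polynomial of the Hamiltonian.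
open Classical in
theorem run_mainCirc (hD : IsDecodingOracle p.vec p.l D) (hm : 1 ≤ p.m) (hl : 1 ≤ p.l)
    (hc : ∀ i < p.m, ∀ j < p.m, Commute (p.op i) (p.op j)) (Q : Polynomial ℝ)
    (hQ : Q.natDegree ≤ p.l) (ha : ∀ k ≤ p.l, p.a k = Q.coeff k) (z : Fin p.size → ZMod 2) :
    (p.bond p.m 0 0 : ℂ) * run D p.size p.mainCirc (ket p.size 0) z =
      if p.Rest z then (((√2)⁻¹ : ℝ) : ℂ) ^ p.n *
        Polynomial.aeval p.ham Q (regB p.m p.n z) (regC p.m p.n z) else 0 := by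
  have hamp := sum_amp_opProd p p.op (fun i _ => p.op_mul_self i) hc
    (fun i _ h => p.op_of_not_nontriv h) Q hQ ha p.m le_rfl 0
  rw [Function.iterate_zero_apply] at hamp
  have term : ∀ S ∈ (Finset.range p.m).powerset,
      (p.amp p.m 0 S : ℂ) * run D p.size (p.syndromeCirc ++ (p.flagCirc ++ ([.oracle] ++
        (p.unflagCirc ++ p.bellCirc)))) (p.walk (setBits 0 S) 0 0 0) z =
      if p.Rest z then (((√2)⁻¹ : ℝ) : ℂ) ^ p.n *
        (p.amp p.m 0 S • opProd p.op p.m S) (regB p.m p.n z) (regC p.m p.n z) else 0 := by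
    intro S hS
    rw [Finset.mem_powerset] at hS
    by_cases h0 : p.amp p.m 0 S = 0
    · simp [h0]
    obtain ⟨h1, h2⟩ := p.amp_support p.m 0 S hS h0
    obtain ⟨θ, e1, e2⟩ := run_syndrome D S (setBits 0 S) (Pi.single 0 1) 0 p.m le_rfl
      fun j _ => rfl
    have e3 := run_decode hD hm hl hS h1 h2 (Pi.single 0 1)
    rw [show p.syndromeCirc ++ (p.flagCirc ++ ([.oracle] ++ (p.unflagCirc ++ p.bellCirc))) =
      p.syndromeCirc ++ ((p.flagCirc ++ ([.oracle] ++ p.unflagCirc)) ++ p.bellCirc) by simp,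
      run_append, syndromeCirc, walk, e1, map_smul, run_append, e3, Pi.smul_apply, run_bell, e2]
    split_ifs
    · simp only [Matrix.smul_apply, smul_eq_mul, Complex.real_smul]; ring
    · simp
  have hrun : (p.bond p.m 0 0 : ℂ) • run D p.size p.mainCirc (ket p.size 0) =
      ∑ S ∈ (Finset.range p.m).powerset, (p.amp p.m 0 S : ℂ) •
        run D p.size (p.syndromeCirc ++ (p.flagCirc ++ ([.oracle] ++
          (p.unflagCirc ++ p.bellCirc)))) (p.walk (setBits 0 S) 0 0 0) := by
    rw [mainCirc, run_append, ← map_smul, run_prep, map_sum]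
    simp only [map_smul]
  have h := congrFun hrun z
  rw [Finset.sum_apply] at h
  simp only [Pi.smul_apply, smul_eq_mul] at h
  rw [h, Finset.sum_congr rfl term]
  split_ifs
  · rw [← Finset.mul_sum, ham, ← hamp, Matrix.sum_apply]
  · simp

end Par

/-! ### Legality of the circuits -/

section Valid

theorem unitary_of_sum {U : Matrix (ZMod 2) (ZMod 2) ℂ}
    (h : ∀ a b, U a 0 * star (U b 0) + U a 1 * star (U b 1) = if a = b then 1 else 0) :
    U ∈ Matrix.unitaryGroup (ZMod 2) ℂ := by
  rw [Matrix.mem_unitaryGroup_iff]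
  ext a b
  rw [Matrix.mul_apply, sum_zmod_two, Matrix.one_apply]
  exact h a b

theorem pauliX_mem : pauliX ∈ Matrix.unitaryGroup (ZMod 2) ℂ :=
  unitary_of_sum fun a b => by
    rcases zmod_two a with rfl | rfl <;> rcases zmod_two b with rfl | rfl <;> simp [pauliX]

theorem pauliZ_mem : pauliZ ∈ Matrix.unitaryGroup (ZMod 2) ℂ :=
  unitary_of_sum fun a b => by
    rcases zmod_two a with rfl | rfl <;> rcases zmod_two b with rfl | rfl <;> simp [pauliZ]

theorem phaseMat_mem : phaseMat ∈ Matrix.unitaryGroup (ZMod 2) ℂ :=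
  unitary_of_sum fun a b => by
    rcases zmod_two a with rfl | rfl <;> rcases zmod_two b with rfl | rfl <;> simp [phaseMat]

theorem inv_sqrt_two_mul_self : (((√2)⁻¹ : ℝ) : ℂ) * (((√2)⁻¹ : ℝ) : ℂ) = 2⁻¹ := by
  rw [← Complex.ofReal_mul, ← mul_inv, Real.mul_self_sqrt (by norm_num)]
  push_cast; rfl

theorem hadamard_mem : hadamard ∈ Matrix.unitaryGroup (ZMod 2) ℂ :=
  unitary_of_sum fun a b => by
    have h := inv_sqrt_two_mul_self
    simp only [hadamard, Matrix.of_apply, star_mul', Complex.star_def, Complex.conj_ofReal]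
    rcases zmod_two a with rfl | rfl <;> rcases zmod_two b with rfl | rfl <;>
      simp only [zero_ne_one, one_ne_zero, false_and, and_false, and_self, if_true, if_false,
        map_one, map_neg]
    · linear_combination 2 * h
    · ring
    · ring
    · linear_combination 2 * h

theorem rotation_mem {c s : ℝ} (h : c * c + s * s = 1) :
    rotation c s ∈ Matrix.unitaryGroup (ZMod 2) ℂ :=
  unitary_of_sum fun a b => by
    have h' : (c : ℂ) * c + s * s = 1 := by exact_mod_cast h
    rcases zmod_two a with rfl | rfl <;> rcases zmod_two b with rfl | rfl <;>
      simp [rotation]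
    · linear_combination h'
    · ring
    · ring
    · linear_combination h'

/-- A legal gate other than the oracle. -/
def Gate.Plain (N : ℕ) (g : Gate) : Prop := g.Valid N ∧ g.isOracle = false

variable {N : ℕ} {U : Matrix (ZMod 2) (ZMod 2) ℂ}

theorem plain₀ (hU : U ∈ Matrix.unitaryGroup (ZMod 2) ℂ) {t : ℕ} (ht : t < N) :
    (Gate.ctrl [] t U).Plain N :=
  ⟨⟨by simp, by simp, by simpa, hU⟩, rfl⟩

theorem plain₁ (hU : U ∈ Matrix.unitaryGroup (ZMod 2) ℂ) {s t : ℕ} (ht : t < N) (hs : s < N)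
    (hst : s ≠ t) : (Gate.ctrl [s] t U).Plain N :=
  ⟨⟨by simp, by simpa using hst.symm, by simp [ht, hs], hU⟩, rfl⟩

theorem plain₂ (hU : U ∈ Matrix.unitaryGroup (ZMod 2) ℂ) {r s t : ℕ} (ht : t < N) (hr : r < N)
    (hs : s < N) (hrt : r ≠ t) (hst : s ≠ t) (hrs : r ≠ s) : (Gate.ctrl [r, s] t U).Plain N :=
  ⟨⟨by simp, by simp [hrs, hrt.symm, hst.symm], by simp [ht, hs, hr], hU⟩, rfl⟩

theorem mem_desc {f : ℕ → List Gate} {k : ℕ} {g : Gate} (h : g ∈ desc f k) :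
    ∃ j < k, g ∈ f j := by
  induction k with
  | zero => simp [desc] at h
  | succ k ih =>
    rcases List.mem_append.1 h with h | h
    · exact ⟨k, by omega, h⟩
    · obtain ⟨j, hj, h⟩ := ih h
      exact ⟨j, by omega, h⟩

theorem countP_isOracle_eq_zero {gs : List Gate} (h : ∀ g ∈ gs, g.Plain N) :
    gs.countP Gate.isOracle = 0 :=
  List.countP_eq_zero.2 fun g hg => by simp [(h g hg).2]

namespace Par

variable (p : Par)

theorem plain_prepCirc : ∀ g ∈ p.prepCirc, g.Plain p.size := by
  have hw : ∀ s < p.W, p.wq s < p.size := fun s hs => by simp only [wq, size]; omega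
  intro g hg
  rcases List.mem_append.1 hg with h | h
  · rw [List.mem_singleton.1 h]
    exact plain₀ pauliX_mem (hw 0 (by change 0 < p.l + 1 + (p.l + 1); omega))
  obtain ⟨i, hi, h⟩ := mem_desc h
  have hi' : i < p.size := by simp only [size]; omega
  rcases List.mem_append.1 h with h | h
  · obtain ⟨r, hr, h⟩ := mem_desc h
    obtain ⟨q, hq, h⟩ := mem_desc h
    unfold givens at h
    split_ifs at h with hqr
    · simp at h
    have ne : p.wq r ≠ p.wq q := by simp only [wq]; omega
    have hr' := hw r (by simp only [W]; omega)
    have hq' := hw q hq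
    simp only [List.mem_cons, List.not_mem_nil, or_false] at h
    rcases h with rfl | rfl | rfl
    · exact plain₁ pauliX_mem hq' hr' ne
    · exact plain₁ (rotation_mem (cosG_sq_add_sinG_sq _ _ _)) hr' hq' ne.symm
    · exact plain₁ pauliX_mem hq' hr' ne
  · obtain ⟨s, hs, h⟩ := List.mem_flatMap.1 h
    rw [List.mem_range] at hs
    have h1 := hw s (by simp only [W]; omega)
    have h2 := hw (p.L + s) (by simp only [W]; omega)
    have ne : p.wq s ≠ p.wq (p.L + s) := by simp only [wq]; omega
    have ne1 : i ≠ p.wq s := by simp only [wq]; omega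
    have ne2 : i ≠ p.wq (p.L + s) := by simp only [wq]; omega
    simp only [merge, List.mem_cons, List.not_mem_nil, or_false] at h
    rcases h with rfl | rfl | rfl
    · exact plain₁ pauliX_mem hi' h2 ne2.symm
    · exact plain₁ pauliX_mem h1 h2 ne.symm
    · exact plain₂ pauliX_mem h2 hi' h1 ne2 ne ne1

theorem plain_syndromeCirc : ∀ g ∈ p.syndromeCirc, g.Plain p.size := by
  intro g hg
  obtain ⟨i, hi, h⟩ := List.mem_flatMap.1 hg
  obtain ⟨k, hk, h⟩ := List.mem_flatMap.1 h
  rw [List.mem_range] at hi hk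
  have b0 : i < p.size := by simp only [size]; omega
  have b1 : p.m + k < p.size := by simp only [size]; omega
  have b2 : p.m + (p.n + k) < p.size := by simp only [size]; omega
  have n1 : i ≠ p.m + k := by omega
  have n2 : i ≠ p.m + (p.n + k) := by omega
  unfold pauliCirc at h
  simp only [List.mem_append] at h
  rcases h with h | h | h | h <;> split_ifs at h <;> simp only [List.mem_singleton,
    List.not_mem_nil] at h <;> subst h
  · exact plain₁ pauliZ_mem b1 b0 n1
  · exact plain₁ pauliX_mem b1 b0 n1
  · exact plain₁ pauliX_mem b2 b0 n2
  · exact plain₁ phaseMat_mem b1 b0 n1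

theorem plain_flagShift {k : ℕ} (hk : k < p.n) : ∀ g ∈ p.flagShift k, g.Plain p.size := by
  intro g h
  have b0 : p.gq (p.n + p.n) < p.size := by simp only [gq, size]; omega
  unfold flagShift at h
  simp only [List.mem_append] at h
  rcases h with h | h <;> split_ifs at h <;> simp only [List.mem_singleton,
    List.not_mem_nil] at h <;> subst h <;>
    exact plain₁ pauliX_mem (by simp only [size]; omega) b0 (by simp only [gq]; omega)

theorem plain_ladder {j : ℕ} (hj : j < p.n + p.n) : ∀ g ∈ p.ladder j, g.Plain p.size := by
  intro g h
  have b0 : p.gq j < p.size := by simp only [gq, size]; omega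
  have b1 : p.gq (j + 1) < p.size := by simp only [gq, size]; omega
  have n1 : p.gq j ≠ p.gq (j + 1) := by simp only [gq]; omega
  simp only [ladder, List.mem_cons, List.not_mem_nil, or_false] at h
  rcases h with rfl | rfl
  · exact plain₁ pauliX_mem b1 b0 n1
  · exact plain₂ pauliX_mem b1 b0 (by simp only [size]; omega) n1 (by simp only [gq]; omega)
      (by simp only [gq]; omega)

theorem plain_flagCirc (hm : 1 ≤ p.m) : ∀ g ∈ p.flagCirc, g.Plain p.size := by
  intro g h
  simp only [flagCirc, List.mem_append, List.mem_singleton, List.mem_flatMap, List.mem_range] at h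
  rcases h with rfl | ⟨j, hj, h⟩ | rfl | ⟨k, hk, h⟩
  · exact plain₀ pauliX_mem (by simp only [gq, size]; omega)
  · exact p.plain_ladder hj g h
  · exact plain₁ pauliX_mem (by simp only [size]; omega) (by simp only [gq, size]; omega)
      (by simp only [gq]; omega)
  · exact p.plain_flagShift hk g h

theorem plain_unflagCirc : ∀ g ∈ p.unflagCirc, g.Plain p.size := by
  intro g h
  simp only [unflagCirc, List.mem_append, List.mem_flatMap, List.mem_range] at h
  rcases h with ⟨k, hk, h⟩ | h
  · exact p.plain_flagShift hk g h
  · obtain ⟨j, hj, h⟩ := mem_desc h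
    exact p.plain_ladder hj g h

theorem plain_bellPair {s t : ℕ} (hs : s < N) (ht : t < N) (hst : s ≠ t) :
    ∀ g ∈ bellPair s t, g.Plain N := by
  intro g h
  simp only [bellPair, List.mem_cons, List.not_mem_nil, or_false] at h
  rcases h with rfl | rfl
  · exact plain₀ hadamard_mem hs
  · exact plain₁ pauliX_mem ht hs hst

theorem plain_bellCirc : ∀ g ∈ p.bellCirc, g.Plain p.size := by
  intro g h
  simp only [bellCirc, List.mem_flatMap, List.mem_range] at h
  obtain ⟨k, hk, h⟩ := h
  exact plain_bellPair (by simp only [size]; omega) (by simp only [size]; omega) (by omega) g h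

theorem valid_mainCirc (hm : 1 ≤ p.m) : ∀ g ∈ p.mainCirc, g.Valid p.size := by
  intro g h
  simp only [mainCirc, List.mem_append, List.mem_singleton] at h
  rcases h with h | h | h | rfl | h | h
  · exact (p.plain_prepCirc g h).1
  · exact (p.plain_syndromeCirc g h).1
  · exact (p.plain_flagCirc hm g h).1
  · trivial
  · exact (p.plain_unflagCirc g h).1
  · exact (p.plain_bellCirc g h).1

theorem countP_mainCirc (hm : 1 ≤ p.m) : p.mainCirc.countP Gate.isOracle = 1 := by
  simp only [mainCirc, List.countP_append, countP_isOracle_eq_zero p.plain_prepCirc,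
    countP_isOracle_eq_zero p.plain_syndromeCirc, countP_isOracle_eq_zero (p.plain_flagCirc hm),
    countP_isOracle_eq_zero p.plain_unflagCirc, countP_isOracle_eq_zero p.plain_bellCirc]
  rfl

/-- The number of qubits of the circuit for polynomials of degree zero. -/
abbrev constSize : ℕ := p.m + (p.n + p.n) + (p.m + (p.n + p.n))

theorem plain_constCirc : ∀ g ∈ (List.range (p.m + (p.n + p.n))).flatMap
    (fun q => bellPair (p.m + (p.n + p.n) + q) q), g.Plain p.constSize := by
  intro g h
  simp only [List.mem_flatMap, List.mem_range] at h
  obtain ⟨k, hk, h⟩ := h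
  exact plain_bellPair (by simp only [constSize]; omega) (by simp only [constSize]; omega)
    (by omega) g h

theorem valid_constCirc : ∀ g ∈ p.constCirc, g.Valid p.constSize := by
  intro g h
  rcases List.mem_append.1 h with h | h
  · exact (p.plain_constCirc g h).1
  · rw [List.mem_singleton.1 h]; trivial

theorem countP_constCirc : p.constCirc.countP Gate.isOracle = 1 := by
  rw [constCirc, List.countP_append, countP_isOracle_eq_zero p.plain_constCirc]
  rfl

end Par

end Valid

/-! ### The output state -/

theorem sum_norm_ket (N : ℕ) (x : ℕ → ZMod 2) :
    ∑ z, star (ket N x z) * ket N x z = 1 := by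
  simp [ket, Pi.single_apply]

namespace Par

section Main

variable {p : Par} {D : Matrix (OracleLabel p.n p.m) (OracleLabel p.n p.m) ℂ}

theorem ham_isSelfAdjoint : star p.ham = p.ham := by
  rw [ham, star_sum]
  refine Finset.sum_congr rfl fun i _ => ?_
  rw [star_smul, star_trivial, Matrix.star_eq_conjTranspose, op_conjTranspose]

theorem aeval_ham_conjTranspose (Q : Polynomial ℝ) :
    (Polynomial.aeval p.ham Q).conjTranspose = Polynomial.aeval p.ham Q := by
  rw [← Matrix.star_eq_conjTranspose, Polynomial.aeval_eq_sum_range, star_sum]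
  refine Finset.sum_congr rfl fun i _ => ?_
  rw [star_smul, star_trivial, star_pow, ham_isSelfAdjoint]

/-- The final basis state with `b` and `e` in the registers `B` and `C`. -/
def final (p : Par) (b e : Fin p.n → ZMod 2) : Fin p.size → ZMod 2 := fun q =>
  p.lay 0 (fun j => if h : j < p.n then b ⟨j, h⟩ else if h : j - p.n < p.n then e ⟨j - p.n, h⟩
    else 0) (Pi.single 0 1) (Pi.single 0 1) q

theorem rest_final (b e : Fin p.n → ZMod 2) : p.Rest (p.final b e) := by
  intro q hq
  simp only [final, lay]
  split_ifs <;> first | rfl | omega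

theorem regB_final (b e : Fin p.n → ZMod 2) : regB p.m p.n (p.final b e) = b := by
  funext k
  rw [regB, bit_eq (by simp only [size]; omega), final, lay_u _ _ _ _ (by omega), dif_pos k.2]

theorem regC_final (b e : Fin p.n → ZMod 2) : regC p.m p.n (p.final b e) = e := by
  funext k
  rw [regC, bit_eq (by simp only [size]; omega), final]
  simp only [add_assoc p.m]
  rw [lay_u _ _ _ _ (by omega), dif_neg (by omega), dif_pos (by omega)]
  exact congrArg e (Fin.ext (by simp))

theorem eq_final {z : Fin p.size → ZMod 2} (h : p.Rest z) :
    z = p.final (regB p.m p.n z) (regC p.m p.n z) := by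
  funext q
  by_cases h1 : (q : ℕ) < p.m ∨ p.m + (p.n + p.n) ≤ q
  · rw [h q h1, rest_final _ _ q h1]
  by_cases h2 : (q : ℕ) < p.m + p.n
  · have := congrFun (regB_final (regB p.m p.n z) (regC p.m p.n z)) ⟨q - p.m, by omega⟩
    simp only [regB, bit] at this
    rw [dif_pos (by omega), dif_pos (by omega)] at this
    simp only [show p.m + ((q : ℕ) - p.m) = q by omega] at this
    exact this.symm
  · have := congrFun (regC_final (regB p.m p.n z) (regC p.m p.n z)) ⟨q - (p.m + p.n), by omega⟩
    simp only [regC, bit] at this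
    rw [dif_pos (by omega), dif_pos (by omega)] at this
    simp only [show p.m + p.n + ((q : ℕ) - (p.m + p.n)) = q by omega] at this
    exact this.symm

theorem setB_final (b b' e : Fin p.n → ZMod 2) : setB p.m (p.final b e) b' = p.final b' e := by
  have hr : p.Rest (setB p.m (p.final b e) b') := fun q hq => by
    rw [setB_of_notMem _ _ _ (by omega), rest_final _ _ q hq]
  rw [eq_final hr, regB_setB (by simp only [size]; omega)]
  congr 1
  conv_rhs => rw [← regC_final b e]
  funext k
  rw [regC, regC, bit_eq (by simp only [size]; omega), bit_eq (by simp only [size]; omega),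
    setB_of_notMem _ _ _ (by simp)]

/-- The final vector is κ times the entries of a self-adjoint `F`, so the reduced matrix is κ κ* `F`
`F`† = κ κ* `F`²; trace one then identifies κ κ* with the inverse of the trace of `F`². -/
theorem outputState_mainCirc (hD : IsDecodingOracle p.vec p.l D) (hm : 1 ≤ p.m) (hl : 1 ≤ p.l)
    (hc : ∀ i < p.m, ∀ j < p.m, Commute (p.op i) (p.op j)) (Q : Polynomial ℝ)
    (hQ : Q.natDegree ≤ p.l) (ha : ∀ k ≤ p.l, p.a k = Q.coeff k)
    (hF : Polynomial.aeval p.ham Q ≠ 0) :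
    outputState D p.size p.mainCirc = ((Polynomial.aeval p.ham Q) ^ 2).trace⁻¹ •
      (Polynomial.aeval p.ham Q) ^ 2 := by
  classical
  have hψ := run_mainCirc hD hm hl hc Q hQ ha
  have hH := aeval_ham_conjTranspose (p := p) Q
  generalize hFQ : Polynomial.aeval p.ham Q = F at *
  have hN : p.m + 2 * p.n ≤ p.size := by simp only [size]; omega
  have hN' : p.m + p.n ≤ p.size := by omega
  have norm : (outputState D p.size p.mainCirc).trace = 1 := by
    rw [trace_outputState D hN', finalVector_eq,
      sum_norm_run D hN hD.1 _ (p.valid_mainCirc hm), sum_norm_ket]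
  -- If this scalar were zero, `hψ` would make every entry of `F` vanish.
  have hbond : (p.bond p.m 0 0 : ℂ) ≠ 0 := by
    intro h0
    refine hF (Matrix.ext fun b e => ?_)
    have h := hψ (p.final b e)
    rw [h0, zero_mul, if_pos (rest_final b e), regB_final, regC_final] at h
    refine (mul_eq_zero.1 h.symm).resolve_left (pow_ne_zero _ ?_)
    simp
  set κ : ℂ := (((√2)⁻¹ : ℝ) : ℂ) ^ p.n / p.bond p.m 0 0 with hκ
  have hψ' : ∀ z, finalVector D p.size p.mainCirc z =
      if p.Rest z then κ * F (regB p.m p.n z) (regC p.m p.n z) else 0 := by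
    intro z
    rw [finalVector_eq, eq_comm, ← mul_right_inj' hbond, hψ z, mul_ite, mul_zero, hκ, ← mul_assoc,
      mul_div_cancel₀ _ hbond]
  have out : outputState D p.size p.mainCirc = (κ * star κ) • F ^ 2 := by
    ext b b'
    rw [outputState_apply D hN', Matrix.smul_apply, smul_eq_mul, pow_two]
    nth_rewrite 2 [← hH]
    rw [Matrix.mul_apply, Finset.mul_sum]
    symm
    refine Fintype.sum_of_injective (fun e => p.final b e) ?_ _ _ ?_ fun e => ?_
    · intro e e' h
      rw [← regC_final b e, ← regC_final b e']
      exact congrArg _ h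
    · intro x hx
      split_ifs with hb
      · rw [hψ' x, if_neg fun h => hx ⟨regC p.m p.n x, ?_⟩, zero_mul]
        rw [← hb]
        exact (eq_final h).symm
      · rfl
    · rw [if_pos (regB_final b e), setB_final, hψ', hψ', if_pos (rest_final _ _),
        if_pos (rest_final _ _), regB_final, regC_final, regB_final, regC_final,
        Matrix.conjTranspose_apply, star_mul']
      ring
  rw [out, Matrix.trace_smul, smul_eq_mul] at norm
  rw [out]
  congr 1
  exact eq_inv_of_mul_eq_one_left norm

end Main

end Par

/-! ### Polynomials of degree zero -/

section Const

variable {n m : ℕ}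

/-- The label `e` with the register `B` set to `b`. -/
def relabel (e : OracleLabel n m) (b : Fin n → ZMod 2) : OracleLabel n m :=
  (e.1, Sum.elim b (e.2 ∘ Sum.inr))

theorem eq_relabel_iff (e : OracleLabel n m) (b : Fin n → ZMod 2) :
    e = relabel e b ↔ e.2 ∘ Sum.inl = b := by
  constructor
  · intro h
    rw [h]; rfl
  · rintro rfl
    exact Prod.ext rfl (Sum.elim_comp_inl_inr e.2).symm

theorem sum_regB (b : Fin n → ZMod 2) :
    ∑ e : OracleLabel n m, (if e.2 ∘ Sum.inl = b then 1 else 0 : ℂ) = 2 ^ (m + n) := by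
  rw [Fintype.sum_prod_type]
  change ∑ _ : Fin m → ZMod 2, ∑ e : PauliLabel n, (if e ∘ Sum.inl = b then 1 else 0 : ℂ) = _
  rw [Finset.sum_const, Finset.card_univ, ← (Equiv.sumArrowEquivProdArrow _ _ _).symm.sum_comp,
    Fintype.sum_prod_type, Finset.sum_comm]
  have : ∀ c d : Fin n → ZMod 2,
      ((Equiv.sumArrowEquivProdArrow (Fin n) (Fin n) (ZMod 2)).symm (c, d)) ∘ Sum.inl = c :=
    fun _ _ => rfl
  simp [this, ZMod.card, pow_add]

variable {M : ℕ} (D : Matrix (OracleLabel n m) (OracleLabel n m) ℂ)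

/-- The second half of the qubits, as a label. -/
def upper (n m : ℕ) (x : Fin (M + M) → ZMod 2) : OracleLabel n m :=
  oracleLabel n m fun q : Fin M => bit x (M + q)

theorem setB_label (hM : M = m + (n + n)) (x : Fin (M + M) → ZMod 2) (b : Fin n → ZMod 2) :
    oracleLabel n m (setB m x b) = relabel (oracleLabel n m x) b := by
  refine Prod.ext (funext fun i => ?_) (funext fun k => ?_)
  · change bit (setB m x b) i = bit x i
    rw [bit_eq (by omega), bit_eq (by omega), setB_of_notMem _ _ _ (by simp)]
  · rcases k with k | k
    · exact congrFun (regB_setB (m := m) (by omega) x b) k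
    · change bit (setB m x b) (m + n + k) = bit x (m + n + k)
      rw [bit_eq (by omega), bit_eq (by omega), setB_of_notMem _ _ _ (by simp)]

theorem setB_upper (hM : M = m + (n + n)) (x : Fin (M + M) → ZMod 2) (b : Fin n → ZMod 2) :
    upper n m (setB m x b) = upper n m x := by
  unfold upper
  congr 1
  funext q
  rw [bit_eq (by omega), bit_eq (by omega), setB_of_notMem _ _ _ (by simp; omega)]

theorem label_upper_bijective (hM : M = m + (n + n)) :
    Function.Bijective fun x : Fin (M + M) → ZMod 2 => (oracleLabel n m x, upper n m x) := by
  rw [Fintype.bijective_iff_injective_and_card]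
  constructor
  · intro x y h
    obtain ⟨h1, h2⟩ := Prod.mk.inj h
    refine eq_of_oracleLabel_eq h1 fun q hq => ?_
    have h3 := eq_of_oracleLabel_eq (N := M) h2 fun q hq => by omega
    have h4 := congrFun h3 ⟨q - M, by omega⟩
    simp only [bit] at h4
    rw [dif_pos (by omega), dif_pos (by omega)] at h4
    simpa only [show M + ((q : ℕ) - M) = q by omega] using h4
  · simp only [Fintype.card_fun, Fintype.card_prod, Fintype.card_sum, Fintype.card_fin, ZMod.card,
      hM]
    ring

theorem label_restrict {N : ℕ} (hM : M = m + (n + n)) (x : Fin N → ZMod 2) :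
    oracleLabel n m (fun q : Fin M => bit x q) = oracleLabel n m x := by
  have hb : ∀ j < M, bit (fun q : Fin M => bit x q) j = bit x j := fun j hj => bit_eq hj _
  refine Prod.ext (funext fun i => hb i (by omega)) (funext fun k => ?_)
  rcases k with k | k
  · exact hb (m + k) (by omega)
  · exact hb (m + n + k) (by omega)

theorem oracle_mulVec_apply {N : ℕ} (hN : m + 2 * n ≤ N) (ψ : Vec N) (x : Fin N → ZMod 2) :
    (Gate.oracle.matrix D N).mulVec ψ x = ∑ e, D (oracleLabel n m x) e * ψ (fill x e) := by
  classical
  simp only [Matrix.mulVec, dotProduct, Gate.matrix, Matrix.of_apply]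
  rw [sum_fill (m := m) (n := n) hN x _ fun y hy => ?_]
  · refine Finset.sum_congr rfl fun e _ => ?_
    rw [if_pos fun q hq => (fill_of_le x e q hq).symm, oracleLabel_fill hN]
  · rw [if_neg fun h => hy fun q hq => (h q hq).symm, zero_mul]

end Const

namespace Par

variable {p : Par} {D : Matrix (OracleLabel p.n p.m) (OracleLabel p.n p.m) ℂ}

-- Applying `D` to one half of a maximally entangled state gives its vectorisation: row index in the
-- registers, column index in the ancillas.
open Classical in
theorem finalVector_constCirc (z : Fin p.constSize → ZMod 2) :
    finalVector D p.constSize p.constCirc z =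
      (((√2)⁻¹ : ℝ) : ℂ) ^ (p.m + (p.n + p.n)) * D (oracleLabel p.n p.m z) (upper p.n p.m z) := by
  have hN : p.m + 2 * p.n ≤ p.constSize := by simp only [constSize]; omega
  have hc : p.constSize = p.m + (p.n + p.n) + (p.m + (p.n + p.n)) := rfl
  have hb : ∀ e, run D p.constSize ((List.range (p.m + (p.n + p.n))).flatMap
      fun q => bellPair (p.m + (p.n + p.n) + q) q) (ket p.constSize 0) (fill z e) =
      if e = upper p.n p.m z then (((√2)⁻¹ : ℝ) : ℂ) ^ (p.m + (p.n + p.n)) else 0 := by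
    intro e
    have hup : ∀ j < p.m + (p.n + p.n), bit (fill z e) (p.m + (p.n + p.n) + j) =
        bit z (p.m + (p.n + p.n) + j) := fun j hj => by
      rw [bit_eq (by omega), bit_eq (by omega), fill_of_le _ _ _ (by simp; omega)]
    have heq : e = upper p.n p.m z ↔ ∀ j < p.m + (p.n + p.n),
        bit (fill z e) (p.m + (p.n + p.n) + j) = bit (fill z e) j := by
      have hl : oracleLabel p.n p.m (fun q : Fin (p.m + (p.n + p.n)) => bit (fill z e) q) = e := by
        rw [label_restrict rfl, oracleLabel_fill hN]
      generalize fill z e = x at *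
      subst hl
      constructor
      · intro h j hj
        have := congrFun (eq_of_oracleLabel_eq h fun q hq => by omega) ⟨j, hj⟩
        rw [hup j hj]
        exact this.symm
      · intro h
        refine congrArg _ (funext fun q => ?_)
        rw [← h q q.2, hup q q.2]
    rw [run_bellPairs D (p.m + (p.n + p.n)) (fun q => p.m + (p.n + p.n) + q) (fun q => q)
      (fun j hj => by simp only [constSize]; omega) (fun j hj => by simp only [constSize]; omega)
      (fun i hi j hj => by omega) (fun i hi j hj h => by omega) (fun i hi j hj h => h), if_pos]
    · simp only [Pi.zero_apply, add_zero, sgn, zero_ne_one, false_and, if_false]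
      by_cases h : e = upper p.n p.m z
      · rw [if_pos h, Finset.prod_eq_one, mul_one]
        exact fun j hj => if_pos (heq.1 h j (Finset.mem_range.1 hj))
      · rw [if_neg h]
        have h' := h
        rw [heq] at h'
        push Not at h'
        obtain ⟨j, hj, hne⟩ := h'
        rw [Finset.prod_eq_zero (Finset.mem_range.2 hj) (if_neg hne), mul_zero]
    · intro q hq
      exfalso
      by_cases h : (q : ℕ) < p.m + (p.n + p.n)
      · exact (hq q h).2 rfl
      · exact (hq (q - (p.m + (p.n + p.n))) (by omega)).1 (by omega)
  rw [finalVector_eq, constCirc, run_append, run_cons, run_nil, oracle_mulVec_apply D hN]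
  simp only [hb, mul_ite, mul_zero]
  rw [Finset.sum_ite_eq', if_pos (Finset.mem_univ _), mul_comm]

/-- Summing over the ancillas gives `D` `D`† = 1. The 2^{m+n} values of the remaining register
qubits, each with weight 2^{-(m+2n)}, leave 2^{-n}. -/
theorem outputState_constCirc (hD : D ∈ Matrix.unitaryGroup (OracleLabel p.n p.m) ℂ) :
    outputState D p.constSize p.constCirc = ((2 : ℂ) ^ p.n)⁻¹ • 1 := by
  classical
  have hM : p.m + (p.n + p.n) = p.m + (p.n + p.n) := rfl
  have hκ : (((√2)⁻¹ : ℝ) : ℂ) ^ (p.m + (p.n + p.n)) *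
      star ((((√2)⁻¹ : ℝ) : ℂ) ^ (p.m + (p.n + p.n))) = (2⁻¹ : ℂ) ^ (p.m + (p.n + p.n)) := by
    rw [star_pow, Complex.star_def, Complex.conj_ofReal, ← mul_pow, inv_sqrt_two_mul_self]
  have hD' : ∀ a b, ∑ e, D a e * star (D b e) = if a = b then 1 else 0 := by
    intro a b
    have := congrFun (congrFun (Matrix.mem_unitaryGroup_iff.1 hD) a) b
    rwa [Matrix.mul_apply, Matrix.one_apply] at this
  ext b b'
  rw [outputState_apply D (by simp only [constSize]; omega)]
  simp only [finalVector_constCirc, setB_label hM, setB_upper hM]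
  rw [Fintype.sum_bijective _ (label_upper_bijective (n := p.n) (m := p.m) hM) _
    (fun e => (2⁻¹ : ℂ) ^ (p.m + (p.n + p.n)) * (if e.1.2 ∘ Sum.inl = b then
      D e.1 e.2 * star (D (relabel e.1 b') e.2) else 0)) ?_]
  · rw [← Finset.mul_sum, Fintype.sum_prod_type]
    have h : ∀ e : OracleLabel p.n p.m, ∑ e' : OracleLabel p.n p.m,
        (if e.2 ∘ Sum.inl = b then D e e' * star (D (relabel e b') e') else 0) =
        (if b = b' then 1 else 0) * (if e.2 ∘ Sum.inl = b then 1 else 0 : ℂ) := by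
      intro e
      by_cases he : e.2 ∘ Sum.inl = b
      · simp only [if_pos he]
        rw [hD', mul_one]
        exact if_congr (by rw [eq_relabel_iff, he]) rfl rfl
      · simp only [if_neg he, Finset.sum_const_zero, mul_zero]
    simp only [h]
    rw [← Finset.mul_sum, sum_regB, Matrix.smul_apply, Matrix.one_apply, smul_eq_mul]
    by_cases hb : b = b'
    · rw [if_pos hb, one_mul, mul_one, ← add_assoc, pow_add, mul_comm, ← mul_assoc, ← mul_pow]
      simp
    · simp [hb]
  · intro x
    have : regB p.m p.n x = (oracleLabel p.n p.m x).2 ∘ Sum.inl := rfl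
    rw [mul_ite, mul_zero, this, ← hκ]
    refine if_congr Iff.rfl ?_ rfl
    rw [star_mul']
    ring

end Par

/-! ### The parameters of an input -/

section Input

variable {n m l : ℕ} (v : Fin m → PauliLabel n) (c : Fin m → ℝ) (a : ℕ → ℝ)

theorem zBit_ofInput (i : Fin m) (k : Fin n) :
    (Par.ofInput l v c a).zBit i k = v i (Sum.inl k) := by
  have h : (Par.ofInput l v c a).α i k = (v i (Sum.inl k)).val := by
    simp [Par.ofInput, inputStore]
  rw [Par.zBit, h]
  rcases zmod_two (v i (Sum.inl k)) with h | h <;> rw [h] <;> decide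

theorem xBit_ofInput (i : Fin m) (k : Fin n) :
    (Par.ofInput l v c a).xBit i k = v i (Sum.inr k) := by
  have h : (Par.ofInput l v c a).β i k = (v i (Sum.inr k)).val := by
    simp [Par.ofInput, inputStore]
  rw [Par.xBit, h]
  rcases zmod_two (v i (Sum.inr k)) with h | h <;> rw [h] <;> decide

theorem op_ofInput (i : Fin m) : (Par.ofInput l v c a).op i = pauli (v i) := by
  ext x y
  change ∏ k : Fin n, pauliOne ((Par.ofInput l v c a).zBit i k) ((Par.ofInput l v c a).xBit i k)
    (x k) (y k) = ∏ k, pauliOne (v i (Sum.inl k)) (v i (Sum.inr k)) (x k) (y k)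
  refine Finset.prod_congr rfl fun k _ => ?_
  rw [zBit_ofInput v c a i k, xBit_ofInput v c a i k]

theorem vec_ofInput : (Par.ofInput l v c a).vec = v := by
  funext i k
  rcases k with k | k
  · exact zBit_ofInput v c a i k
  · exact xBit_ofInput v c a i k

theorem ham_ofInput : (Par.ofInput l v c a).ham = hamiltonian v c := by
  unfold Par.ham hamiltonian
  refine (Fin.sum_univ_eq_sum_range (fun i => (Par.ofInput l v c a).c i •
    (Par.ofInput l v c a).op i) m).symm.trans (Finset.sum_congr rfl fun i _ => ?_)
  have h : (Par.ofInput l v c a).c i = c i := by simp [Par.ofInput, inputStore]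
  rw [h, op_ofInput v c a i, Complex.coe_smul]
  rfl

end Input

theorem size_le {m K : ℕ} (l n : ℕ) (hm : 1 ≤ m) (hK : 10 ≤ K) :
    10 * (m + l + n) ≤ K * m * (l + n + 1) ^ K := by
  have hX : l + n + 1 ≤ (l + n + 1) ^ K := Nat.le_self_pow (by omega) _
  rw [mul_assoc]
  refine Nat.mul_le_mul hK (le_trans ?_ (Nat.mul_le_mul_left m hX))
  nlinarith

theorem rhoP_C {n m : ℕ} (v : Fin m → PauliLabel n) (c : Fin m → ℝ) {a : ℝ} (ha : a ≠ 0) :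
    rhoP v c (Polynomial.C a) = ((2 : ℂ) ^ n)⁻¹ • 1 := by
  have ha' : (a : ℂ) ≠ 0 := by exact_mod_cast ha
  have h : Polynomial.aeval (hamiltonian v c) (Polynomial.C a) ^ 2 =
      ((a : ℂ) ^ 2) • (1 : Matrix (Fin n → ZMod 2) (Fin n → ZMod 2) ℂ) := by
    rw [Polynomial.aeval_C, Algebra.algebraMap_eq_smul_one, ← Complex.coe_smul, smul_pow, one_pow]
  rw [rhoP, h, Matrix.trace_smul, Matrix.trace_one, smul_smul]
  congr 1
  simp only [Fintype.card_fun, Fintype.card_fin, ZMod.card, smul_eq_mul]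
  push_cast
  field_simp

end HDQI

end

theorem mainTheorem1 :
    ∃ (prog : HDQI.Cmd) (K : ℕ),
      ∀ (n m l : ℕ) (v : Fin m → HDQI.PauliLabel n) (c : Fin m → ℝ) (P : Polynomial ℝ),
        1 ≤ m →
        Function.Injective (fun i => HDQI.pauli (v i)) →
        (∀ i j, Commute (HDQI.pauli (v i)) (HDQI.pauli (v j))) →
        P.natDegree = l →
        Polynomial.aeval (HDQI.hamiltonian v c) P ≠ 0 →
        ∃ (T N : ℕ) (τ : HDQI.Store),
          -- the program halts after `T` steps, with `T = O(m · poly(l, n))`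
          HDQI.Exec prog (HDQI.inputStore l v c P.coeff) T τ ∧
          T ≤ K * m * (l + n + 1) ^ K ∧
          -- it has run a legal circuit on `N` qubits, with `N = O(m · poly(l, n))`
          m + 2 * n ≤ N ∧ N ≤ K * m * (l + n + 1) ^ K ∧
          (∀ g ∈ τ.gates, g.Valid N) ∧
          -- with a single call of the oracle
          τ.gates.countP HDQI.Gate.isOracle = 1 ∧
          -- that outputs the state, whatever decoding oracle is plugged in
          ∀ D : Matrix (HDQI.OracleLabel n m) (HDQI.OracleLabel n m) ℂ,
            HDQI.IsDecodingOracle v l D →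
              HDQI.outputState D N τ.gates = HDQI.rhoP v c P := by
  obtain ⟨K, hK, hK'⟩ : ∃ K, 10 ≤ K ∧ ∀ (n m l : ℕ) (v : Fin m → HDQI.PauliLabel n)
      (c : Fin m → ℝ) (a : ℕ → ℝ), 1 ≤ m → ∃ T τ,
        HDQI.Exec HDQI.algorithm (HDQI.inputStore l v c a) T τ ∧ T ≤ K * m * (l + n + 1) ^ K ∧
          τ.gates = (HDQI.Par.ofInput l v c a).circuit :=
    ⟨100000, by norm_num, fun n m l v c a hm => HDQI.exec_algorithm l v c a hm⟩
  refine ⟨HDQI.algorithm, K, fun n m l v c P hm _ hcomm hP hne => ?_⟩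
  obtain ⟨T, τ, hexec, hT, hgates⟩ := hK' n m l v c P.coeff hm
  set p := HDQI.Par.ofInput l v c P.coeff with hp
  -- For m ≥ 1 the two circuits use m + 4n + 2l + 3 and 2m + 4n qubits, both at most 10 (m + l + n).
  have hN := HDQI.size_le l n hm hK
  have hs : p.size = m + (n + n) + (l + 1 + (l + 1)) + (n + n + 1) := rfl
  have hs₀ : p.constSize = m + (n + n) + (m + (n + n)) := rfl
  by_cases hl : 1 ≤ l
  · have hg : τ.gates = p.mainCirc := hgates.trans (if_pos hl)
    refine ⟨T, p.size, τ, hexec, hT, by omega, by omega, ?_, ?_, fun D hD => ?_⟩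
    · rw [hg]; exact p.valid_mainCirc hm
    · rw [hg]; exact p.countP_mainCirc hm
    · have hham : p.ham = HDQI.hamiltonian v c := HDQI.ham_ofInput v c P.coeff
      have hop : ∀ i (hi : i < m), p.op i = HDQI.pauli (v ⟨i, hi⟩) := fun i hi =>
        HDQI.op_ofInput v c P.coeff ⟨i, hi⟩
      have hD' : HDQI.IsDecodingOracle p.vec p.l D := by
        rw [HDQI.vec_ofInput v c P.coeff]; exact hD
      have h := HDQI.Par.outputState_mainCirc hD' hm hl
        (fun i hi j hj => by rw [hop i hi, hop j hj]; exact hcomm _ _) P hP.le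
        (fun k hk => by
          change (if 0 = 0 ∧ k ≤ l then P.coeff k else 0) = P.coeff k
          exact if_pos ⟨rfl, hk⟩) (by rw [hham]; exact hne)
      rw [hham] at h
      rw [hg]
      exact h
  · have hg : τ.gates = p.constCirc := hgates.trans (if_neg hl)
    refine ⟨T, p.constSize, τ, hexec, hT, by omega, by omega, ?_, ?_, fun D hD => ?_⟩
    · rw [hg]; exact p.valid_constCirc
    · rw [hg]; exact p.countP_constCirc
    · have hC := Polynomial.eq_C_of_natDegree_eq_zero (p := P) (by omega)
      have ha : P.coeff 0 ≠ 0 := fun h => hne (by rw [hC, h]; simp)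
      rw [hg, hC, HDQI.rhoP_C v c ha]
      exact HDQI.Par.outputState_constCirc (p := p) hD.1
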